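/- Let $A\to M$ be a special affine bundle of finite rank over a smooth finite-dimensional manifold $M$: a smooth affine bundle, with model vector bundle $\mathcal V(A)\to M$, together with a smooth nowhere vanishing section $v_A$ of $\mathcal V(A)$. Let $E\to M$ be its vector hull, i.e. $E_m$ is the quotient of the free vector space on the points $x_a$, $a\in A_m$, by the relations $x_{\lambda a+(1-\lambda)b}=\lambda x_a+(1-\lambda)x_b$, and let $\alpha_A\in \mathrm{Sec}_M(E^*)$ be the section with $A=\{\alpha_A=1\}$, $\mathcal V(A)=\{\alpha_A=0\}$; then $v_A$ is a section of $\mathcal V(A)\subset E$. We also regard $\alpha_A$ as a function on $E$. Let $\varphi_s:E\to E$, $\varphi_s(e)=e+s\,v_A$, and put $\underline E=E/\langle v_A\rangle$, $\underline{E^*}=E^*/\langle\alpha_A\rangle$. Let $\mathbb R\times\mathbb R$ act on $T^*E$ by $(s,t)\cdot\omega=(\varphi_{-s})^*\omega+t\,d\alpha_A$, and let $\widetilde{\mathbf T}^*=T^*E/(\mathbb R\times\mathbb R)$ be the space of orbits, with the structure of a double vector bundle $(\widetilde{\mathbf T}^*;\underline E,\underline{E^*};M)$ inherited from $(T^*E;E,E^*;M)$.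 Let $T^{\mathrm{hor}}E=\{X\in TE:\ d\alpha_A(X)=0\}$ be the set of horizontal tangent vectors, let $\mathbb R$ act on it by the tangent maps $T\varphi_s$, and let $\widetilde{\mathbf T}=T^{\mathrm{hor}}E/\mathbb R$ be the space of orbits $[X]$, with the structure inherited from the double vector bundle $(TE;E,TM;M)$. Recall that the core of a double vector bundle $(D;D_1,D_2;M)$ is the vector bundle $D_3\to M$ of those elements of $D$ that project to zero vectors of both $D_1\to M$ and $D_2\to M$, and that its vertical dual is the double vector bundle $(D^*_{D_1};D_1,D_3^*;M)$, where $D^*_{D_1}$ is the dual of the vector bundle $D\to D_1$. Then $(\widetilde{\mathbf T}^*;\underline E,\underline{E^*};M)$, its vertical dual, and $(\widetilde{\mathbf T};\underline E,TM;M)$ are smooth double vector bundles, and the vertical dual of $(\widetilde{\mathbf T}^*;\underline E,\underline{E^*};M)$ is canonically isomorphic to $(\widetilde{\mathbf T};\underline E,TM;M)$: there is an isomorphism of double vector bundles $\Psi$ from $(\widetilde{\mathbf T};\underline E,TM;M)$ onto this vertical dual, which is the identity on $\underline E$ and on $M$ and satisfies $$\langle \Psi([X]),[\omega]\rangle=\langle\omega,X\rangle\qquad\text{for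 all } e\in E,\ X\in T^{\mathrm{hor}}_eE,\ \omega\in T^*_eE .$$ Moreover, the core of $(\widetilde{\mathbf T};\underline E,TM;M)$ is canonically isomorphic, as a vector bundle over $M$, to the model vector bundle $\mathcal V(A)$: the map that sends $w\in\mathcal V(A)_m\subset E_m$ to the orbit of the vertical vector $\frac{d}{dt}\big|_{t=0}(t\,w)\in T_{0_m}E$ is an isomorphism of $\mathcal V(A)$ onto the core, and its composite with $\Psi$ is an isomorphism of $\mathcal V(A)$ onto the core of the vertical dual. -/

import Mathlib

open scoped Manifold ContDiff Topology
open Bundle Set Diffeology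

noncomputable section

universe u v

/-! ## Smooth spaces

Manifolds, embedded submanifolds, quotients of manifolds by surjective submersions and total spaces
of vector bundles are all treated as sets with a diffeology.  Manifolds embed fully faithfully in
this category: a map between manifolds is smooth if and only if it maps smooth plots to smooth
plots; embedded submanifolds carry the subspace diffeology, and quotient manifolds carry the
quotient diffeology. -/

/-- A set with a smooth structure (a diffeology). -/
structure SmoothSpace where
  carrier : Type u
  diffeology : DiffeologicalSpace carrier

namespace SmoothSpace

instance : CoeSort SmoothSpace.{u} (Type u) := ⟨SmoothSpace.carrier⟩

instance (X : SmoothSpace.{u}) : DiffeologicalSpace X := X.diffeology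

/-- A manifold, with all smooth maps from Euclidean spaces as plots. -/
def ofManifold {V H : Type*} [NormedAddCommGroup V] [NormedSpace ℝ V] [TopologicalSpace H]
    (I : ModelWithCorners ℝ V H) (X : Type u) [TopologicalSpace X] [ChartedSpace H X] :
    SmoothSpace.{u} where
  carrier := X
  diffeology := .ofCorePlotsOn
    { isPlotOn := fun {n} {s} _ p ↦ ContMDiffOn 𝓘(ℝ, EuclideanSpace ℝ (Fin n)) I ∞ p s
      isPlotOn_congr := fun _ _ _ h ↦ contMDiffOn_congr h
      isPlot_const := fun _ ↦ contMDiffOn_const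
      isPlotOn_reparam := fun _ _ _ h hp hf ↦ hp.comp hf.contMDiffOn h
      locality := fun _ _ h x hx ↦ by
        obtain ⟨v, hv, hxv, hp⟩ := h x hx
        exact ((hp x hxv).contMDiffAt (hv.mem_nhds hxv)).contMDiffWithinAt }

/-- The diffeology induced by a map `f : X → Y`: a map is a plot if its composite with `f` is. -/
@[reducible]
def induced {X : Type u} {Y : Type v} [dY : DiffeologicalSpace Y] (f : X → Y) :
    DiffeologicalSpace X where
  plots n := {p | IsPlot (f ∘ p)}
  constant_plots x := isPlot_const (x := f x)
  plot_reparam hp hf := isPlot_reparam hp hf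
  locality hp := dY.locality fun x ↦ by
    obtain ⟨s, hs, hx, h⟩ := hp x
    exact ⟨s, hs, hx, fun hf hf' ↦ h hf hf'⟩

/-- A subset with the subspace structure. -/
def sub (X : SmoothSpace.{u}) (S : Set X) : SmoothSpace.{u} where
  carrier := S
  diffeology := induced (Subtype.val : S → X)

/-- The product of two smooth spaces. -/
def prod (X : SmoothSpace.{u}) (Y : SmoothSpace.{v}) : SmoothSpace.{max u v} where
  carrier := X × Y
  diffeology := induced (Prod.fst : X × Y → X) ⊓ induced (Prod.snd : X × Y → Y)

/-- The quotient by (the equivalence relation generated by) `r`, with the quotient structure: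
the finest one for which the projection is smooth. -/
def quot (X : SmoothSpace.{u}) (r : X → X → Prop) : SmoothSpace.{u} where
  carrier := Quot r
  diffeology := .generateFrom {p | ∃ q : EuclideanSpace ℝ (Fin p.1) → X,
    IsPlot q ∧ p.2 = fun t ↦ Quot.mk r (q t)}

/-- The Euclidean space `ℝ^k`. -/
def euclidean (k : ℕ) : SmoothSpace.{0} where
  carrier := EuclideanSpace ℝ (Fin k)
  diffeology := inferInstance

/-- A point of `ℝ^k` as a vector. -/
def vec {k : ℕ} (y : euclidean k) : EuclideanSpace ℝ (Fin k) := y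

end SmoothSpace

/-! ## Vector bundles -/

/-- The structure maps of a (candidate) vector bundle `X → B`, given by their graphs:
`liesOver x b` says that `x` is projected onto `b`, `add x y z` says that `x, y, z` lie in one fibre
and `x + y = z`, and `smul t x y` says that `x, y` lie in one fibre and `t • x = y`. -/
structure VecFib (X : Type u) (B : Type v) where
  liesOver : X → B → Prop
  add : X → X → X → Prop
  smul : ℝ → X → X → Prop

namespace VecFib

variable {X : Type u} {B : Type v}

/-- `x` is the zero vector of its fibre. -/
def IsZero (V : VecFib X B) (x : X) : Prop := V.smul 0 x x

/-- The direct image of the structure under maps of the total space and of the base.  It is used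
for quotient maps: the structure maps of the quotient are defined through representatives. -/
def image {X' B' : Type*} (V : VecFib X B) (f : X → X') (g : B → B') : VecFib X' B' where
  liesOver x b := ∃ x₀ b₀, f x₀ = x ∧ g b₀ = b ∧ V.liesOver x₀ b₀
  add x y z := ∃ x₀ y₀ z₀, f x₀ = x ∧ f y₀ = y ∧ f z₀ = z ∧ V.add x₀ y₀ z₀
  smul t x y := ∃ x₀ y₀, f x₀ = x ∧ f y₀ = y ∧ V.smul t x₀ y₀

/-- The restriction of the structure to a subset of the total space. -/
def restrict (V : VecFib X B) (S : Set X) : VecFib S B where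
  liesOver x b := V.liesOver x b
  add x y z := V.add x y z
  smul t x y := V.smul t x y

/-- A point of the dual bundle: a base point and a linear functional on the fibre over it. -/
structure Dual (V : VecFib X B) where
  base : B
  toFun : {x : X // V.liesOver x base} → ℝ
  map_add : ∀ x y z, V.add x.1 y.1 z.1 → toFun z = toFun x + toFun y
  map_smul : ∀ t x y, V.smul t x.1 y.1 → toFun y = t * toFun x

/-- The dual bundle, with the pointwise operations on functionals. -/
def dual (V : VecFib X B) : VecFib V.Dual B where
  liesOver φ b := φ.base = b
  add φ ψ χ := φ.base = χ.base ∧ ψ.base = χ.base ∧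
    ∀ x hφ hψ hχ, χ.toFun ⟨x, hχ⟩ = φ.toFun ⟨x, hφ⟩ + ψ.toFun ⟨x, hψ⟩
  smul t φ ψ := φ.base = ψ.base ∧ ∀ x hφ hψ, ψ.toFun ⟨x, hψ⟩ = t * φ.toFun ⟨x, hφ⟩

/-- The total space of the dual bundle as a smooth space: a family of functionals is smooth if its
family of base points is smooth and if its values on smooth families of vectors are smooth. -/
def dualSpace {X : SmoothSpace.{u}} {B : SmoothSpace.{v}} (V : VecFib X B) :
    SmoothSpace.{max u v} where
  carrier := V.Dual
  diffeology := .generateFrom {p | IsPlot (fun t ↦ ((p.2 t).base : B)) ∧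
    ∀ (m : ℕ) (f : EuclideanSpace ℝ (Fin m) → EuclideanSpace ℝ (Fin p.1))
      (q : EuclideanSpace ℝ (Fin m) → X) (h : ∀ t, V.liesOver (q t) (p.2 (f t)).base),
      ContDiff ℝ ∞ f → IsPlot q → ContDiff ℝ ∞ (fun t ↦ (p.2 (f t)).toFun ⟨q t, h t⟩)}

/-- The part of the total space that lies over a subset of the base. -/
def overSet (V : VecFib X B) (U : Set B) : Set X := {x | ∃ b ∈ U, V.liesOver x b}

/-- `V` is a smooth real vector bundle of finite rank: the projection is a map, the operations are
fibrewise, and over a neighbourhood `U` of each point of the base there is a fibrewise linear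
diffeomorphism of the total space with `U × ℝ^k`. -/
def IsVectorBundle {X : SmoothSpace.{u}} {B : SmoothSpace.{v}} (V : VecFib X B) : Prop :=
  (∀ x, ∃! b, V.liesOver x b) ∧
  (∀ x y z, V.add x y z → ∃ b, V.liesOver x b ∧ V.liesOver y b ∧ V.liesOver z b) ∧
  (∀ t x y, V.smul t x y → ∃ b, V.liesOver x b ∧ V.liesOver y b) ∧
  ∀ b : B, ∃ U : Set B, IsOpen[dTopology] U ∧ b ∈ U ∧
    ∃ (k : ℕ) (Φ : X.sub (V.overSet U) ≃ (B.sub U).prod (SmoothSpace.euclidean k)),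
      DSmooth Φ ∧ DSmooth Φ.symm ∧
      (∀ x : V.overSet U, V.liesOver x.1 (Φ x).1.1) ∧
      (∀ x y z : V.overSet U, V.add x.1 y.1 z.1 ↔
        (Φ x).1 = (Φ z).1 ∧ (Φ y).1 = (Φ z).1 ∧
          SmoothSpace.vec (Φ z).2 = SmoothSpace.vec (Φ x).2 + SmoothSpace.vec (Φ y).2) ∧
      (∀ (t : ℝ) (x y : V.overSet U), V.smul t x.1 y.1 ↔
        (Φ x).1 = (Φ y).1 ∧
          SmoothSpace.vec (Φ y).2 = t • SmoothSpace.vec (Φ x).2)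

/-- `f`, with `g` on the bases, respects projections, sums and multiples. -/
def IsMorphism {X' B' : Type*} (V : VecFib X B) (V' : VecFib X' B') (f : X → X') (g : B → B') :
    Prop :=
  (∀ x b, V.liesOver x b → V'.liesOver (f x) (g b)) ∧
  (∀ x y z, V.add x y z → V'.add (f x) (f y) (f z)) ∧
  (∀ t x y, V.smul t x y → V'.smul t (f x) (f y))

/-- `f`, with `g` on the bases, is an isomorphism of smooth vector bundles. -/
def IsIso {X : SmoothSpace.{u}} {B : SmoothSpace.{v}} {X' B' : SmoothSpace}
    (V : VecFib X B) (V' : VecFib X' B') (f : X ≃ X') (g : B ≃ B') : Prop :=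
  DSmooth f ∧ DSmooth f.symm ∧ DSmooth g ∧ DSmooth g.symm ∧
    V.IsMorphism V' f g ∧ V'.IsMorphism V f.symm g.symm

end VecFib

/-! ## Double vector bundles -/

/-- The structure maps of a (candidate) double vector bundle: `vert` is `D → D₁`, `horiz` is
`D → D₂`, and `side₁`, `side₂` are `D₁ → M`, `D₂ → M`. -/
structure DoubleVecFib (D D₁ D₂ M : SmoothSpace) where
  vert : VecFib D D₁
  horiz : VecFib D D₂
  side₁ : VecFib D₁ M
  side₂ : VecFib D₂ M

namespace DoubleVecFib

variable {D D₁ D₂ M : SmoothSpace}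

/-- A double vector bundle: a commuting square of four smooth vector bundles such that `D` maps
onto `D₁ ×_M D₂`, each projection of `D` is linear for the other structure, and each operation of
one structure on `D` is linear for the other structure (interchange laws). -/
structure IsDoubleVectorBundle (𝒟 : DoubleVecFib D D₁ D₂ M) : Prop where
  vert : 𝒟.vert.IsVectorBundle
  horiz : 𝒟.horiz.IsVectorBundle
  side₁ : 𝒟.side₁.IsVectorBundle
  side₂ : 𝒟.side₂.IsVectorBundle
  comm : ∀ d d₁ d₂, 𝒟.vert.liesOver d d₁ → 𝒟.horiz.liesOver d d₂ →
    ∃ m, 𝒟.side₁.liesOver d₁ m ∧ 𝒟.side₂.liesOver d₂ m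
  surj : ∀ d₁ d₂ m, 𝒟.side₁.liesOver d₁ m → 𝒟.side₂.liesOver d₂ m →
    ∃ d, 𝒟.vert.liesOver d d₁ ∧ 𝒟.horiz.liesOver d d₂
  vert_add : ∀ x y z a b c, 𝒟.horiz.add x y z →
    𝒟.vert.liesOver x a → 𝒟.vert.liesOver y b → 𝒟.vert.liesOver z c → 𝒟.side₁.add a b c
  vert_smul : ∀ t x y a b, 𝒟.horiz.smul t x y →
    𝒟.vert.liesOver x a → 𝒟.vert.liesOver y b → 𝒟.side₁.smul t a b
  horiz_add : ∀ x y z a b c, 𝒟.vert.add x y z →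
    𝒟.horiz.liesOver x a → 𝒟.horiz.liesOver y b → 𝒟.horiz.liesOver z c → 𝒟.side₂.add a b c
  horiz_smul : ∀ t x y a b, 𝒟.vert.smul t x y →
    𝒟.horiz.liesOver x a → 𝒟.horiz.liesOver y b → 𝒟.side₂.smul t a b
  add_add : ∀ a b c d ab cd ac bd, 𝒟.vert.add a b ab → 𝒟.vert.add c d cd →
    𝒟.horiz.add a c ac → 𝒟.horiz.add b d bd →
    ∃ s, 𝒟.horiz.add ab cd s ∧ 𝒟.vert.add ac bd s
  vert_smul_add : ∀ t x y z x' y' z', 𝒟.horiz.add x y z → 𝒟.vert.smul t x x' →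
    𝒟.vert.smul t y y' → 𝒟.vert.smul t z z' → 𝒟.horiz.add x' y' z'
  horiz_smul_add : ∀ t x y z x' y' z', 𝒟.vert.add x y z → 𝒟.horiz.smul t x x' →
    𝒟.horiz.smul t y y' → 𝒟.horiz.smul t z z' → 𝒟.vert.add x' y' z'
  smul_smul : ∀ s t x y z, 𝒟.vert.smul s x y → 𝒟.horiz.smul t y z →
    ∃ w, 𝒟.horiz.smul t x w ∧ 𝒟.vert.smul s w z

/-- The core: the elements that project to zero vectors in both side bundles. -/
def coreSet (𝒟 : DoubleVecFib D D₁ D₂ M) : Set D :=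
  {d | ∃ d₁ d₂, 𝒟.vert.liesOver d d₁ ∧ 𝒟.side₁.IsZero d₁ ∧ 𝒟.horiz.liesOver d d₂ ∧ 𝒟.side₂.IsZero d₂}

/-- The total space of the core bundle. -/
def coreSpace (𝒟 : DoubleVecFib D D₁ D₂ M) : SmoothSpace := D.sub 𝒟.coreSet

/-- The core as a vector bundle over `M`. -/
def core (𝒟 : DoubleVecFib D D₁ D₂ M) : VecFib 𝒟.coreSpace M where
  liesOver c m := ∃ d₁, 𝒟.vert.liesOver c.1 d₁ ∧ 𝒟.side₁.liesOver d₁ m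
  add x y z := 𝒟.vert.add x.1 y.1 z.1
  smul t x y := 𝒟.vert.smul t x.1 y.1

/-- The vertical dual `(D*_{D₁}; D₁, K*; M)`, where the core bundle of `𝒟` is presented as a vector
bundle `C : K → M` together with the embedding `ι : K → D`.

A functional `φ` on the fibre of `D → D₁` over `d₁` is projected to the functional
`k ↦ φ (0_{d₁} + ι k)` on `K`, where `0_{d₁}` is the zero vector of the fibre over `d₁` and the sum
is that of `D → D₂`.  The operations over `K*` are
`⟨φ + ψ, x + y⟩ = ⟨φ, x⟩ + ⟨ψ, y⟩` and `⟨t φ, t x⟩ = t ⟨φ, x⟩`, where the sum `x + y` and the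
multiple `t x` are those of `D → D₂`. -/
def verticalDualOf (𝒟 : DoubleVecFib D D₁ D₂ M) {K : SmoothSpace} (C : VecFib K M) (ι : K → D) :
    DoubleVecFib 𝒟.vert.dualSpace D₁ C.dualSpace M where
  vert := 𝒟.vert.dual
  horiz :=
    let lies : 𝒟.vert.Dual → C.Dual → Prop := fun φ κ ↦
      𝒟.side₁.liesOver φ.base κ.base ∧
      ∀ (k : K) (hk : C.liesOver k κ.base) (z x : D) (hx : 𝒟.vert.liesOver x φ.base),
        𝒟.vert.liesOver z φ.base → 𝒟.vert.IsZero z → 𝒟.horiz.add z (ι k) x →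
        κ.toFun ⟨k, hk⟩ = φ.toFun ⟨x, hx⟩
    { liesOver := lies
      add := fun φ ψ χ ↦ (∃ κ, lies φ κ ∧ lies ψ κ ∧ lies χ κ) ∧
        𝒟.side₁.add φ.base ψ.base χ.base ∧
        ∀ x y z hx hy hz, 𝒟.horiz.add x y z →
          χ.toFun ⟨z, hz⟩ = φ.toFun ⟨x, hx⟩ + ψ.toFun ⟨y, hy⟩
      smul := fun t φ ψ ↦ (∃ κ, lies φ κ ∧ lies ψ κ) ∧
        𝒟.side₁.smul t φ.base ψ.base ∧
        ∀ x y hx hy, 𝒟.horiz.smul t x y → ψ.toFun ⟨y, hy⟩ = t * φ.toFun ⟨x, hx⟩ }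
  side₁ := 𝒟.side₁
  side₂ := C.dual

/-- The vertical dual of `𝒟`, over `D₁` and the dual of the core bundle. -/
def verticalDual (𝒟 : DoubleVecFib D D₁ D₂ M) :
    DoubleVecFib 𝒟.vert.dualSpace D₁ 𝒟.core.dualSpace M :=
  𝒟.verticalDualOf 𝒟.core (fun c ↦ c.1)

/-- The restriction of the structure to a subset of `D`, with the same sides. -/
def restrict (𝒟 : DoubleVecFib D D₁ D₂ M) (S : Set D) : DoubleVecFib (D.sub S) D₁ D₂ M where
  vert := 𝒟.vert.restrict S
  horiz := 𝒟.horiz.restrict S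
  side₁ := 𝒟.side₁
  side₂ := 𝒟.side₂

/-- The direct image of the structure (used for quotient maps `f`, `f₁`, `f₂`). -/
def image {D' D₁' D₂' : SmoothSpace} (𝒟 : DoubleVecFib D D₁ D₂ M) (f : D → D') (f₁ : D₁ → D₁')
    (f₂ : D₂ → D₂') : DoubleVecFib D' D₁' D₂' M where
  vert := 𝒟.vert.image f f₁
  horiz := 𝒟.horiz.image f f₂
  side₁ := 𝒟.side₁.image f₁ id
  side₂ := 𝒟.side₂.image f₂ id

/-- `(f, f₁, f₂)` is an isomorphism of double vector bundles over the identity of `M`. -/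
def IsIso {D' D₁' D₂' : SmoothSpace} (𝒟 : DoubleVecFib D D₁ D₂ M)
    (𝒟' : DoubleVecFib D' D₁' D₂' M) (f : D ≃ D') (f₁ : D₁ ≃ D₁') (f₂ : D₂ ≃ D₂') : Prop :=
  𝒟.vert.IsIso 𝒟'.vert f f₁ ∧ 𝒟.horiz.IsIso 𝒟'.horiz f f₂ ∧
    𝒟.side₁.IsIso 𝒟'.side₁ f₁ (Equiv.refl M) ∧ 𝒟.side₂.IsIso 𝒟'.side₂ f₂ (Equiv.refl M)

end DoubleVecFib

/-! ## Special affine bundles and their vector hulls -/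

/-- A special affine bundle of rank `k` over a `d`-dimensional manifold `M`: a family of affine
spaces with a smooth affine atlas (the gluing maps are `y ↦ L x y + c x` with smooth `L` and `c`),
and a smooth nowhere vanishing section of the model vector bundle.
(Only the values of `triv i` over `baseSet i` matter.) -/
structure SpecialAffineBundle (d k : ℕ) (M : Type u) [TopologicalSpace M]
    [ChartedSpace (EuclideanSpace ℝ (Fin d)) M] where
  /-- the fibre over a point -/
  Fiber : M → Type v
  /-- the model vector space of the fibre -/
  Model : M → Type v
  [addCommGroup : ∀ x, AddCommGroup (Model x)]
  [module : ∀ x, Module ℝ (Model x)]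
  [torsor : ∀ x, AddTorsor (Model x) (Fiber x)]
  /-- the index set of the atlas -/
  ι : Type u
  baseSet : ι → Set M
  isOpen_baseSet : ∀ i, IsOpen (baseSet i)
  indexAt : M → ι
  mem_baseSet_indexAt : ∀ x, x ∈ baseSet (indexAt x)
  triv : ∀ (_ : ι) (x : M), Fiber x ≃ᵃ[ℝ] EuclideanSpace ℝ (Fin k)
  smooth_triv : ∀ i j, ∃ (L : M → EuclideanSpace ℝ (Fin k) →L[ℝ] EuclideanSpace ℝ (Fin k))
    (c : M → EuclideanSpace ℝ (Fin k)),
    ContMDiffOn (𝓡 d) 𝓘(ℝ, EuclideanSpace ℝ (Fin k) →L[ℝ] EuclideanSpace ℝ (Fin k)) ∞ L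
      (baseSet i ∩ baseSet j) ∧
    ContMDiffOn (𝓡 d) 𝓘(ℝ, EuclideanSpace ℝ (Fin k)) ∞ c (baseSet i ∩ baseSet j) ∧
    ∀ x ∈ baseSet i ∩ baseSet j, ∀ y, triv j x ((triv i x).symm y) = L x y + c x
  /-- the distinguished section -/
  special : ∀ x, Model x
  special_ne_zero : ∀ x, special x ≠ 0
  smooth_special : ∀ i, ContMDiffOn (𝓡 d) 𝓘(ℝ, EuclideanSpace ℝ (Fin k)) ∞
    (fun x ↦ (triv i x).linear (special x)) (baseSet i)

attribute [instance] SpecialAffineBundle.addCommGroup SpecialAffineBundle.module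
  SpecialAffineBundle.torsor

namespace AffineHull

variable {V : Type v} {P : Type v} [AddCommGroup V] [Module ℝ V] [AddTorsor V P]

variable (P) in
/-- The relations `x_{aff(a, b; t)} = t x_a + (1 - t) x_b` in the free vector space on `P`. -/
def relations : Submodule ℝ (P →₀ ℝ) :=
  Submodule.span ℝ {g | ∃ (a b : P) (t : ℝ), g = Finsupp.single (AffineMap.lineMap b a t) 1
    - t • Finsupp.single a 1 - (1 - t) • Finsupp.single b 1}

variable (P) in
/-- The vector hull of an affine space. -/
abbrev Hull : Type v := (P →₀ ℝ) ⧸ relations P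

/-- The canonical immersion of an affine space into its vector hull. -/
def incl (a : P) : Hull P := (relations P).mkQ (Finsupp.single a 1)

/-- The canonical embedding `w ↦ [a + w] - [a]` of the model vector space into the vector hull
(it does not depend on `a`). -/
def modelIncl (w : V) : Hull P :=
  incl (w +ᵥ Classical.arbitrary P) - incl (Classical.arbitrary P)

variable (P) in
/-- The linear functional on the vector hull that is equal to `1` on the affine space. -/
def height : Hull P →ₗ[ℝ] ℝ :=
  (relations P).liftQ (Finsupp.linearCombination ℝ fun _ ↦ (1 : ℝ)) (by
    rw [relations, Submodule.span_le]
    rintro _ ⟨a, b, t, rfl⟩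
    simp)

theorem incl_lineMap (a b : P) (t : ℝ) :
    incl (AffineMap.lineMap b a t) = t • incl a + (1 - t) • incl b := by
  rw [← sub_eq_zero, ← sub_sub]
  simp only [incl, ← map_smul, ← map_sub]
  rw [Submodule.mkQ_apply, Submodule.Quotient.mk_eq_zero]
  exact Submodule.subset_span ⟨a, b, t, rfl⟩

variable {F : Type*} [AddCommGroup F] [Module ℝ F]

/-- The linear map `[a] ↦ (e a, 1)`. -/
def toProd (e : P ≃ᵃ[ℝ] F) : Hull P →ₗ[ℝ] F × ℝ :=
  (relations P).liftQ (Finsupp.linearCombination ℝ fun a ↦ (e a, (1 : ℝ))) (by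
    rw [relations, Submodule.span_le]
    rintro _ ⟨a, b, t, rfl⟩
    have : e (AffineMap.lineMap b a t) = t • e a + (1 - t) • e b := by
      rw [← AffineEquiv.coe_toAffineMap, AffineMap.apply_lineMap, AffineMap.lineMap_apply_module,
        add_comm]
    simp only [SetLike.mem_coe, LinearMap.mem_ker, map_sub, map_smul,
      Finsupp.linearCombination_single, this]
    ext <;> simp)

@[simp] theorem toProd_incl (e : P ≃ᵃ[ℝ] F) (a : P) : toProd e (incl a) = (e a, 1) := by
  simp [toProd, incl]

/-- The linear map `(y, s) ↦ [e⁻¹ y] - [e⁻¹ 0] + s [e⁻¹ 0]`. -/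
def ofProd (e : P ≃ᵃ[ℝ] F) : F × ℝ →ₗ[ℝ] Hull P :=
  have key : ∀ (t : ℝ) (y z : F), incl (e.symm (t • y + (1 - t) • z)) =
      t • incl (e.symm y) + (1 - t) • incl (e.symm z) := fun t y z ↦ by
    rw [← incl_lineMap]
    congr 1
    rw [← AffineEquiv.coe_toAffineMap, ← AffineMap.apply_lineMap, AffineMap.lineMap_apply_module,
      add_comm]
  have hsmul : ∀ (t : ℝ) (y : F), incl (e.symm (t • y)) =
      t • incl (e.symm y) + (1 - t) • incl (e.symm 0) := fun t y ↦ by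
    simpa using key t y 0
  { toFun := fun p ↦ incl (e.symm p.1) - incl (e.symm 0) + p.2 • incl (e.symm 0)
    map_add' := fun p q ↦ by
      have h1 := key (1 / 2) p.1 q.1
      have h2 := hsmul 2 ((1 / 2 : ℝ) • p.1 + (1 - 1 / 2 : ℝ) • q.1)
      have h3 : (2 : ℝ) • ((1 / 2 : ℝ) • p.1 + (1 - 1 / 2 : ℝ) • q.1) = p.1 + q.1 := by
        rw [smul_add, smul_smul, smul_smul]; norm_num
      rw [h3, h1] at h2
      simp only [Prod.fst_add, Prod.snd_add, h2]
      module
    map_smul' := fun t p ↦ by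
      simp only [Prod.smul_fst, Prod.smul_snd, hsmul, RingHom.id_apply, smul_eq_mul]
      module }

theorem ofProd_apply (e : P ≃ᵃ[ℝ] F) (p : F × ℝ) :
    ofProd e p = incl (e.symm p.1) - incl (e.symm 0) + p.2 • incl (e.symm 0) := rfl

/-- The linear coordinates `(y, s)` on the vector hull induced by affine coordinates. -/
def prodEquiv (e : P ≃ᵃ[ℝ] F) : Hull P ≃ₗ[ℝ] F × ℝ :=
  LinearEquiv.ofLinearMap (toProd e) (ofProd e)
    (by
      refine LinearMap.ext fun p ↦ ?_
      simp [ofProd_apply])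
    (by
      refine Submodule.linearMap_qext _ (Finsupp.lhom_ext' fun a ↦ LinearMap.ext_ring ?_)
      change ofProd e (toProd e (incl a)) = incl a
      simp [ofProd_apply])

theorem prodEquiv_apply (e : P ≃ᵃ[ℝ] F) (x : Hull P) : prodEquiv e x = toProd e x := rfl

theorem prodEquiv_symm_apply (e : P ≃ᵃ[ℝ] F) (p : F × ℝ) :
    (prodEquiv e).symm p = incl (e.symm p.1) - incl (e.symm 0) + p.2 • incl (e.symm 0) := rfl

end AffineHull

namespace SpecialAffineBundle

variable {d k : ℕ} {M : Type u} [TopologicalSpace M] [ChartedSpace (EuclideanSpace ℝ (Fin d)) M]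
  (𝒜 : SpecialAffineBundle.{u, v} d k M)

/-- The fibre `E_x` of the vector hull `E` of the affine bundle. -/
def E (x : M) : Type v := AffineHull.Hull (𝒜.Fiber x)

instance (x : M) : AddCommGroup (𝒜.E x) := inferInstanceAs (AddCommGroup (AffineHull.Hull _))

instance (x : M) : Module ℝ (𝒜.E x) := inferInstanceAs (Module ℝ (AffineHull.Hull _))

/-- The typical fibre of the vector hull. -/
abbrev HullModel (k : ℕ) : Type := EuclideanSpace ℝ (Fin k) × ℝ

/-- The linear coordinates on the vector hull induced by the atlas of the affine bundle. -/
def hullCoord (i : 𝒜.ι) (x : M) : 𝒜.E x ≃ₗ[ℝ] HullModel k := AffineHull.prodEquiv (𝒜.triv i x)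

instance (x : M) : TopologicalSpace (𝒜.E x) :=
  .induced (𝒜.hullCoord (𝒜.indexAt x) x) inferInstance

/-- The local trivialization of the vector hull induced by a local trivialization of the affine
bundle. -/
def hullPretriv (i : 𝒜.ι) : Pretrivialization (HullModel k) (π (HullModel k) 𝒜.E) where
  toFun z := (z.1, 𝒜.hullCoord i z.1 z.2)
  invFun p := ⟨p.1, (𝒜.hullCoord i p.1).symm p.2⟩
  source := π (HullModel k) 𝒜.E ⁻¹' 𝒜.baseSet i
  target := 𝒜.baseSet i ×ˢ univ
  map_source' z hz := ⟨hz, mem_univ _⟩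
  map_target' p hp := hp.1
  left_inv' z _ := by simp
  right_inv' p _ := by simp
  open_target := (𝒜.isOpen_baseSet i).prod isOpen_univ
  baseSet := 𝒜.baseSet i
  open_baseSet := 𝒜.isOpen_baseSet i
  source_eq := rfl
  target_eq := rfl
  proj_toFun _ _ := rfl

theorem hullPretriv_symm (i : 𝒜.ι) {x : M} (hx : x ∈ 𝒜.baseSet i) (p : HullModel k) :
    (𝒜.hullPretriv i).symm x p = (𝒜.hullCoord i x).symm p := by
  have h : x ∈ (𝒜.hullPretriv i).baseSet := hx
  rw [Pretrivialization.symm_apply _ h]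
  rfl

/-- The linear extension `(y, s) ↦ (L y + s c, s)` of the affine map `y ↦ L y + c`. -/
def linearExtension {F : Type*} [NormedAddCommGroup F] [NormedSpace ℝ F] (q : (F →L[ℝ] F) × F) :
    F × ℝ →L[ℝ] F × ℝ :=
  ContinuousLinearMap.inl ℝ F ℝ ∘L
    (q.1 ∘L ContinuousLinearMap.fst ℝ F ℝ + (ContinuousLinearMap.snd ℝ F ℝ).smulRight q.2) +
  ContinuousLinearMap.inr ℝ F ℝ ∘L ContinuousLinearMap.snd ℝ F ℝ

theorem contDiff_linearExtension {F : Type*} [NormedAddCommGroup F] [NormedSpace ℝ F] :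
    ContDiff ℝ ∞ (linearExtension (F := F)) := by
  have h1 : ContDiff ℝ ∞ fun q : (F →L[ℝ] F) × F ↦ q.1 ∘L ContinuousLinearMap.fst ℝ F ℝ :=
    contDiff_fst.clm_comp contDiff_const
  have h2 : ContDiff ℝ ∞ fun q : (F →L[ℝ] F) × F ↦
      (ContinuousLinearMap.snd ℝ F ℝ).smulRight q.2 :=
    contDiff_const.smulRight contDiff_snd
  exact (contDiff_const.clm_comp (h1.add h2)).add contDiff_const

theorem exists_hullCoordChange (i j : 𝒜.ι) : ∃ f : M → HullModel k →L[ℝ] HullModel k,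
    ContMDiffOn (𝓡 d) 𝓘(ℝ, HullModel k →L[ℝ] HullModel k) ∞ f (𝒜.baseSet i ∩ 𝒜.baseSet j) ∧
    ∀ x ∈ 𝒜.baseSet i ∩ 𝒜.baseSet j, ∀ p,
      f x p = 𝒜.hullCoord j x ((𝒜.hullCoord i x).symm p) := by
  obtain ⟨L, c, hL, hc, h⟩ := 𝒜.smooth_triv i j
  refine ⟨fun x ↦ linearExtension (L x, c x), ?_, ?_⟩
  · exact (contDiff_linearExtension (F := EuclideanSpace ℝ (Fin k))).contMDiff.comp_contMDiffOn (hL.prodMk_space hc)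
  · intro x hx p
    have h0 : 𝒜.triv j x ((𝒜.triv i x).symm 0) = c x := by simpa using h x hx 0
    change _ = AffineHull.prodEquiv (𝒜.triv j x) ((AffineHull.prodEquiv (𝒜.triv i x)).symm p)
    rw [AffineHull.prodEquiv_symm_apply, AffineHull.prodEquiv_apply, map_add, map_sub, map_smul,
      AffineHull.toProd_incl, AffineHull.toProd_incl, h x hx, h0]
    ext <;> simp [linearExtension]

/-- The vector bundle structure of the vector hull. -/
def hullPrebundle : VectorPrebundle ℝ (HullModel k) 𝒜.E where
  pretrivializationAtlas := range 𝒜.hullPretriv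
  pretrivialization_linear' := by
    rintro _ ⟨i, rfl⟩
    exact ⟨fun x _ ↦ (𝒜.hullCoord i x).toLinearMap.isLinear⟩
  pretrivializationAt x := 𝒜.hullPretriv (𝒜.indexAt x)
  mem_base_pretrivializationAt := 𝒜.mem_baseSet_indexAt
  pretrivialization_mem_atlas x := mem_range_self _
  exists_coordChange := by
    rintro _ ⟨i, rfl⟩ _ ⟨j, rfl⟩
    obtain ⟨f, hf, h⟩ := 𝒜.exists_hullCoordChange i j
    refine ⟨f, hf.continuousOn, fun x hx p ↦ ?_⟩
    rw [𝒜.hullPretriv_symm i hx.1]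
    exact h x hx p
  totalSpaceMk_isInducing x := by
    have h : Topology.IsInducing (𝒜.hullCoord (𝒜.indexAt x) x) := ⟨rfl⟩
    exact (Topology.isInducing_const_prod (x := x)).2 h

instance : TopologicalSpace (TotalSpace (HullModel k) 𝒜.E) := 𝒜.hullPrebundle.totalSpaceTopology

instance : FiberBundle (HullModel k) 𝒜.E := 𝒜.hullPrebundle.toFiberBundle

instance : VectorBundle ℝ (HullModel k) 𝒜.E := 𝒜.hullPrebundle.toVectorBundle

instance : 𝒜.hullPrebundle.IsContMDiff (𝓡 d) ∞ where
  exists_contMDiffCoordChange := by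
    rintro _ ⟨i, rfl⟩ _ ⟨j, rfl⟩
    obtain ⟨f, hf, h⟩ := 𝒜.exists_hullCoordChange i j
    refine ⟨f, hf, fun x hx p ↦ ?_⟩
    rw [𝒜.hullPretriv_symm i hx.1]
    exact h x hx p

instance : ContMDiffVectorBundle ∞ (HullModel k) 𝒜.E (𝓡 d) :=
  𝒜.hullPrebundle.contMDiffVectorBundle (𝓡 d)

/-! ### The bispecial structure of the hull -/

/-- The total space of the vector hull `E`. -/
abbrev Tot : Type (max u v) := TotalSpace (HullModel k) 𝒜.E

/-- The model with corners of the total space of `E`. -/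
abbrev modelE (d k : ℕ) := (𝓡 d).prod 𝓘(ℝ, HullModel k)

/-- The canonical embedding `V(A) → E` of the model vector bundle. -/
def modelIncl (x : M) (w : 𝒜.Model x) : 𝒜.E x := AffineHull.modelIncl (P := 𝒜.Fiber x) w

/-- The distinguished section `v_A` as a section of `E`. -/
def vA (x : M) : 𝒜.E x := 𝒜.modelIncl x (𝒜.special x)

/-- The linear function `α_A` on `E` with `A = {α_A = 1}` and `V(A) = {α_A = 0}`. -/
def αA (e : 𝒜.Tot) : ℝ := AffineHull.height (𝒜.Fiber e.1) e.2

/-- The translation `e ↦ e + t v_A` of `E`. -/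
def translate (t : ℝ) (e : 𝒜.Tot) : 𝒜.Tot := ⟨e.1, e.2 + t • 𝒜.vA e.1⟩

/-- The multiplication by `t` in the fibres of `E`. -/
def scale (t : ℝ) (e : 𝒜.Tot) : 𝒜.Tot := ⟨e.1, t • e.2⟩

/-! ### The smooth spaces and vector bundles of the construction -/

/-- The base manifold `M`. -/
def spaceM (_ : SpecialAffineBundle.{u, v} d k M) : SmoothSpace.{u} := .ofManifold (𝓡 d) M

/-- The manifold `E`. -/
def spaceE : SmoothSpace.{max u v} := .ofManifold (modelE d k) 𝒜.Tot

/-- The vector bundle `E → M`. -/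
def fibE : VecFib 𝒜.spaceE 𝒜.spaceM where
  liesOver e x := TotalSpace.proj (E := 𝒜.E) e = x
  add e f g := ∃ (x : M) (a b : 𝒜.E x), e = (⟨x, a⟩ : 𝒜.Tot) ∧ f = (⟨x, b⟩ : 𝒜.Tot) ∧
    g = (⟨x, a + b⟩ : 𝒜.Tot)
  smul t e f := f = 𝒜.scale t e

/-- The model vector bundle `V(A)`, as a subspace of `E`. -/
def spaceV : SmoothSpace.{max u v} where
  carrier := Σ x, 𝒜.Model x
  diffeology := SmoothSpace.induced (Y := 𝒜.spaceE)
    fun w : (Σ x, 𝒜.Model x) ↦ (⟨w.1, 𝒜.modelIncl w.1 w.2⟩ : 𝒜.Tot)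

/-- The vector bundle `V(A) → M`. -/
def fibV : VecFib 𝒜.spaceV 𝒜.spaceM where
  liesOver w x := Sigma.fst (β := 𝒜.Model) w = x
  add u v w := ∃ (x : M) (a b : 𝒜.Model x), u = (⟨x, a⟩ : Σ x, 𝒜.Model x) ∧
    v = (⟨x, b⟩ : Σ x, 𝒜.Model x) ∧ w = (⟨x, a + b⟩ : Σ x, 𝒜.Model x)
  smul t u v := ∃ (x : M) (a : 𝒜.Model x), u = (⟨x, a⟩ : Σ x, 𝒜.Model x) ∧
    v = (⟨x, t • a⟩ : Σ x, 𝒜.Model x)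

/-- The equivalence relation `e ∼ e + t v_A` on `E`. -/
def relE (e e' : 𝒜.spaceE) : Prop := ∃ t : ℝ, e' = 𝒜.translate t e

/-- The equivalence relation `f ∼ f + t α_A` on `E*`. -/
def relEDual (f f' : 𝒜.fibE.dualSpace) : Prop :=
  ∃ t : ℝ, VecFib.Dual.base f' = VecFib.Dual.base f ∧
    ∀ e h h', VecFib.Dual.toFun f' ⟨e, h'⟩ = VecFib.Dual.toFun f ⟨e, h⟩ + t * 𝒜.αA e

/-- `E/⟨v_A⟩`. -/
def reducedE : SmoothSpace := 𝒜.spaceE.quot 𝒜.relE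

/-- `E*/⟨α_A⟩`. -/
def reducedEDual : SmoothSpace := 𝒜.fibE.dualSpace.quot 𝒜.relEDual

section Tangent

variable [IsManifold (𝓡 d) ∞ M]

/-- The manifold `TM`. -/
def spaceTM (_ : SpecialAffineBundle.{u, v} d k M) : SmoothSpace.{u} :=
  .ofManifold (𝓡 d).tangent (TangentBundle (𝓡 d) M)

/-- The manifold `TE`. -/
def spaceTE : SmoothSpace.{max u v} :=
  .ofManifold (modelE d k).tangent (TangentBundle (modelE d k) 𝒜.Tot)

/-- The vector bundle `TM → M`. -/
def fibTM : VecFib 𝒜.spaceTM 𝒜.spaceM where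
  liesOver X x := TotalSpace.proj (E := (TangentSpace (𝓡 d) : M → Type)) X = x
  add X Y Z := ∃ (x : M) (a b : TangentSpace (𝓡 d) x), X = (⟨x, a⟩ : TangentBundle (𝓡 d) M) ∧
    Y = (⟨x, b⟩ : TangentBundle (𝓡 d) M) ∧ Z = (⟨x, a + b⟩ : TangentBundle (𝓡 d) M)
  smul t X Y := ∃ (x : M) (a : TangentSpace (𝓡 d) x), X = (⟨x, a⟩ : TangentBundle (𝓡 d) M) ∧
    Y = (⟨x, t • a⟩ : TangentBundle (𝓡 d) M)

/-- The total space of the direct sum `E ⊕ E`. -/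
abbrev TotSum : Type (max u v) := TotalSpace (HullModel k × HullModel k) (𝒜.E ×ᵇ 𝒜.E)

/-- The model with corners of the total space of `E ⊕ E`. -/
abbrev modelSum (d k : ℕ) := (𝓡 d).prod 𝓘(ℝ, HullModel k × HullModel k)

/-- The double vector bundle `(TE; E, TM; M)`.  The operations of `TE → TM` are the tangent maps
of the addition `E ⊕ E → E` and of the multiplications by scalars in the fibres of `E`. -/
def tangentDouble : DoubleVecFib 𝒜.spaceTE 𝒜.spaceE 𝒜.spaceTM 𝒜.spaceM where
  vert :=
    { liesOver := fun X e ↦ TotalSpace.proj (E := (TangentSpace (modelE d k) : 𝒜.Tot → Type)) X = e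
      add := fun X Y Z ↦ ∃ (e : 𝒜.Tot) (a b : TangentSpace (modelE d k) e),
        X = (⟨e, a⟩ : TangentBundle (modelE d k) 𝒜.Tot) ∧
        Y = (⟨e, b⟩ : TangentBundle (modelE d k) 𝒜.Tot) ∧
        Z = (⟨e, a + b⟩ : TangentBundle (modelE d k) 𝒜.Tot)
      smul := fun t X Y ↦ ∃ (e : 𝒜.Tot) (a : TangentSpace (modelE d k) e),
        X = (⟨e, a⟩ : TangentBundle (modelE d k) 𝒜.Tot) ∧
        Y = (⟨e, t • a⟩ : TangentBundle (modelE d k) 𝒜.Tot) }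
  horiz :=
    { liesOver := fun X Z ↦
        tangentMap (modelE d k) (𝓡 d) (TotalSpace.proj : 𝒜.Tot → M) X = Z
      add := fun X Y Z ↦ ∃ W : TangentBundle (modelSum d k) 𝒜.TotSum,
        tangentMap (modelSum d k) (modelE d k)
          (fun p : 𝒜.TotSum ↦ (⟨p.1, p.2.1⟩ : 𝒜.Tot)) W = X ∧
        tangentMap (modelSum d k) (modelE d k)
          (fun p : 𝒜.TotSum ↦ (⟨p.1, p.2.2⟩ : 𝒜.Tot)) W = Y ∧
        tangentMap (modelSum d k) (modelE d k)
          (fun p : 𝒜.TotSum ↦ (⟨p.1, p.2.1 + p.2.2⟩ : 𝒜.Tot)) W = Z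
      smul := fun t X Y ↦ tangentMap (modelE d k) (modelE d k) (𝒜.scale t) X = Y }
  side₁ := 𝒜.fibE
  side₂ := 𝒜.fibTM

/-- The vertical tangent vector at the zero of the fibre `E_x` defined by `e ∈ E_x`: the velocity
at `t = 0` of the curve `t ↦ t e`.  It identifies `E` with the core of `TE`. -/
def coreLift (e : 𝒜.spaceE) : 𝒜.spaceTE :=
  tangentMap 𝓘(ℝ, ℝ) (modelE d k) (fun t : ℝ ↦ 𝒜.scale t e)
    (⟨0, (1 : ℝ)⟩ : TangentBundle 𝓘(ℝ, ℝ) ℝ)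

/-- The cotangent bundle `T*E`, i.e. the dual bundle of `TE → E`. -/
def spaceTEDual : SmoothSpace := 𝒜.tangentDouble.vert.dualSpace

/-- The double vector bundle `(T*E; E, E*; M)`: the vertical dual of `(TE; E, TM; M)`, whose core
is `E`. -/
def cotangentDouble : DoubleVecFib 𝒜.spaceTEDual 𝒜.spaceE 𝒜.fibE.dualSpace 𝒜.spaceM :=
  𝒜.tangentDouble.verticalDualOf 𝒜.fibE 𝒜.coreLift

/-- The action of `ℝ` on `TE` induced by the translations along `v_A`. -/
def translateT (t : ℝ) (X : 𝒜.spaceTE) : 𝒜.spaceTE :=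
  tangentMap (modelE d k) (modelE d k) (𝒜.translate t) X

/-- The differential `dα_A` as a function on `TE`. -/
def dα (X : 𝒜.spaceTE) : ℝ := (tangentMap (modelE d k) 𝓘(ℝ, ℝ) 𝒜.αA X).2

/-- The orbit relation of the action `(s, t) · η = (φ_{-s})^* η + t dα_A` of `ℝ × ℝ` on `T*E`,
where `φ_s` is the translation by `s v_A`. -/
def relTEDual (η η' : 𝒜.spaceTEDual) : Prop :=
  ∃ s t : ℝ, VecFib.Dual.base η' = 𝒜.translate s (VecFib.Dual.base η) ∧
    ∀ Y hY hX, VecFib.Dual.toFun η' ⟨Y, hY⟩ =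
      VecFib.Dual.toFun η ⟨𝒜.translateT (-s) Y, hX⟩ + t * 𝒜.dα Y

/-- The space of orbits of `ℝ × ℝ` in `T*E`. -/
def reducedTEDual : SmoothSpace := 𝒜.spaceTEDual.quot 𝒜.relTEDual

/-- The double vector bundle of `ℝ × ℝ`-orbits in `T*E`, over `E/⟨v_A⟩` and `E*/⟨α_A⟩`. -/
def reducedCotangent :
    DoubleVecFib 𝒜.reducedTEDual 𝒜.reducedE 𝒜.reducedEDual 𝒜.spaceM :=
  𝒜.cotangentDouble.image (Quot.mk _) (Quot.mk _) (Quot.mk _)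

/-- The set of horizontal tangent vectors, i.e. those annihilated by `dα_A`. -/
def horizontal : Set 𝒜.spaceTE := {X | 𝒜.dα X = 0}

/-- The orbit relation of the action of `ℝ` on horizontal tangent vectors. -/
def relHor (X X' : 𝒜.spaceTE.sub 𝒜.horizontal) : Prop :=
  ∃ t : ℝ, (X' : 𝒜.horizontal).1 = 𝒜.translateT t (X : 𝒜.horizontal).1

/-- The space of orbits of horizontal tangent vectors. -/
def reducedHor : SmoothSpace := (𝒜.spaceTE.sub 𝒜.horizontal).quot 𝒜.relHor

/-- The double vector bundle of orbits of horizontal tangent vectors, over `E/⟨v_A⟩` and `TM`. -/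
def reducedHorizontal : DoubleVecFib 𝒜.reducedHor 𝒜.reducedE 𝒜.spaceTM 𝒜.spaceM :=
  (𝒜.tangentDouble.restrict 𝒜.horizontal).image (Quot.mk _) (Quot.mk _) id

end Tangent

end SpecialAffineBundle

/-! ## Charts of smooth spaces over a base -/

/-! Near each point of `M` there are coordinates in which everything becomes linear. Since `v_A`
does not vanish, a shear turns it into a constant vector, and `α_A` is already the last coordinate
of the vector hull. Hence `E` is locally `W × ((ℝ × F) × ℝ)` with `v_A = ((1, 0), 0)` and `α_A` the
last projection (`exists_isSpecialFrame`). Together with a chart `φ` of `M` this splits `TE` into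
point of `E`, velocity along `M` and velocity along the fibre, and dually splits `T*E`. In these
coordinates translation along `v_A` adds a constant to the point and leaves both velocities alone,
and `dα_A` is the last component of the fibre velocity. An orbit in `T*E` therefore forgets the
`v_A` component of the point and the last component of the fibre covector, and remembers everything
else (`relTEDual_iff`). An orbit of horizontal vectors forgets the `v_A` component of the point
only, and the fibre velocity of a horizontal vector lies in `ℝ × F` (`relHor_iff`). The local models
are `(F × ℝ) × (ℝ × F)* × (ℝ^d)*` for the reduced cotangent bundle and `(F × ℝ) × ℝ^d × (ℝ × F)` for
the reduced horizontal one, each in the order first side, second side, core. Vertical dualization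
keeps the first side, turns the dual of the core into the second side and the dual of the second
side into the core (`IsDecomp.verticalDualOf`). So the vertical dual of the first model is the
second one up to double duals, and the pairing of covectors with horizontal vectors is, in
coordinates, evaluation (`isPairing_iff`). The core of the horizontal model is `ℝ × F`, which is the
kernel of `α_A`, that is `V(A)`. The passage from local to global rests on one notion, the local
decomposition `IsDecomp`: coordinates `(a, b, c)` in which vertical operations act on `(b, c)` and
horizontal ones on `(a, c)`. Local decompositions imply all axioms of a double vector bundle
(`IsProj.isDoubleVectorBundle`) and survive restriction, quotients and vertical duals. The global
isomorphisms need no gluing: each is specified by a global, coordinate-free relation, and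
`exists_equiv_of_charts` shows that it is the graph of a bijection because it is the graph of a
linear isomorphism in every chart. -/

/-- Plots have all of `ℝ^n` as domain, so local statements must be moved to global maps. The
diffeomorphism of `ℝ^n` onto a ball inside `V` gives `f`, and its inverse on the ball gives `g`. -/
theorem exists_contDiff_into {n : ℕ} {V : Set (EuclideanSpace ℝ (Fin n))} (hV : IsOpen V)
    {t : EuclideanSpace ℝ (Fin n)} (ht : t ∈ V) :
    ∃ (f g : EuclideanSpace ℝ (Fin n) → EuclideanSpace ℝ (Fin n)) (W : Set _), ContDiff ℝ ∞ f ∧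
      (∀ s, f s ∈ V) ∧ IsOpen W ∧ t ∈ W ∧ ContDiffOn ℝ ∞ g W ∧ ∀ s ∈ W, f (g s) = s := by
  obtain ⟨ε, hε, hb⟩ := Metric.isOpen_iff.1 hV t ht
  refine ⟨OpenPartialHomeomorph.univBall t ε, (OpenPartialHomeomorph.univBall t ε).symm,
    Metric.ball t ε, OpenPartialHomeomorph.contDiff_univBall, fun s ↦ hb ?_, Metric.isOpen_ball,
    Metric.mem_ball_self hε, OpenPartialHomeomorph.contDiffOn_univBall_symm, fun s hs ↦ ?_⟩
  · rw [← OpenPartialHomeomorph.univBall_target t hε]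
    exact (OpenPartialHomeomorph.univBall t ε).map_source (by simp)
  · exact (OpenPartialHomeomorph.univBall t ε).right_inv
      (by rwa [OpenPartialHomeomorph.univBall_target t hε])

/-- Near a point of `V` the function is `(g ∘ f) ∘ e`, where `f` is a global reparametrization with
values in `V` and `e` its local smooth inverse. Hence composites with global maps into `V` detect
smoothness on `V`. -/
theorem contDiffOn_of_comp {n : ℕ} {F : Type*} [NormedAddCommGroup F] [NormedSpace ℝ F]
    {g : EuclideanSpace ℝ (Fin n) → F} {V : Set (EuclideanSpace ℝ (Fin n))} (hV : IsOpen V)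
    (h : ∀ f : EuclideanSpace ℝ (Fin n) → EuclideanSpace ℝ (Fin n), ContDiff ℝ ∞ f →
      (∀ s, f s ∈ V) → ContDiff ℝ ∞ (g ∘ f)) : ContDiffOn ℝ ∞ g V := by
  intro t ht
  obtain ⟨f, e, W, hf, hfV, hW, htW, he, hfe⟩ := exists_contDiff_into hV ht
  have h1 : ContDiffOn ℝ ∞ ((g ∘ f) ∘ e) W := (h f hf hfV).comp_contDiffOn he
  have h2 : ContDiffOn ℝ ∞ g W := h1.congr fun s hs ↦ by simp [hfe s hs]
  exact (h2.contDiffAt (hW.mem_nhds htW)).contDiffWithinAt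

theorem isPlot_of_locally {X : Type*} [DiffeologicalSpace X] {n : ℕ}
    {p : EuclideanSpace ℝ (Fin n) → X}
    (h : ∀ t, ∃ V : Set (EuclideanSpace ℝ (Fin n)), IsOpen V ∧ t ∈ V ∧
      ∀ (m : ℕ) (f : EuclideanSpace ℝ (Fin m) → EuclideanSpace ℝ (Fin n)), (∀ s, f s ∈ V) →
        ContDiff ℝ ∞ f → IsPlot (p ∘ f)) : IsPlot p :=
  DiffeologicalSpace.locality fun t ↦ by
    obtain ⟨V, hV, ht, h⟩ := h t
    exact ⟨V, hV, ht, fun hf hf' ↦ h _ _ hf hf'⟩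

/-- The coordinate `c : X → F` trivializes `pr : X → B` over the open subset `U` of the base. -/
structure IsChart {X : SmoothSpace.{u}} {B : SmoothSpace.{v}} {F : Type*} [NormedAddCommGroup F]
    [NormedSpace ℝ F] (pr : X → B) (U : Set B) (c : X → F) : Prop where
  isOpen : IsOpen[dTopology] U
  inj : ∀ {x y}, pr y ∈ U → pr x = pr y → c x = c y → x = y
  surj : ∀ b ∈ U, ∀ f, ∃ x, pr x = b ∧ c x = f
  contDiffOn : ∀ {n} (p : EuclideanSpace ℝ (Fin n) → X), IsPlot p →
    ContDiffOn ℝ ∞ (c ∘ p) ((pr ∘ p) ⁻¹' U)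
  isPlot : ∀ {n} (p : EuclideanSpace ℝ (Fin n) → X), (∀ t, pr (p t) ∈ U) → IsPlot (pr ∘ p) →
    ContDiff ℝ ∞ (c ∘ p) → IsPlot p

section Chart

variable {X : SmoothSpace.{u}} {B : SmoothSpace.{v}} {F : Type*} [NormedAddCommGroup F]
  [NormedSpace ℝ F] {pr : X → B} {U : Set B} {c : X → F}

/-- The maps whose projection is a plot and whose coordinate is smooth. -/
@[reducible]
def chartDiffeology (pr : X → B) (c : X → F) (hU : IsOpen[dTopology] U) :
    DiffeologicalSpace X where
  plots n := {p | IsPlot (pr ∘ p) ∧ ContDiffOn ℝ ∞ (c ∘ p) ((pr ∘ p) ⁻¹' U)}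
  constant_plots x := ⟨isPlot_const (x := pr x), contDiffOn_const (c := c x)⟩
  plot_reparam {n m p f} hp hf :=
    ⟨isPlot_reparam hp.1 hf, hp.2.comp hf.contDiffOn fun _ h ↦ h⟩
  locality {n p} hp := by
    have h1 : IsPlot (pr ∘ p) := isPlot_of_locally fun t ↦ by
      obtain ⟨V, hV, ht, h⟩ := hp t
      exact ⟨V, hV, ht, fun m f hf hf' ↦ (h hf hf').1⟩
    refine ⟨h1, fun t ht ↦ ?_⟩
    obtain ⟨V, hV, htV, h⟩ := hp t
    have hO : IsOpen ((pr ∘ p) ⁻¹' U) := isOpen_iff_preimages_plots.1 hU n _ h1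
    -- The locality hypothesis speaks only of composites with maps defined on a whole Euclidean
    -- space, so smoothness on the open set is tested by such maps.
    have h2 : ContDiffOn ℝ ∞ (c ∘ p) (V ∩ (pr ∘ p) ⁻¹' U) :=
      contDiffOn_of_comp (hV.inter hO) fun f hf hfV ↦
        contDiffOn_univ.1 ((h (fun s ↦ (hfV s).1) hf).2.mono fun s _ ↦ (hfV s).2)
    exact (h2.contDiffAt ((hV.inter hO).mem_nhds ⟨htV, ht⟩)).contDiffWithinAt

theorem IsChart.isOpen_preimage (h : IsChart pr U c) {n : ℕ} {p : EuclideanSpace ℝ (Fin n) → B}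
    (hp : IsPlot p) : IsOpen (p ⁻¹' U) :=
  isOpen_iff_preimages_plots.1 h.isOpen n p hp

theorem isOpen_preimage_of_dSmooth {X Y : Type*} [DiffeologicalSpace X] [DiffeologicalSpace Y]
    {f : X → Y} (hf : DSmooth f) {U : Set Y} (hU : IsOpen[dTopology] U) :
    IsOpen[dTopology] (f ⁻¹' U) :=
  isOpen_iff_preimages_plots.2 fun n p hp ↦
    isOpen_iff_preimages_plots.1 hU n (f ∘ p) (hf n p hp)

theorem IsChart.contDiff (h : IsChart pr U c) {n : ℕ} {p : EuclideanSpace ℝ (Fin n) → X}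
    (hp : IsPlot p) (hU : ∀ t, pr (p t) ∈ U) : ContDiff ℝ ∞ (c ∘ p) :=
  contDiffOn_univ.1 ((h.contDiffOn p hp).mono fun t _ ↦ hU t)

/-- A coordinate change by a linear isomorphism. -/
theorem IsChart.postcomp {F' : Type*} [NormedAddCommGroup F'] [NormedSpace ℝ F']
    (h : IsChart pr U c) (L : F ≃L[ℝ] F') : IsChart pr U (fun x ↦ L (c x)) where
  isOpen := h.isOpen
  inj hy hxy hc := h.inj hy hxy (L.injective hc)
  surj b hb f := by
    obtain ⟨x, hx, hc⟩ := h.surj b hb (L.symm f)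
    exact ⟨x, hx, by simp [hc]⟩
  contDiffOn p hp := L.contDiff.comp_contDiffOn (h.contDiffOn p hp)
  isPlot p hU hp hc := h.isPlot p hU hp (by
    have := L.symm.contDiff.comp hc
    simpa [Function.comp_def] using this)

variable {Y : SmoothSpace} {G : Type*} [NormedAddCommGroup G] [NormedSpace ℝ G]
  {ρ : Y → X} {e : Y → G}

/-- Coordinates of a tower `Y → X → B` stack: those of `X` over `B` followed by those of `Y` over
`X`. -/
theorem IsChart.comp (hX : IsChart pr U c) (hρ : DSmooth ρ) (hY : IsChart ρ (pr ⁻¹' U) e) :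
    IsChart (fun y ↦ pr (ρ y)) U (fun y ↦ (c (ρ y), e y)) where
  isOpen := hX.isOpen
  inj hy hxy hc := hY.inj hy (hX.inj hy hxy (Prod.ext_iff.1 hc).1) (Prod.ext_iff.1 hc).2
  surj b hb f := by
    obtain ⟨x, hx, hc⟩ := hX.surj b hb f.1
    obtain ⟨y, hy, he⟩ := hY.surj x (by simpa [hx] using hb) f.2
    exact ⟨y, by rw [hy, hx], by rw [hy, hc, he]⟩
  contDiffOn p hp := (hX.contDiffOn _ (hρ _ _ hp)).prodMk (hY.contDiffOn p hp)
  isPlot p hU hp hc := hY.isPlot p hU (hX.isPlot _ hU hp hc.fst) hc.snd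

/-- Converse of stacking: when the first block of coordinates over `B` is pulled back from a chart
of `X`, fixing the point of `X` fixes this block, and the remaining block is a chart of `Y` over
`X`. This turns coordinates of a double vector bundle over `M` into trivializations over its sides.
-/
theorem IsChart.of_comp (hpr : DSmooth pr) (hX : IsChart pr U c)
    (hY : IsChart (fun y ↦ pr (ρ y)) U (fun y ↦ (c (ρ y), e y))) : IsChart ρ (pr ⁻¹' U) e where
  isOpen := isOpen_preimage_of_dSmooth hpr hX.isOpen
  inj hy hxy hc := hY.inj hy (by rw [hxy]) (by rw [hxy, hc])
  surj x hx f := by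
    obtain ⟨y, hy, he⟩ := hY.surj (pr x) hx (c x, f)
    exact ⟨y, hX.inj hx hy (Prod.ext_iff.1 he).1, (Prod.ext_iff.1 he).2⟩
  contDiffOn p hp := (hY.contDiffOn p hp).snd
  isPlot p hU hp hc := hY.isPlot p hU (hpr _ _ hp) ((hX.contDiff hp hU).prodMk hc)

/-- A map that commutes with the projections is smooth if it is smooth in charts. -/
theorem dSmooth_of_charts {X' : SmoothSpace} {pr' : X' → B} {f : X → X'} (hpr : DSmooth pr)
    (hf : ∀ x, pr' (f x) = pr x)
    (h : ∀ b : B, ∃ (U : Set B) (F' : Type) (_ : NormedAddCommGroup F') (_ : NormedSpace ℝ F')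
      (c' : X' → F'), b ∈ U ∧ IsChart pr' U c' ∧
        ∀ (n : ℕ) (p : EuclideanSpace ℝ (Fin n) → X), IsPlot p → (∀ t, pr (p t) ∈ U) →
          ContDiff ℝ ∞ (fun t ↦ c' (f (p t)))) : DSmooth f := by
  intro n p hp
  refine isPlot_of_locally fun t ↦ ?_
  obtain ⟨U, F', _, _, c', hb, hc', hs⟩ := h (pr (p t))
  refine ⟨(pr ∘ p) ⁻¹' U, hc'.isOpen_preimage (hpr _ _ hp), hb, fun m g hg hg' ↦ ?_⟩
  have hpg : IsPlot (p ∘ g) := isPlot_reparam hp hg'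
  refine hc'.isPlot _ (fun s ↦ ?_) ?_ (hs m (p ∘ g) hpg hg)
  · simpa [hf] using hg s
  · have : (pr' ∘ (f ∘ p) ∘ g) = pr ∘ (p ∘ g) := by
      funext s; simp [hf]
    rw [this]
    exact hpr _ _ hpg

end Chart

/-! ## Projections and local trivializations -/

namespace VecFib

variable {X : SmoothSpace.{u}} {B : SmoothSpace.{v}}

/-- `pr` is the projection of `V`, and the operations are fibrewise. -/
structure IsProj (V : VecFib X B) (pr : X → B) : Prop where
  smooth : DSmooth pr
  liesOver_iff : ∀ {x b}, V.liesOver x b ↔ pr x = b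
  add : ∀ {x y z}, V.add x y z → pr x = pr z ∧ pr y = pr z
  smul : ∀ {t x y}, V.smul t x y → pr x = pr y

/-- The coordinate `c` is a linear local trivialization over `U`. -/
structure IsTriv {F : Type*} [NormedAddCommGroup F] [NormedSpace ℝ F] (V : VecFib X B)
    (pr : X → B) (U : Set B) (c : X → F) : Prop extends IsChart pr U c where
  add_iff : ∀ {x y z}, pr z ∈ U → pr x = pr z → pr y = pr z → (V.add x y z ↔ c z = c x + c y)
  smul_iff : ∀ {t x y}, pr y ∈ U → pr x = pr y → (V.smul t x y ↔ c y = t • c x)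

variable {V : VecFib X B} {pr : X → B} {U : Set B}

theorem IsTriv.isZero_iff {F : Type*} [NormedAddCommGroup F] [NormedSpace ℝ F] {c : X → F}
    (h : V.IsTriv pr U c) {x : X} (hx : pr x ∈ U) : V.IsZero x ↔ c x = 0 := by
  rw [IsZero, h.smul_iff hx rfl, zero_smul]

/-- The fibre model may be any finite-dimensional space (functionals, products, subspaces), which is
far easier to work with; only here is it replaced by `ℝ^k`, through `toEuclidean`. -/
theorem IsTriv.exists_trivialization {F : Type*} [NormedAddCommGroup F] [NormedSpace ℝ F]
    [FiniteDimensional ℝ F] {c : X → F} (hpr : V.IsProj pr) (h : V.IsTriv pr U c) :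
    ∃ (k : ℕ) (Φ : X.sub (V.overSet U) ≃ (B.sub U).prod (SmoothSpace.euclidean k)),
      DSmooth Φ ∧ DSmooth Φ.symm ∧
      (∀ x : V.overSet U, V.liesOver x.1 (Φ x).1.1) ∧
      (∀ x y z : V.overSet U, V.add x.1 y.1 z.1 ↔
        (Φ x).1 = (Φ z).1 ∧ (Φ y).1 = (Φ z).1 ∧
          SmoothSpace.vec (Φ z).2 = SmoothSpace.vec (Φ x).2 + SmoothSpace.vec (Φ y).2) ∧
      (∀ (t : ℝ) (x y : V.overSet U), V.smul t x.1 y.1 ↔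
        (Φ x).1 = (Φ y).1 ∧
          SmoothSpace.vec (Φ y).2 = t • SmoothSpace.vec (Φ x).2) := by
  let L := toEuclidean (E := F)
  have hmem : ∀ x : V.overSet U, pr x.1 ∈ U := fun ⟨x, b, hb, hx⟩ ↦ by
    rw [hpr.liesOver_iff] at hx
    simpa [hx] using hb
  -- `s b f` is the vector over `b` with coordinate `f`; it is unique, so the choice is the inverse
  -- of the coordinate map.
  choose s hs hcs using h.surj
  let Φ : V.overSet U ≃ U × EuclideanSpace ℝ (Fin (Module.finrank ℝ F)) :=
    { toFun := fun x ↦ (⟨pr x.1, hmem x⟩, L (c x.1))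
      invFun := fun p ↦ ⟨s p.1 p.1.2 (L.symm p.2), p.1, p.1.2, hpr.liesOver_iff.2 (hs _ _ _)⟩
      left_inv := fun x ↦ Subtype.ext (h.inj (hmem x) (hs _ _ _) (by simp [hcs]))
      right_inv := fun p ↦ by
        refine Prod.ext (Subtype.ext (hs _ _ _)) ?_
        simp [hcs] }
  refine ⟨Module.finrank ℝ F, Φ, ?_, ?_, ?_, ?_, ?_⟩
  · intro n p hp
    have hp' : IsPlot (fun t ↦ (p t).1) := hp
    have hp'' : IsPlot (fun t ↦ pr (p t).1) := hpr.smooth _ _ hp'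
    refine (DiffeologicalSpace.isPlot_inf_iff (X := U × EuclideanSpace ℝ (Fin _))).2 ⟨hp'', ?_⟩
    have h1 : ContDiff ℝ ∞ (fun t ↦ c (p t).1) := h.contDiff hp' fun t ↦ hmem (p t)
    have h2 : ContDiff ℝ ∞ (fun t ↦ L (c (p t).1)) := L.contDiff.comp h1
    exact h2.isPlot
  · intro n p hp
    have hp' := (DiffeologicalSpace.isPlot_inf_iff (X := U × EuclideanSpace ℝ (Fin _))).1 hp
    have h1 : IsPlot (fun t ↦ (p t).1.1) := hp'.1
    have h2 : IsPlot (fun t ↦ SmoothSpace.vec (p t).2) := hp'.2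
    have h3 : ContDiff ℝ ∞ (fun t ↦ L.symm (SmoothSpace.vec (p t).2)) :=
      L.symm.contDiff.comp h2.contDiff
    change IsPlot (fun t ↦ s (p t).1.1 (p t).1.2 (L.symm (p t).2))
    refine h.isPlot _ (fun t ↦ ?_) ?_ ?_
    · rw [hs]; exact (p t).1.2
    · have : (pr ∘ fun t ↦ s (p t).1.1 (p t).1.2 (L.symm (p t).2)) = fun t ↦ (p t).1.1 := by
        funext t; exact hs _ _ _
      rw [this]; exact h1
    · have : (c ∘ fun t ↦ s (p t).1.1 (p t).1.2 (L.symm (p t).2)) =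
          fun t ↦ L.symm (SmoothSpace.vec (p t).2) := by
        funext t; exact hcs _ _ _
      rw [this]; exact h3
  · intro x
    exact hpr.liesOver_iff.2 rfl
  · intro x y z
    change _ ↔ (⟨pr x.1, hmem x⟩ : U) = ⟨pr z.1, hmem z⟩ ∧ (⟨pr y.1, hmem y⟩ : U) = ⟨pr z.1, hmem z⟩ ∧
      L (c z.1) = L (c x.1) + L (c y.1)
    rw [Subtype.mk_eq_mk, Subtype.mk_eq_mk, ← map_add, L.injective.eq_iff]
    refine ⟨fun hadd ↦ ?_, fun ⟨hx, hy, hadd⟩ ↦ (h.add_iff (hmem z) hx hy).2 hadd⟩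
    obtain ⟨hx, hy⟩ := hpr.add hadd
    exact ⟨hx, hy, (h.add_iff (hmem z) hx hy).1 hadd⟩
  · intro t x y
    change _ ↔ (⟨pr x.1, hmem x⟩ : U) = ⟨pr y.1, hmem y⟩ ∧ L (c y.1) = t • L (c x.1)
    rw [Subtype.mk_eq_mk, ← map_smul, L.injective.eq_iff]
    refine ⟨fun hsm ↦ ?_, fun ⟨hx, hadd⟩ ↦ (h.smul_iff (hmem y) hx).2 hadd⟩
    have hx := hpr.smul hsm
    exact ⟨hx, (h.smul_iff (hmem y) hx).1 hsm⟩

theorem IsProj.isVectorBundle (hpr : V.IsProj pr)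
    (h : ∀ b, ∃ (U : Set B) (F : Type) (_ : NormedAddCommGroup F) (_ : NormedSpace ℝ F)
      (_ : FiniteDimensional ℝ F) (c : X → F), b ∈ U ∧ V.IsTriv pr U c) : V.IsVectorBundle := by
  refine ⟨fun x ↦ ⟨pr x, hpr.liesOver_iff.2 rfl, fun b hb ↦ (hpr.liesOver_iff.1 hb).symm⟩,
    fun x y z hadd ↦ ⟨pr z, ?_⟩, fun t x y hsm ↦ ⟨pr y, ?_⟩, fun b ↦ ?_⟩
  · simp only [hpr.liesOver_iff]
    exact ⟨(hpr.add hadd).1, (hpr.add hadd).2, trivial⟩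
  · simp only [hpr.liesOver_iff]
    exact ⟨hpr.smul hsm, trivial⟩
  · obtain ⟨U, F, _, _, _, c, hb, hc⟩ := h b
    exact ⟨U, hc.isOpen, hb, hc.exists_trivialization hpr⟩

end VecFib

/-! ### Double vector bundles from local decompositions. -/

namespace DoubleVecFib

variable {D D₁ D₂ M : SmoothSpace}

/-- The four projections of a double vector bundle. -/
structure IsProj (𝒟 : DoubleVecFib D D₁ D₂ M) (p₁ : D → D₁) (p₂ : D → D₂) (q₁ : D₁ → M)
    (q₂ : D₂ → M) : Prop where
  vert : 𝒟.vert.IsProj p₁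
  horiz : 𝒟.horiz.IsProj p₂
  side₁ : 𝒟.side₁.IsProj q₁
  side₂ : 𝒟.side₂.IsProj q₂
  comm : ∀ d, q₂ (p₂ d) = q₁ (p₁ d)

/-- The coordinates `a`, `b`, `c` are a local decomposition `U × A × B × C` of `𝒟`. -/
structure IsDecomp {A B C : Type*} [NormedAddCommGroup A] [NormedSpace ℝ A]
    [NormedAddCommGroup B] [NormedSpace ℝ B] [NormedAddCommGroup C] [NormedSpace ℝ C]
    (𝒟 : DoubleVecFib D D₁ D₂ M) (p₁ : D → D₁) (p₂ : D → D₂) (q₁ : D₁ → M)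
    (q₂ : D₂ → M) (U : Set M) (a : D₁ → A) (b : D₂ → B) (c : D → C) : Prop where
  side₁ : 𝒟.side₁.IsTriv q₁ U a
  side₂ : 𝒟.side₂.IsTriv q₂ U b
  total : IsChart (fun d ↦ q₁ (p₁ d)) U (fun d ↦ (a (p₁ d), b (p₂ d), c d))
  vert_add : ∀ {x y z}, q₁ (p₁ z) ∈ U → p₁ x = p₁ z → p₁ y = p₁ z →
    (𝒟.vert.add x y z ↔ b (p₂ z) = b (p₂ x) + b (p₂ y) ∧ c z = c x + c y)
  vert_smul : ∀ {t x y}, q₁ (p₁ y) ∈ U → p₁ x = p₁ y →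
    (𝒟.vert.smul t x y ↔ b (p₂ y) = t • b (p₂ x) ∧ c y = t • c x)
  horiz_add : ∀ {x y z}, q₁ (p₁ z) ∈ U → p₂ x = p₂ z → p₂ y = p₂ z →
    (𝒟.horiz.add x y z ↔ a (p₁ z) = a (p₁ x) + a (p₁ y) ∧ c z = c x + c y)
  horiz_smul : ∀ {t x y}, q₁ (p₁ y) ∈ U → p₂ x = p₂ y →
    (𝒟.horiz.smul t x y ↔ a (p₁ y) = t • a (p₁ x) ∧ c y = t • c x)

/-- `𝒟` has local decompositions. -/
def LocallyDecomposable (𝒟 : DoubleVecFib D D₁ D₂ M) (p₁ : D → D₁) (p₂ : D → D₂) (q₁ : D₁ → M)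
    (q₂ : D₂ → M) : Prop :=
  ∀ m : M, ∃ (U : Set M) (A B C : Type) (_ : NormedAddCommGroup A) (_ : NormedSpace ℝ A)
    (_ : FiniteDimensional ℝ A) (_ : NormedAddCommGroup B) (_ : NormedSpace ℝ B)
    (_ : FiniteDimensional ℝ B) (_ : NormedAddCommGroup C) (_ : NormedSpace ℝ C)
    (_ : FiniteDimensional ℝ C) (a : D₁ → A) (b : D₂ → B) (c : D → C),
    m ∈ U ∧ 𝒟.IsDecomp p₁ p₂ q₁ q₂ U a b c

variable {A B C : Type*} [NormedAddCommGroup A] [NormedSpace ℝ A]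
  [NormedAddCommGroup B] [NormedSpace ℝ B] [NormedAddCommGroup C] [NormedSpace ℝ C]
  {𝒟 : DoubleVecFib D D₁ D₂ M} {p₁ : D → D₁} {p₂ : D → D₂} {q₁ : D₁ → M} {q₂ : D₂ → M} {U : Set M}
  {a : D₁ → A} {b : D₂ → B} {c : D → C}

/-- Once the point of `D₁` is fixed, the coordinate `a` and the base point are fixed as well, and
`(b, c)` remain as linear coordinates of the fibre. -/
theorem IsDecomp.vert (h : 𝒟.IsProj p₁ p₂ q₁ q₂) (hd : 𝒟.IsDecomp p₁ p₂ q₁ q₂ U a b c) :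
    𝒟.vert.IsTriv p₁ (q₁ ⁻¹' U) (fun d ↦ (b (p₂ d), c d)) where
  toIsChart := IsChart.of_comp h.side₁.smooth hd.side₁.toIsChart hd.total
  add_iff hz hx hy := by
    rw [hd.vert_add hz hx hy, Prod.ext_iff]; rfl
  smul_iff hy hx := by
    rw [hd.vert_smul hy hx, Prod.ext_iff]; rfl

/-- The coordinates with the two sides exchanged. -/
def prodSwap (A B C : Type*) [NormedAddCommGroup A] [NormedSpace ℝ A]
    [NormedAddCommGroup B] [NormedSpace ℝ B] [NormedAddCommGroup C] [NormedSpace ℝ C] :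
    (A × B × C) ≃L[ℝ] (B × A × C) :=
  ((ContinuousLinearEquiv.prodAssoc ℝ A B C).symm.trans
    ((ContinuousLinearEquiv.prodComm ℝ A B).prodCongr (.refl ℝ C))).trans
    (ContinuousLinearEquiv.prodAssoc ℝ B A C)

theorem IsDecomp.horiz (h : 𝒟.IsProj p₁ p₂ q₁ q₂) (hd : 𝒟.IsDecomp p₁ p₂ q₁ q₂ U a b c) :
    𝒟.horiz.IsTriv p₂ (q₂ ⁻¹' U) (fun d ↦ (a (p₁ d), c d)) where
  toIsChart := by
    refine IsChart.of_comp h.side₂.smooth hd.side₂.toIsChart ?_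
    simp only [h.comm]
    exact hd.total.postcomp (prodSwap A B C)
  add_iff hz hx hy := by
    rw [hd.horiz_add (by simpa [h.comm] using hz) hx hy, Prod.ext_iff]; rfl
  smul_iff hy hx := by
    rw [hd.horiz_smul (by simpa [h.comm] using hy) hx, Prod.ext_iff]; rfl

/-- A point of `D` over `U` can be prescribed freely by a compatible pair of side points and a core
coordinate. The test vectors in later arguments are produced in this way. -/
theorem IsDecomp.exists_mk (h : 𝒟.IsProj p₁ p₂ q₁ q₂) (hd : 𝒟.IsDecomp p₁ p₂ q₁ q₂ U a b c)
    {d₁ : D₁} {d₂ : D₂} (h₁ : q₁ d₁ ∈ U) (h₂ : q₂ d₂ = q₁ d₁) (w : C) :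
    ∃ x, p₁ x = d₁ ∧ p₂ x = d₂ ∧ c x = w := by
  obtain ⟨x, hx, hc⟩ := (hd.vert h).surj d₁ h₁ (b d₂, w)
  rw [Prod.mk.injEq] at hc
  exact ⟨x, hx, hd.side₂.inj (by simpa [h₂] using h₁) (by rw [h.comm, hx, h₂]) hc.1, hc.2⟩

/-- In the model `U × A × B × C` vertical operations act on `(b, c)` with `a` fixed and horizontal
ones on `(a, c)` with `b` fixed. The interchange laws then amount to vector space identities in `C`,
together with the agreement of the relevant projections. -/
theorem IsProj.isDoubleVectorBundle (h : 𝒟.IsProj p₁ p₂ q₁ q₂)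
    (hloc : 𝒟.LocallyDecomposable p₁ p₂ q₁ q₂) : 𝒟.IsDoubleVectorBundle where
  vert := h.vert.isVectorBundle fun d₁ ↦ by
    obtain ⟨U, A, B, C, _, _, _, _, _, _, _, _, _, a, b, c, hm, hd⟩ := hloc (q₁ d₁)
    exact ⟨_, B × C, inferInstance, inferInstance, inferInstance, _, hm, hd.vert h⟩
  horiz := h.horiz.isVectorBundle fun d₂ ↦ by
    obtain ⟨U, A, B, C, _, _, _, _, _, _, _, _, _, a, b, c, hm, hd⟩ := hloc (q₂ d₂)
    exact ⟨_, A × C, inferInstance, inferInstance, inferInstance, _, hm, hd.horiz h⟩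
  side₁ := h.side₁.isVectorBundle fun m ↦ by
    obtain ⟨U, A, B, C, _, _, _, _, _, _, _, _, _, a, b, c, hm, hd⟩ := hloc m
    exact ⟨_, A, inferInstance, inferInstance, inferInstance, _, hm, hd.side₁⟩
  side₂ := h.side₂.isVectorBundle fun m ↦ by
    obtain ⟨U, A, B, C, _, _, _, _, _, _, _, _, _, a, b, c, hm, hd⟩ := hloc m
    exact ⟨_, B, inferInstance, inferInstance, inferInstance, _, hm, hd.side₂⟩
  comm d d₁ d₂ h₁ h₂ := by
    rw [h.vert.liesOver_iff] at h₁
    rw [h.horiz.liesOver_iff] at h₂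
    refine ⟨q₁ d₁, h.side₁.liesOver_iff.2 rfl, h.side₂.liesOver_iff.2 ?_⟩
    rw [← h₁, ← h₂, h.comm]
  surj d₁ d₂ m h₁ h₂ := by
    rw [h.side₁.liesOver_iff] at h₁
    rw [h.side₂.liesOver_iff] at h₂
    obtain ⟨U, A, B, C, _, _, _, _, _, _, _, _, _, a, b, c, hm, hd⟩ := hloc m
    obtain ⟨x, hx₁, hx₂, -⟩ := hd.exists_mk h (d₁ := d₁) (d₂ := d₂) (by rwa [h₁]) (by rw [h₁, h₂]) 0
    exact ⟨x, h.vert.liesOver_iff.2 hx₁, h.horiz.liesOver_iff.2 hx₂⟩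
  vert_add x y z d₁ d₁' d₁'' hadd hx hy hz := by
    rw [h.vert.liesOver_iff] at hx hy hz
    subst hx hy hz
    obtain ⟨U, A, B, C, _, _, _, _, _, _, _, _, _, a, b, c, hm, hd⟩ := hloc (q₁ (p₁ z))
    obtain ⟨hx, hy⟩ := h.horiz.add hadd
    rw [hd.horiz_add hm hx hy] at hadd
    refine (hd.side₁.add_iff hm ?_ ?_).2 hadd.1
    · rw [← h.comm, hx, h.comm]
    · rw [← h.comm, hy, h.comm]
  vert_smul t x y d₁ d₁' hsm hx hy := by
    rw [h.vert.liesOver_iff] at hx hy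
    subst hx hy
    obtain ⟨U, A, B, C, _, _, _, _, _, _, _, _, _, a, b, c, hm, hd⟩ := hloc (q₁ (p₁ y))
    have hx := h.horiz.smul hsm
    rw [hd.horiz_smul hm hx] at hsm
    refine (hd.side₁.smul_iff hm ?_).2 hsm.1
    rw [← h.comm, hx, h.comm]
  horiz_add x y z d₁ d₁' d₁'' hadd hx hy hz := by
    rw [h.horiz.liesOver_iff] at hx hy hz
    subst hx hy hz
    obtain ⟨U, A, B, C, _, _, _, _, _, _, _, _, _, a, b, c, hm, hd⟩ := hloc (q₁ (p₁ z))
    obtain ⟨hx, hy⟩ := h.vert.add hadd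
    rw [hd.vert_add hm hx hy] at hadd
    refine (hd.side₂.add_iff (by rwa [h.comm]) ?_ ?_).2 hadd.1
    · rw [h.comm, hx, h.comm]
    · rw [h.comm, hy, h.comm]
  horiz_smul t x y d₁ d₁' hsm hx hy := by
    rw [h.horiz.liesOver_iff] at hx hy
    subst hx hy
    obtain ⟨U, A, B, C, _, _, _, _, _, _, _, _, _, a, b, c, hm, hd⟩ := hloc (q₁ (p₁ y))
    have hx := h.vert.smul hsm
    rw [hd.vert_smul hm hx] at hsm
    refine (hd.side₂.smul_iff (by rwa [h.comm]) ?_).2 hsm.1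
    rw [h.comm, hx, h.comm]
  add_add w x y z wx yz wy xz h1 h2 h3 h4 := by
    obtain ⟨U, A, B, C, _, _, _, _, _, _, _, _, _, a, b, c, hm, hd⟩ := hloc (q₁ (p₁ wx))
    obtain ⟨v1, v2⟩ := h.vert.add h1
    obtain ⟨v3, v4⟩ := h.vert.add h2
    obtain ⟨v5, v6⟩ := h.horiz.add h3
    obtain ⟨v7, v8⟩ := h.horiz.add h4
    have e : ∀ {s t}, p₂ s = p₂ t → q₁ (p₁ s) = q₁ (p₁ t) := fun {s t} e ↦ by
      rw [← h.comm, ← h.comm, e]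
    have hw : q₁ (p₁ w) ∈ U := by rwa [v1]
    have hx : q₁ (p₁ x) ∈ U := by rwa [v2]
    have hwy : q₁ (p₁ wy) ∈ U := by rwa [← e v5]
    have hxz : q₁ (p₁ xz) ∈ U := by rwa [← e v7]
    have hyz : q₁ (p₁ yz) ∈ U := by rw [← v4, e v8]; exact hxz
    rw [hd.vert_add hm v1 v2] at h1
    rw [hd.vert_add hyz v3 v4] at h2
    rw [hd.horiz_add hwy v5 v6] at h3
    rw [hd.horiz_add hxz v7 v8] at h4
    -- The horizontal summands agree in `D₁`: `w` with `x`, and `y` with `z`. Since the coordinate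
    -- `a` is additive for horizontal sums, the two sums lie over the same point of `D₁`.
    have hp₁ : p₁ wy = p₁ xz := by
      refine hd.side₁.inj hxz ?_ ?_
      · rw [← e v5, ← e v7, v1, v2]
      · rw [h3.1, h4.1, v1, v2, v3, v4]
    have hp₂ : p₂ wx = p₂ yz := by
      refine hd.side₂.inj (by rwa [h.comm]) ?_ ?_
      · rw [h.comm, h.comm, ← v1, ← v3, e v5, e v6]
      · rw [h1.1, h2.1, v5, v6, v7, v8]
    -- The total sum is built from its side points and the sum of the four core coordinates; both
    -- orders of summation lead to it.
    obtain ⟨s, hs₁, hs₂, hs⟩ := hd.exists_mk h (d₁ := p₁ xz) (d₂ := p₂ yz) hxz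
      (by rw [h.comm, ← v4, e v8]) (c wx + c yz)
    refine ⟨s, (hd.horiz_add (by rwa [hs₁]) (by rw [hs₂, hp₂]) hs₂.symm).2 ⟨?_, hs⟩,
      (hd.vert_add (by rwa [hs₁]) (by rw [hs₁, hp₁]) hs₁.symm).2 ⟨?_, ?_⟩⟩
    · rw [hs₁, h4.1, v2, v4]
    · rw [hs₂, h2.1, v6, v8]
    · rw [hs, h1.2, h2.2, h3.2, h4.2]; abel
  vert_smul_add t x y z x' y' z' hadd hx hy hz := by
    obtain ⟨U, A, B, C, _, _, _, _, _, _, _, _, _, a, b, c, hm, hd⟩ := hloc (q₁ (p₁ z'))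
    have ex := h.vert.smul hx
    have ey := h.vert.smul hy
    have ez := h.vert.smul hz
    obtain ⟨e1, e2⟩ := h.horiz.add hadd
    have e : ∀ {s t}, p₂ s = p₂ t → q₁ (p₁ s) = q₁ (p₁ t) := fun {s t} e ↦ by
      rw [← h.comm, ← h.comm, e]
    have hmz : q₁ (p₁ z) ∈ U := by rwa [ez]
    have hx' : q₁ (p₁ x') = q₁ (p₁ z') := by rw [← ex, e e1, ez]
    have hy' : q₁ (p₁ y') = q₁ (p₁ z') := by rw [← ey, e e2, ez]
    rw [hd.horiz_add hmz e1 e2] at hadd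
    rw [hd.vert_smul (by rwa [hx']) ex] at hx
    rw [hd.vert_smul (by rwa [hy']) ey] at hy
    rw [hd.vert_smul hm ez] at hz
    refine (hd.horiz_add hm ?_ ?_).2 ⟨?_, ?_⟩
    · exact hd.side₂.inj (by rwa [h.comm]) (by rw [h.comm, h.comm, hx']) (by rw [hx.1, hz.1, e1])
    · exact hd.side₂.inj (by rwa [h.comm]) (by rw [h.comm, h.comm, hy']) (by rw [hy.1, hz.1, e2])
    · rw [← ex, ← ey, ← ez, hadd.1]
    · rw [hx.2, hy.2, hz.2, hadd.2, smul_add]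
  horiz_smul_add t x y z x' y' z' hadd hx hy hz := by
    obtain ⟨U, A, B, C, _, _, _, _, _, _, _, _, _, a, b, c, hm, hd⟩ := hloc (q₁ (p₁ z'))
    have ex := h.horiz.smul hx
    have ey := h.horiz.smul hy
    have ez := h.horiz.smul hz
    obtain ⟨e1, e2⟩ := h.vert.add hadd
    have e : ∀ {s t}, p₂ s = p₂ t → q₁ (p₁ s) = q₁ (p₁ t) := fun {s t} e ↦ by
      rw [← h.comm, ← h.comm, e]
    have hmz : q₁ (p₁ z) ∈ U := by rwa [e ez]
    have hx' : q₁ (p₁ x') = q₁ (p₁ z') := by rw [← e ex, e1, e ez]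
    have hy' : q₁ (p₁ y') = q₁ (p₁ z') := by rw [← e ey, e2, e ez]
    rw [hd.vert_add hmz e1 e2] at hadd
    rw [hd.horiz_smul (by rwa [hx']) ex] at hx
    rw [hd.horiz_smul (by rwa [hy']) ey] at hy
    rw [hd.horiz_smul hm ez] at hz
    refine (hd.vert_add hm ?_ ?_).2 ⟨?_, ?_⟩
    · exact hd.side₁.inj hm hx' (by rw [hx.1, hz.1, e1])
    · exact hd.side₁.inj hm hy' (by rw [hy.1, hz.1, e2])
    · rw [← ex, ← ey, ← ez, hadd.1]
    · rw [hx.2, hy.2, hz.2, hadd.2, smul_add]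
  smul_smul s t x y z hxy hyz := by
    obtain ⟨U, A, B, C, _, _, _, _, _, _, _, _, _, a, b, c, hm, hd⟩ := hloc (q₁ (p₁ z))
    have e1 := h.vert.smul hxy
    have e2 := h.horiz.smul hyz
    have e : ∀ {s t}, p₂ s = p₂ t → q₁ (p₁ s) = q₁ (p₁ t) := fun {s t} e ↦ by
      rw [← h.comm, ← h.comm, e]
    have hy : q₁ (p₁ y) ∈ U := by rwa [e e2]
    rw [hd.vert_smul hy e1] at hxy
    rw [hd.horiz_smul hm e2] at hyz
    -- The horizontal multiple of `x` moves only its first side point, which is then that of `z`,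
    -- and scales the core coordinate.
    obtain ⟨w, hw₁, hw₂, hw⟩ := hd.exists_mk h (d₁ := p₁ z) (d₂ := p₂ x) hm
      (by rw [h.comm, e1, e e2]) (t • c x)
    refine ⟨w, (hd.horiz_smul (by rwa [hw₁]) hw₂.symm).2 ⟨?_, hw⟩,
      (hd.vert_smul hm hw₁).2 ⟨?_, ?_⟩⟩
    · rw [hw₁, hyz.1, e1]
    · rw [hw₂, ← hxy.1, e2]
    · rw [hw, hyz.2, hxy.2, smul_comm]

end DoubleVecFib

/-! ## The dual bundle -/

theorem ContDiff.of_eq {V W : Type*} [NormedAddCommGroup V] [NormedSpace ℝ V]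
    [NormedAddCommGroup W] [NormedSpace ℝ W] {f g : V → W} (hf : ContDiff ℝ ∞ f)
    (h : ∀ t, g t = f t) : ContDiff ℝ ∞ g :=
  (funext h : g = f) ▸ hf

namespace VecFib

theorem Dual.ext {X : Type u} {B : Type v} {V : VecFib X B} {φ ψ : V.Dual} (hb : φ.base = ψ.base)
    (h : ∀ x hφ hψ, φ.toFun ⟨x, hφ⟩ = ψ.toFun ⟨x, hψ⟩) : φ = ψ := by
  obtain ⟨b, f, hf, hf'⟩ := φ
  obtain ⟨b', g, hg, hg'⟩ := ψ
  obtain rfl : b = b' := hb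
  obtain rfl : f = g := funext fun x ↦ h x.1 x.2 x.2
  rfl

variable {X : SmoothSpace.{u}} {B : SmoothSpace.{v}} {V : VecFib X B} {pr : X → B} {U : Set B}
  {F : Type*} [NormedAddCommGroup F] [NormedSpace ℝ F] {c : X → F}

open Classical in
/-- The coordinate of a functional: the corresponding functional on the typical fibre. -/
def dualCoord (V : VecFib X B) (c : X → F) (φ : V.Dual) : F →L[ℝ] ℝ :=
  if h : ∃ L : F →L[ℝ] ℝ, ∀ x, φ.toFun x = L (c x.1) then h.choose else 0

/-- The fibre over a point of `U` is identified with `F` by `c`, so a functional respecting the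
fibre operations is a linear functional on `F`, and it is continuous because `F` is
finite-dimensional. Hence the default value in `dualCoord` never occurs over `U`. -/
theorem IsTriv.toFun_eq [FiniteDimensional ℝ F] (hpr : V.IsProj pr) (h : V.IsTriv pr U c)
    {φ : V.Dual} (hφ : φ.base ∈ U) (x : {x // V.liesOver x φ.base}) :
    φ.toFun x = dualCoord V c φ (c x.1) := by
  have hex : ∃ L : F →L[ℝ] ℝ, ∀ x, φ.toFun x = L (c x.1) := by
    choose s hs hcs using h.surj φ.base hφ
    let L : F →ₗ[ℝ] ℝ :=
      { toFun := fun f ↦ φ.toFun ⟨s f, hpr.liesOver_iff.2 (hs f)⟩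
        map_add' := fun f g ↦ φ.map_add _ _ _ ((h.add_iff (by rwa [hs]) (by rw [hs, hs])
          (by rw [hs, hs])).2 (by simp [hcs]))
        map_smul' := fun t f ↦ φ.map_smul _ _ _ ((h.smul_iff (by rwa [hs])
          (by rw [hs, hs])).2 (by simp [hcs])) }
    refine ⟨LinearMap.toContinuousLinearMap L, fun x ↦ ?_⟩
    have hx : pr x.1 = φ.base := hpr.liesOver_iff.1 x.2
    change _ = φ.toFun ⟨s (c x.1), _⟩
    congr 1
    exact Subtype.ext (h.inj (by rwa [hs]) (by rw [hs, hx]) (hcs _).symm)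
  rw [dualCoord, dif_pos hex]
  exact hex.choose_spec x

theorem IsTriv.dualCoord_eq [FiniteDimensional ℝ F] (hpr : V.IsProj pr) (h : V.IsTriv pr U c)
    {φ : V.Dual} (hφ : φ.base ∈ U) {L : F →L[ℝ] ℝ}
    (hL : ∀ x, φ.toFun x = L (c x.1)) : dualCoord V c φ = L := by
  ext f
  obtain ⟨x, hx, rfl⟩ := h.surj _ hφ f
  rw [← hL ⟨x, hpr.liesOver_iff.2 hx⟩, h.toFun_eq hpr hφ]

theorem IsTriv.exists_dual (hpr : V.IsProj pr) (h : V.IsTriv pr U c)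
    {b : B} (hb : b ∈ U) (L : F →L[ℝ] ℝ) :
    ∃ φ : V.Dual, φ.base = b ∧ ∀ x, φ.toFun x = L (c x.1) := by
  refine ⟨⟨b, fun x ↦ L (c x.1), fun x y z hadd ↦ ?_, fun t x y hs ↦ ?_⟩, rfl, fun x ↦ rfl⟩
  · have hz := hpr.liesOver_iff.1 z.2
    obtain ⟨h1, h2⟩ := hpr.add hadd
    rw [(h.add_iff (by rwa [hz]) h1 h2).1 hadd, map_add]
  · have hy := hpr.liesOver_iff.1 y.2
    rw [(h.smul_iff (by rwa [hy]) (hpr.smul hs)).1 hs, map_smul, smul_eq_mul]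

theorem isPlot_dual_of_mem {n : ℕ} {p : EuclideanSpace ℝ (Fin n) → V.dualSpace}
    (hb : IsPlot (fun t ↦ (Dual.base (p t) : B)))
    (hp : ∀ (m : ℕ) (f : EuclideanSpace ℝ (Fin m) → EuclideanSpace ℝ (Fin n))
      (q : EuclideanSpace ℝ (Fin m) → X) (h : ∀ t, V.liesOver (q t) (Dual.base (p (f t)))),
      ContDiff ℝ ∞ f → IsPlot q → ContDiff ℝ ∞ (fun t ↦ Dual.toFun (p (f t)) ⟨q t, h t⟩)) :
    IsPlot p :=
  DiffeologicalSpace.isPlot_generatedFrom_of_mem ⟨hb, hp⟩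

/-- The diffeology of the dual is the smallest one containing the given families. A property of all
its plots is thus proved by comparison with any diffeology `d` that contains these families. -/
theorem isPlot_dual_induction (d : DiffeologicalSpace V.dualSpace)
    (h : ∀ {n : ℕ} {p : EuclideanSpace ℝ (Fin n) → V.dualSpace},
      IsPlot (fun t ↦ (Dual.base (p t) : B)) →
      (∀ (m : ℕ) (f : EuclideanSpace ℝ (Fin m) → EuclideanSpace ℝ (Fin n))
        (q : EuclideanSpace ℝ (Fin m) → X) (h : ∀ t, V.liesOver (q t) (Dual.base (p (f t)))),
        ContDiff ℝ ∞ f → IsPlot q → ContDiff ℝ ∞ (fun t ↦ Dual.toFun (p (f t)) ⟨q t, h t⟩)) →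
      (@IsPlot _ d n) p)
    {n : ℕ} {p : EuclideanSpace ℝ (Fin n) → V.dualSpace}
    (hp : @IsPlot _ V.dualSpace.diffeology n p) : (@IsPlot _ d n) p :=
  DiffeologicalSpace.le_iff'.1
    (DiffeologicalSpace.generateFrom_le_iff.2 fun _ _ hp ↦ h hp.1 hp.2) n p hp

theorem IsProj.dual (_ : V.IsProj pr) : V.dual.IsProj (X := V.dualSpace) Dual.base where
  smooth _ _ hp := isPlot_dual_induction
    (SmoothSpace.induced (Y := B) (Dual.base : V.dualSpace → B)) (fun hp _ ↦ hp) hp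
  liesOver_iff := Iff.rfl
  add h := ⟨h.1, h.2.1⟩
  smul h := h.1

/-- Locally the dual of `U × F` is `U × F*`. The content is smoothness: evaluation on smooth
families of vectors and smoothness of the coordinate functional determine each other, since `F` is
finite-dimensional. -/
theorem IsTriv.dual [FiniteDimensional ℝ F] (hpr : V.IsProj pr) (h : V.IsTriv pr U c) :
    V.dual.IsTriv (X := V.dualSpace) Dual.base U (dualCoord V c) where
  isOpen := h.isOpen
  inj {φ ψ} hψ hb hc := Dual.ext hb fun x h1 h2 ↦
    (h.toFun_eq hpr (φ := φ) (by rwa [hb]) _).trans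
      ((congrArg (· (c x)) hc).trans (h.toFun_eq hpr hψ ⟨x, h2⟩).symm)
  surj b hb L := by
    obtain ⟨φ, rfl, hL⟩ := h.exists_dual hpr hb L
    exact ⟨φ, rfl, h.dualCoord_eq hpr hb hL⟩
  contDiffOn p hp := by
    -- The comparison diffeology consists of the families that are smooth in this coordinate, so
    -- only the generating families have to be checked.
    refine (isPlot_dual_induction (chartDiffeology (X := V.dualSpace) Dual.base
      (dualCoord V c) h.isOpen) (fun {_ p} hp hp' ↦ ⟨hp, ?_⟩) hp).2
    refine contDiffOn_of_comp (h.isOpen_preimage hp) fun f hf hfU ↦ ?_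
    rw [contDiff_clm_apply_iff]
    intro w
    have hbf : ∀ s, Dual.base (p (f s)) ∈ U := hfU
    -- The vectors with constant coordinate `w` form a plot; evaluating the functionals on it gives
    -- the component of the coordinate in the direction `w`.
    choose x hx hcx using fun s ↦ h.surj _ (hbf s) w
    have hq : IsPlot x := by
      refine h.isPlot _ (fun t ↦ by rw [hx]; exact hbf t) ?_ ?_
      · have : pr ∘ x = (fun t ↦ (Dual.base (p t) : B)) ∘ f := funext hx
        rw [this]
        exact isPlot_reparam hp hf
      · have : c ∘ x = fun _ ↦ w := funext hcx
        rw [this]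
        exact contDiff_const
    refine (hp' _ f x (fun t ↦ hpr.liesOver_iff.2 (hx t)) hf hq).of_eq fun t ↦ ?_
    rw [h.toFun_eq hpr (hbf t), hcx]
    rfl
  isPlot p hU hb hc := by
    refine isPlot_dual_of_mem hb fun m f q hq hf hq' ↦ ?_
    have h1 : ContDiff ℝ ∞ (c ∘ q) := h.contDiff hq' fun t ↦ by
      rw [hpr.liesOver_iff.1 (hq t)]; exact hU _
    refine ((hc.comp hf).clm_apply h1).of_eq fun t ↦ ?_
    rw [h.toFun_eq hpr (hU _)]
    rfl
  add_iff {φ ψ χ} hχ h1 h2 := by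
    have e1 := h.toFun_eq hpr (φ := φ) (by rwa [h1])
    have e2 := h.toFun_eq hpr (φ := ψ) (by rwa [h2])
    have e3 := h.toFun_eq hpr hχ
    constructor
    · rintro ⟨-, -, hadd⟩
      refine h.dualCoord_eq hpr hχ fun x ↦ ?_
      rw [hadd x.1 (by rw [h1]; exact x.2) (by rw [h2]; exact x.2) x.2, e1, e2]
      rfl
    · intro hadd
      refine ⟨h1, h2, fun x _ _ _ ↦ ?_⟩
      rw [e1, e2, e3, hadd]
      rfl
  smul_iff {t φ ψ} hψ h1 := by
    have e1 := h.toFun_eq hpr (φ := φ) (by rwa [h1])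
    have e2 := h.toFun_eq hpr hψ
    constructor
    · rintro ⟨-, hsm⟩
      refine h.dualCoord_eq hpr hψ fun x ↦ ?_
      rw [hsm x.1 (by rw [h1]; exact x.2) x.2, e1]
      rfl
    · intro hsm
      refine ⟨h1, fun x _ _ ↦ ?_⟩
      rw [e1, e2, hsm]
      rfl

end VecFib

/-! ## The vertical dual -/

namespace ContinuousLinearMap

variable {B C : Type*} [NormedAddCommGroup B] [NormedSpace ℝ B] [NormedAddCommGroup C]
  [NormedSpace ℝ C] {L L₁ L₂ : B × C →L[ℝ] ℝ}

/-- A functional on `B × C` is the pair of its restrictions. The restriction to `C` is put first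
because it becomes the second side coordinate of the vertical dual, and the restriction to `B` the
core coordinate. -/
theorem prod_ext_iff' : L = L₁ ↔
    L.comp (inr ℝ B C) = L₁.comp (inr ℝ B C) ∧ L.comp (inl ℝ B C) = L₁.comp (inl ℝ B C) :=
  ⟨fun h ↦ h ▸ ⟨rfl, rfl⟩, fun h ↦ ContinuousLinearMap.prod_ext h.2 h.1⟩

theorem eq_add_iff_comp_inr_inl : L = L₁ + L₂ ↔
    L.comp (inr ℝ B C) = L₁.comp (inr ℝ B C) + L₂.comp (inr ℝ B C) ∧
    L.comp (inl ℝ B C) = L₁.comp (inl ℝ B C) + L₂.comp (inl ℝ B C) := by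
  rw [prod_ext_iff', add_comp, add_comp]

theorem eq_smul_iff_comp_inr_inl {t : ℝ} : L = t • L₁ ↔
    L.comp (inr ℝ B C) = t • L₁.comp (inr ℝ B C) ∧
    L.comp (inl ℝ B C) = t • L₁.comp (inl ℝ B C) := by
  rw [prod_ext_iff', smul_comp, smul_comp]

end ContinuousLinearMap

namespace DoubleVecFib

open VecFib

variable {D D₁ D₂ M K : SmoothSpace} {A B C : Type*} [NormedAddCommGroup A] [NormedSpace ℝ A]
  [NormedAddCommGroup B] [NormedSpace ℝ B] [NormedAddCommGroup C] [NormedSpace ℝ C]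
  {𝒟 : DoubleVecFib D D₁ D₂ M} {p₁ : D → D₁} {p₂ : D → D₂} {q₁ : D₁ → M} {q₂ : D₂ → M} {U : Set M}
  {a : D₁ → A} {b : D₂ → B} {c : D → C} {𝒞 : VecFib K M} {ι : K → D} {qK : K → M} {e : K → C}

/-- `ι` identifies `𝒞` with the core, and the coordinate `e` on `𝒞` with the core coordinate. -/
structure IsCoreTriv (𝒞 : VecFib K M) (ι : K → D) (qK : K → M) (p₁ : D → D₁) (p₂ : D → D₂)
    (q₁ : D₁ → M) (U : Set M) (a : D₁ → A) (b : D₂ → B) (c : D → C) (e : K → C) : Prop where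
  triv : 𝒞.IsTriv qK U e
  base : ∀ k, qK k ∈ U → q₁ (p₁ (ι k)) = qK k
  a_eq : ∀ k, qK k ∈ U → a (p₁ (ι k)) = 0
  b_eq : ∀ k, qK k ∈ U → b (p₂ (ι k)) = 0
  c_eq : ∀ k, qK k ∈ U → c (ι k) = e k

/-- The functional on the core part of the typical fibre. -/
abbrev coreFunctional (𝒟 : DoubleVecFib D D₁ D₂ M) (p₂ : D → D₂) (b : D₂ → B) (c : D → C)
    (φ : 𝒟.vert.Dual) : C →L[ℝ] ℝ :=
  (dualCoord 𝒟.vert (fun d ↦ (b (p₂ d), c d)) φ).comp (ContinuousLinearMap.inr ℝ B C)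

/-- The functional on the part of the typical fibre that belongs to the second side bundle. -/
abbrev sideFunctional (𝒟 : DoubleVecFib D D₁ D₂ M) (p₂ : D → D₂) (b : D₂ → B) (c : D → C)
    (φ : 𝒟.vert.Dual) : B →L[ℝ] ℝ :=
  (dualCoord 𝒟.vert (fun d ↦ (b (p₂ d), c d)) φ).comp (ContinuousLinearMap.inl ℝ B C)

theorem dualCoord_eq_coprod (φ : 𝒟.vert.Dual) (x : B) (y : C) :
    dualCoord 𝒟.vert (fun d ↦ (b (p₂ d), c d)) φ (x, y) =
      𝒟.sideFunctional p₂ b c φ x + 𝒟.coreFunctional p₂ b c φ y := by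
  simp [← map_add]

variable [FiniteDimensional ℝ B] [FiniteDimensional ℝ C]

theorem IsDecomp.toFun_eq (h : 𝒟.IsProj p₁ p₂ q₁ q₂) (hd : 𝒟.IsDecomp p₁ p₂ q₁ q₂ U a b c)
    {φ : 𝒟.vert.Dual} (hφ : q₁ φ.base ∈ U) (x : {x // 𝒟.vert.liesOver x φ.base}) :
    φ.toFun x = 𝒟.sideFunctional p₂ b c φ (b (p₂ x.1)) + 𝒟.coreFunctional p₂ b c φ (c x.1) := by
  rw [(hd.vert h).toFun_eq h.vert hφ, dualCoord_eq_coprod]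

/-- The zero vector over `d₁` has coordinates `(a d₁, 0, 0)`, and adding a core element `k`
horizontally changes only the last one to `e k`. So the projection to the dual of the core restricts
the functional to the core part `C` of the fibre. -/
theorem IsDecomp.lies_iff (h : 𝒟.IsProj p₁ p₂ q₁ q₂) (hK : 𝒞.IsProj qK)
    (hd : 𝒟.IsDecomp p₁ p₂ q₁ q₂ U a b c) (hc : IsCoreTriv 𝒞 ι qK p₁ p₂ q₁ U a b c e)
    {φ : 𝒟.vert.Dual} {κ : 𝒞.Dual} (hφ : q₁ φ.base ∈ U) :
    (𝒟.verticalDualOf 𝒞 ι).horiz.liesOver φ κ ↔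
      κ.base = q₁ φ.base ∧ dualCoord 𝒞 e κ = 𝒟.coreFunctional p₂ b c φ := by
  constructor
  · rintro ⟨h1, h2⟩
    rw [h.side₁.liesOver_iff] at h1
    have hκ : κ.base ∈ U := by rwa [← h1]
    refine ⟨h1.symm, hc.triv.dualCoord_eq hK hκ fun k ↦ ?_⟩
    have hk := hK.liesOver_iff.1 k.2
    have hkU : qK k.1 ∈ U := by rwa [hk]
    have hb : q₂ (p₂ (ι k.1)) = q₁ φ.base := by rw [h.comm, hc.base _ hkU, hk, h1]
    -- `z` is the zero vector over `φ.base`, and `x` below is `z + ι k`, with core coordinate `e k`.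
    obtain ⟨z, hz₁, hz₂, hz⟩ := hd.exists_mk h hφ hb 0
    obtain ⟨x, hx₁, hx₂, hx⟩ := hd.exists_mk h hφ hb (e k.1)
    have hzero : 𝒟.vert.IsZero z := by
      rw [(hd.vert h).isZero_iff (by rw [hz₁]; exact hφ), Prod.ext_iff]
      exact ⟨by rw [hz₂]; exact hc.b_eq _ hkU, hz⟩
    have hadd : 𝒟.horiz.add z (ι k.1) x := by
      refine (hd.horiz_add (by rwa [hx₁]) (by rw [hz₂, hx₂]) hx₂.symm).2 ⟨?_, ?_⟩
      · rw [hx₁, hz₁, hc.a_eq _ hkU, add_zero]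
      · rw [hx, hz, zero_add, hc.c_eq _ hkU]
    rw [h2 k.1 k.2 z x (h.vert.liesOver_iff.2 hx₁) (h.vert.liesOver_iff.2 hz₁) hzero hadd,
      hd.toFun_eq h hφ, hx₂, hc.b_eq _ hkU, hx, map_zero, zero_add]
  · rintro ⟨h1, h2⟩
    refine ⟨h.side₁.liesOver_iff.2 h1.symm, fun k hk z x hx hz hz0 hadd ↦ ?_⟩
    have hκ : κ.base ∈ U := by rwa [h1]
    have hkb := hK.liesOver_iff.1 hk
    have hkU : qK k ∈ U := by rwa [hkb]
    rw [hc.triv.toFun_eq hK hκ, hd.toFun_eq h hφ, h2]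
    have hx₁ := h.vert.liesOver_iff.1 hx
    have hz₁ := h.vert.liesOver_iff.1 hz
    obtain ⟨h3, h4⟩ := h.horiz.add hadd
    rw [hd.horiz_add (by rwa [hx₁]) h3 h4] at hadd
    rw [(hd.vert h).isZero_iff (by rw [hz₁]; exact hφ), Prod.ext_iff] at hz0
    have h6 : c x = e k := by
      rw [hadd.2, show c z = 0 from hz0.2, zero_add, hc.c_eq _ hkU]
    simp only [← h4, hc.b_eq _ hkU, map_zero, zero_add, h6]

/-- Over each chart, restriction to the core part determines exactly one functional on the core. So
the relation `liesOver` is globally the graph of a map, which is smooth because restriction is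
linear in the coordinates. -/
theorem exists_isProj_verticalDualOf (h : 𝒟.IsProj p₁ p₂ q₁ q₂) (hK : 𝒞.IsProj qK)
    (hloc : ∀ m : M, ∃ (U : Set M) (A B C : Type) (_ : NormedAddCommGroup A) (_ : NormedSpace ℝ A)
      (_ : FiniteDimensional ℝ A) (_ : NormedAddCommGroup B) (_ : NormedSpace ℝ B)
      (_ : FiniteDimensional ℝ B) (_ : NormedAddCommGroup C) (_ : NormedSpace ℝ C)
      (_ : FiniteDimensional ℝ C) (a : D₁ → A) (b : D₂ → B) (c : D → C) (e : K → C),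
      m ∈ U ∧ 𝒟.IsDecomp p₁ p₂ q₁ q₂ U a b c ∧ IsCoreTriv 𝒞 ι qK p₁ p₂ q₁ U a b c e) :
    ∃ p : 𝒟.vert.dualSpace → 𝒞.dualSpace,
      (𝒟.verticalDualOf 𝒞 ι).IsProj Dual.base p q₁ Dual.base := by
  have hex : ∀ φ : 𝒟.vert.Dual, ∃! κ : 𝒞.Dual, (𝒟.verticalDualOf 𝒞 ι).horiz.liesOver φ κ := by
    intro φ
    obtain ⟨U, A, B, C, _, _, _, _, _, _, _, _, _, a, b, c, e, hm, hd, hc⟩ := hloc (q₁ φ.base)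
    simp only [hd.lies_iff h hK hc hm]
    obtain ⟨κ, hκ, hκ'⟩ := (hc.triv.dual hK).surj _ hm (𝒟.coreFunctional p₂ b c φ)
    refine ⟨κ, ⟨hκ, hκ'⟩, fun κ' hκ₂ ↦ ?_⟩
    exact (hc.triv.dual hK).inj (by rwa [hκ]) (by rw [hκ₂.1, hκ]) (by rw [hκ₂.2, hκ'])
  choose p hp huniq using hex
  have hlies : ∀ {φ κ}, (𝒟.verticalDualOf 𝒞 ι).horiz.liesOver φ κ ↔ p φ = κ := fun {φ κ} ↦
    ⟨fun hκ ↦ (huniq φ κ hκ).symm, fun hκ ↦ hκ ▸ hp φ⟩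
  have hbase : ∀ φ, (p φ).base = q₁ φ.base := fun φ ↦ by
    have h1 := (hp φ).1
    rw [h.side₁.liesOver_iff] at h1
    exact h1.symm
  refine ⟨p, h.vert.dual, ⟨?_, hlies, ?_, ?_⟩, h.side₁, hK.dual, hbase⟩
  · refine dSmooth_of_charts (X := 𝒟.vert.dualSpace) (X' := 𝒞.dualSpace)
      (pr := fun φ ↦ q₁ (Dual.base φ)) (pr' := Dual.base)
      (h.side₁.smooth.comp h.vert.dual.smooth) hbase fun m ↦ ?_
    obtain ⟨U, A, B, C, _, _, _, _, _, _, _, _, _, a, b, c, e, hm, hd, hc⟩ := hloc m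
    refine ⟨U, C →L[ℝ] ℝ, inferInstance, inferInstance, dualCoord 𝒞 e, hm,
      (hc.triv.dual hK).toIsChart, fun n r hr hrU ↦ ?_⟩
    have h1 := ((hd.vert h).dual h.vert).contDiff hr hrU
    refine (h1.clm_comp (contDiff_const (c := ContinuousLinearMap.inr ℝ B C))).of_eq fun t ↦ ?_
    exact ((hd.lies_iff h hK hc (hrU t)).1 (hp (r t))).2
  · rintro φ ψ χ ⟨⟨κ, h1, h2, h3⟩, -⟩
    have h1 := hlies.1 h1
    have h2 := hlies.1 h2
    have h3 := hlies.1 h3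
    exact ⟨h1.trans h3.symm, h2.trans h3.symm⟩
  · rintro t φ ψ ⟨⟨κ, h1, h2⟩, -⟩
    have h1 := hlies.1 h1
    have h2 := hlies.1 h2
    exact h1.trans h2.symm

/-- A functional on `B × C` is a pair in `C* × B*`, so the dual of `A × B × C` is decomposed as `A ×
C* × B*`. Horizontal sums are taken with the restriction to `C` fixed, and then the restrictions to
`B` add up. -/
theorem IsDecomp.verticalDualOf (h : 𝒟.IsProj p₁ p₂ q₁ q₂) (hK : 𝒞.IsProj qK)
    (hd : 𝒟.IsDecomp p₁ p₂ q₁ q₂ U a b c) (hc : IsCoreTriv 𝒞 ι qK p₁ p₂ q₁ U a b c e)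
    {p : 𝒟.vert.dualSpace → 𝒞.dualSpace}
    (hp : (𝒟.verticalDualOf 𝒞 ι).IsProj Dual.base p q₁ Dual.base) :
    (𝒟.verticalDualOf 𝒞 ι).IsDecomp Dual.base p q₁ Dual.base U a (dualCoord 𝒞 e)
      (𝒟.sideFunctional p₂ b c) := by
  have hpe : ∀ {φ}, q₁ (Dual.base φ) ∈ U → dualCoord 𝒞 e (p φ) = 𝒟.coreFunctional p₂ b c φ :=
    fun {φ} hφ ↦ ((hd.lies_iff h hK hc hφ).1 (hp.horiz.liesOver_iff.2 rfl)).2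
  have hdual := (hd.vert h).dual h.vert
  have total : IsChart (X := 𝒟.vert.dualSpace) (fun φ ↦ q₁ (Dual.base φ)) U
      (fun φ ↦ (a (Dual.base φ), dualCoord 𝒞 e (p φ), 𝒟.sideFunctional p₂ b c φ)) :=
    { isOpen := hd.side₁.isOpen
      inj := fun {φ ψ} hψ hb hφψ ↦ by
        rw [Prod.mk.injEq, Prod.mk.injEq, hpe hψ, hpe (φ := φ) (by rwa [hb])] at hφψ
        exact hdual.inj hψ (hd.side₁.inj hψ hb hφψ.1) (ContinuousLinearMap.prod_ext_iff'.2 hφψ.2)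
      surj := fun m hm ⟨u, v, w⟩ ↦ by
        obtain ⟨d₁, hd₁, ha⟩ := hd.side₁.surj m hm u
        obtain ⟨φ, hφ, hφ'⟩ := hdual.surj d₁ (by rwa [mem_preimage, hd₁]) (w.coprod v)
        refine ⟨φ, by rw [hφ, hd₁], ?_⟩
        rw [hpe (φ := φ) (by rwa [hφ, hd₁]), hφ, ha, Prod.mk.injEq, Prod.mk.injEq]
        exact ⟨rfl, (congrArg (fun L : B × C →L[ℝ] ℝ ↦ L.comp (.inr ℝ B C)) hφ').trans
          (ContinuousLinearMap.coprod_comp_inr w v),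
          (congrArg (fun L : B × C →L[ℝ] ℝ ↦ L.comp (.inl ℝ B C)) hφ').trans
          (ContinuousLinearMap.coprod_comp_inl w v)⟩
      contDiffOn := fun r hr ↦ by
        have h1 := hdual.contDiffOn r hr
        refine ((hd.side₁.contDiffOn _ (hp.vert.smooth _ _ hr)).prodMk
          ((h1.clm_comp (contDiffOn_const (c := ContinuousLinearMap.inr ℝ B C))).prodMk
          (h1.clm_comp (contDiffOn_const (c := ContinuousLinearMap.inl ℝ B C))))).congr fun t ht ↦ ?_
        have ht' : dualCoord 𝒞 e (p (r t)) = _ := hpe ht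
        simp only [Function.comp_apply, ht']
        rfl
      isPlot := fun r hU hr hs ↦ by
        refine hdual.isPlot r hU (hd.side₁.isPlot _ hU hr hs.fst) ?_
        refine ((hs.snd.snd.clm_comp (contDiff_const (c := ContinuousLinearMap.fst ℝ B C))).add
          (hs.snd.fst.clm_comp (contDiff_const (c := ContinuousLinearMap.snd ℝ B C)))).of_eq
          fun t ↦ ?_
        have ht' : dualCoord 𝒞 e (p (r t)) = _ := hpe (hU t)
        refine ContinuousLinearMap.ext fun ⟨x, y⟩ ↦ ?_
        simp only [Function.comp_apply, ht']
        exact dualCoord_eq_coprod _ _ _ }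
  refine ⟨hd.side₁, hc.triv.dual hK, total, ?_, ?_, ?_, ?_⟩
  · intro φ ψ χ hχ h1 h2
    rw [hpe hχ, hpe (φ := φ) (by rwa [h1]), hpe (φ := ψ) (by rwa [h2])]
    exact (hdual.add_iff hχ h1 h2).trans ContinuousLinearMap.eq_add_iff_comp_inr_inl
  · intro t φ ψ hψ h1
    rw [hpe hψ, hpe (φ := φ) (by rwa [h1])]
    exact (hdual.smul_iff hψ h1).trans ContinuousLinearMap.eq_smul_iff_comp_inr_inl
  · intro φ ψ χ hχ h1 h2
    have m1 : q₁ (Dual.base φ) = q₁ (Dual.base χ) := by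
      rw [← hp.comm, h1, hp.comm]
    have m2 : q₁ (Dual.base ψ) = q₁ (Dual.base χ) := by
      rw [← hp.comm, h2, hp.comm]
    have e1 : 𝒟.coreFunctional p₂ b c φ = 𝒟.coreFunctional p₂ b c χ := by
      rw [← hpe hχ, ← hpe (φ := φ) (by rwa [m1]), h1]
    have e2 : 𝒟.coreFunctional p₂ b c ψ = 𝒟.coreFunctional p₂ b c χ := by
      rw [← hpe hχ, ← hpe (φ := ψ) (by rwa [m2]), h2]
    constructor
    · rintro ⟨-, h3, h4⟩
      have h3 := (hd.side₁.add_iff hχ m1 m2).1 h3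
      refine ⟨h3, ContinuousLinearMap.ext fun v ↦ ?_⟩
      -- Test vectors over the common point `d₂` with core coordinate zero see only the restrictions
      -- to `B`, and for them horizontal addition is addition of the points of `D₁`.
      obtain ⟨d₂, hd₂, rfl⟩ := hd.side₂.surj _ hχ v
      obtain ⟨x, hx₁, hx₂, hx⟩ := hd.exists_mk h (d₁ := Dual.base φ) (d₂ := d₂) (by rwa [m1])
        (by rw [hd₂, m1]) 0
      obtain ⟨y, hy₁, hy₂, hy⟩ := hd.exists_mk h (d₁ := Dual.base ψ) (d₂ := d₂) (by rwa [m2])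
        (by rw [hd₂, m2]) 0
      obtain ⟨z, hz₁, hz₂, hz⟩ := hd.exists_mk h (d₁ := Dual.base χ) (d₂ := d₂) hχ hd₂ 0
      have := h4 x y z (h.vert.liesOver_iff.2 hx₁) (h.vert.liesOver_iff.2 hy₁)
        (h.vert.liesOver_iff.2 hz₁) ((hd.horiz_add (by rwa [hz₁]) (by rw [hx₂, hz₂])
        (by rw [hy₂, hz₂])).2 ⟨by rw [hx₁, hy₁, hz₁, h3], by rw [hx, hy, hz, add_zero]⟩)
      rw [hd.toFun_eq h hχ, hd.toFun_eq h (φ := φ) (by rwa [m1]),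
        hd.toFun_eq h (φ := ψ) (by rwa [m2])] at this
      simp only [hx₂, hy₂, hz₂, hx, hy, hz, map_zero, add_zero] at this
      exact this
    · rintro ⟨h3, h4⟩
      refine ⟨⟨p χ, hp.horiz.liesOver_iff.2 h1, hp.horiz.liesOver_iff.2 h2,
        hp.horiz.liesOver_iff.2 rfl⟩, (hd.side₁.add_iff hχ m1 m2).2 h3,
        fun x y z hx hy hz hadd ↦ ?_⟩
      -- With a common restriction to `C`, the values on the core parts add because `c z = c x + c
      -- y`; the three vectors share the coordinate `b`, on which the restrictions to `B` add by
      -- `h4`.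
      rw [hd.toFun_eq h hχ, hd.toFun_eq h (φ := φ) (by rwa [m1]),
        hd.toFun_eq h (φ := ψ) (by rwa [m2]), h4, e1, e2]
      obtain ⟨h5, h6⟩ := h.horiz.add hadd
      have hz₁ := h.vert.liesOver_iff.1 hz
      have h7 := ((hd.horiz_add (by rwa [hz₁]) h5 h6).1 hadd).2
      simp only [h5, h6, h7, map_add, add_apply]
      ring
  · intro t φ ψ hψ h1
    have m1 : q₁ (Dual.base φ) = q₁ (Dual.base ψ) := by
      rw [← hp.comm, h1, hp.comm]
    have e1 : 𝒟.coreFunctional p₂ b c φ = 𝒟.coreFunctional p₂ b c ψ := by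
      rw [← hpe hψ, ← hpe (φ := φ) (by rwa [m1]), h1]
    constructor
    · rintro ⟨-, h3, h4⟩
      have h3 := (hd.side₁.smul_iff hψ m1).1 h3
      refine ⟨h3, ContinuousLinearMap.ext fun v ↦ ?_⟩
      obtain ⟨d₂, hd₂, rfl⟩ := hd.side₂.surj _ hψ v
      obtain ⟨x, hx₁, hx₂, hx⟩ := hd.exists_mk h (d₁ := Dual.base φ) (d₂ := d₂) (by rwa [m1])
        (by rw [hd₂, m1]) 0
      obtain ⟨z, hz₁, hz₂, hz⟩ := hd.exists_mk h (d₁ := Dual.base ψ) (d₂ := d₂) hψ hd₂ 0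
      have := h4 x z (h.vert.liesOver_iff.2 hx₁)
        (h.vert.liesOver_iff.2 hz₁) ((hd.horiz_smul (by rwa [hz₁]) (by rw [hx₂, hz₂])).2
          ⟨by rw [hx₁, hz₁, h3], by rw [hx, hz, smul_zero]⟩)
      rw [hd.toFun_eq h hψ, hd.toFun_eq h (φ := φ) (by rwa [m1])] at this
      simp only [hx₂, hz₂, hx, hz, map_zero, add_zero] at this
      exact this
    · rintro ⟨h3, h4⟩
      refine ⟨⟨p ψ, hp.horiz.liesOver_iff.2 h1, hp.horiz.liesOver_iff.2 rfl⟩,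
        (hd.side₁.smul_iff hψ m1).2 h3, fun x z hx hz hsm ↦ ?_⟩
      rw [hd.toFun_eq h hψ, hd.toFun_eq h (φ := φ) (by rwa [m1]), h4, e1]
      have h5 := h.horiz.smul hsm
      have hz₁ := h.vert.liesOver_iff.1 hz
      have h7 := ((hd.horiz_smul (by rwa [hz₁]) h5).1 hsm).2
      simp only [h5, h7, map_smul, smul_apply, smul_eq_mul]
      ring

end DoubleVecFib

/-! ## Quotients -/

section Quot

variable {X : SmoothSpace.{u}} {B Y : SmoothSpace} {r : X → X → Prop}

theorem isPlot_quot_mk {n : ℕ} {p : EuclideanSpace ℝ (Fin n) → X} (hp : IsPlot p) :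
    IsPlot (X := X.quot r) (fun t ↦ Quot.mk r (p t)) :=
  DiffeologicalSpace.isPlot_generatedFrom_of_mem ⟨p, hp, rfl⟩

/-- As for duals: the quotient diffeology is generated by the projected plots, so it is enough that
these lie in `d`. -/
theorem isPlot_quot_induction (d : DiffeologicalSpace (X.quot r))
    (h : ∀ {n : ℕ} {p : EuclideanSpace ℝ (Fin n) → X}, IsPlot p →
      (@IsPlot _ d n) (fun t ↦ Quot.mk r (p t)))
    {n : ℕ} {p : EuclideanSpace ℝ (Fin n) → X.quot r}
    (hp : @IsPlot _ (X.quot r).diffeology n p) : (@IsPlot _ d n) p :=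
  DiffeologicalSpace.le_iff'.1
    (DiffeologicalSpace.generateFrom_le_iff.2 fun n p hq ↦ by
      obtain ⟨q, hq, hqp⟩ := hq
      exact Eq.mpr (congrArg (@IsPlot _ d n) hqp) (h hq)) n p hp

theorem dSmooth_quot_mk : DSmooth (Y := X.quot r) (Quot.mk r) :=
  fun _ _ hp ↦ isPlot_quot_mk hp

theorem dSmooth_of_comp_quot_mk {f : X.quot r → Y} (hf : DSmooth fun x : X ↦ f (Quot.mk r x)) :
    DSmooth f :=
  fun _ _ hp ↦ isPlot_quot_induction (SmoothSpace.induced f) (fun hp ↦ hf _ _ hp) hp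

variable {F F' : Type*} [NormedAddCommGroup F] [NormedSpace ℝ F] [NormedAddCommGroup F']
  [NormedSpace ℝ F'] {pr : X → B} {pr' : X.quot r → B} {U : Set B} {c : X → F} {L : F →L[ℝ] F'}

/-- The coordinate induced on a quotient. -/
def quotCoord (r : X → X → Prop) (c : X → F) (L : F →L[ℝ] F') (ξ : X.quot r) : F' :=
  L (c (Quot.out ξ))

/-- `Quot` identifies along the equivalence relation generated by `r`. The base point is carried
through the induction because the coordinate is known to be invariant over `U` only. -/
theorem quotCoord_mk (hr : ∀ x y, r x y → pr x = pr y)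
    (hL : ∀ x y, pr y ∈ U → r x y → L (c x) = L (c y)) {x : X} (hx : pr x ∈ U) :
    quotCoord r c L (Quot.mk r x) = L (c x) := by
  have key : ∀ {y z}, Relation.EqvGen r y z → pr y = pr z ∧ (pr z ∈ U → L (c y) = L (c z)) := by
    intro y z h
    induction h with
    | rel y z h => exact ⟨hr y z h, fun hz ↦ hL y z hz h⟩
    | refl y => exact ⟨rfl, fun _ ↦ rfl⟩
    | symm y z _ ih => exact ⟨ih.1.symm, fun hy ↦ (ih.2 (by rwa [← ih.1])).symm⟩
    | trans w y z _ _ h1 h2 =>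
      exact ⟨h1.1.trans h2.1, fun hz ↦ (h1.2 (by rwa [h2.1])).trans (h2.2 hz)⟩
  exact (key (Quot.eqvGen_exact (Quot.out_eq (Quot.mk r x)))).2 hx

/-- If `r` contains every pair over `U` with equal base point and equal `L`-coordinate, the quotient
coordinate separates points. The linear section `σ` of `L` supplies smooth representatives, so
smooth families in the quotient lift to plots. -/
theorem IsChart.quot (h : IsChart pr U c) (hpr : DSmooth pr)
    (hL : ∀ x y, pr y ∈ U → pr x = pr y → L (c x) = L (c y) → r x y) {σ : F' →L[ℝ] F}
    (hσ : ∀ v, L (σ v) = v)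
    (hpr' : ∀ x, pr' (Quot.mk r x) = pr x) {c' : X.quot r → F'}
    (hc' : ∀ x, pr x ∈ U → c' (Quot.mk r x) = L (c x)) : IsChart pr' U c' := by
  have hinj : ∀ {x y : X.quot r}, pr' y ∈ U → pr' x = pr' y → c' x = c' y → x = y := by
    rintro ⟨x⟩ ⟨y⟩ hy hxy hcc
    change pr' (Quot.mk r y) ∈ U at hy
    change pr' (Quot.mk r x) = pr' (Quot.mk r y) at hxy
    change c' (Quot.mk r x) = c' (Quot.mk r y) at hcc
    rw [hpr'] at hy
    rw [hpr', hpr'] at hxy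
    rw [hc' _ hy, hc' _ (by rwa [hxy])] at hcc
    exact Quot.sound (hL x y hy hxy hcc)
  refine ⟨h.isOpen, hinj, fun b hb f ↦ ?_, fun p hp ↦ ?_, fun {n} p hU hp hs ↦ ?_⟩
  · obtain ⟨x, hx, hc⟩ := h.surj b hb (σ f)
    refine ⟨Quot.mk r x, by rw [hpr', hx], ?_⟩
    rw [hc' _ (by rwa [hx]), hc, hσ]
  · refine (isPlot_quot_induction (chartDiffeology (X := X.quot r) pr' c' h.isOpen)
      (fun {n q} hq ↦ ⟨?_, ?_⟩) hp).2
    · have : (pr' ∘ fun t ↦ Quot.mk r (q t)) = pr ∘ q := funext fun t ↦ hpr' _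
      rw [this]
      exact hpr _ _ hq
    · have e : (pr' ∘ fun t ↦ Quot.mk r (q t)) = pr ∘ q := funext fun t ↦ hpr' _
      rw [e]
      exact (L.contDiff.comp_contDiffOn (h.contDiffOn q hq)).congr fun t ht ↦ hc' _ ht
  · choose x hx hcx using fun t ↦ h.surj _ (hU t) (σ (c' (p t)))
    have hxp : IsPlot x := by
      refine h.isPlot x (fun t ↦ by rw [hx]; exact hU t) ?_ ?_
      · have : pr ∘ x = pr' ∘ p := funext hx
        rwa [this]
      · exact (σ.contDiff.comp hs).of_eq hcx
    have : p = fun t ↦ Quot.mk r (x t) := funext fun t ↦ by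
      have hxU : pr (x t) ∈ U := by rw [hx]; exact hU t
      refine hinj (by rwa [hpr']) (by rw [hpr', hx]) ?_
      rw [hc' _ hxU, hcx, hσ]
    rw [this]
    exact isPlot_quot_mk hxp

end Quot

/-! ## Direct images and restrictions -/

namespace VecFib

variable {X X' B B' : SmoothSpace} {V : VecFib X B} {pr : X → B} {pr' : X' → B'} {f : X → X'}
  {g : B → B'} {U : Set B} {U' : Set B'} {F F' : Type*} [NormedAddCommGroup F] [NormedSpace ℝ F]
  [NormedAddCommGroup F'] [NormedSpace ℝ F'] {c : X → F} {c' : X' → F'}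

theorem IsProj.image (h : V.IsProj pr) (hf : Function.Surjective f) (hfg : ∀ x, pr' (f x) = g (pr x))
    (hpr' : DSmooth pr') : (V.image f g).IsProj pr' where
  smooth := hpr'
  liesOver_iff {x b} := by
    constructor
    · rintro ⟨x, b, rfl, rfl, hx⟩
      rw [hfg, h.liesOver_iff.1 hx]
    · rintro rfl
      obtain ⟨x, rfl⟩ := hf x
      exact ⟨x, pr x, rfl, (hfg x).symm, h.liesOver_iff.2 rfl⟩
  add := by
    rintro _ _ _ ⟨x, y, z, rfl, rfl, rfl, hadd⟩
    obtain ⟨h1, h2⟩ := h.add hadd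
    rw [hfg, hfg, hfg, h1, h2]
    exact ⟨rfl, rfl⟩
  smul := by
    rintro t _ _ ⟨x, y, rfl, rfl, hs⟩
    rw [hfg, hfg, h.smul hs]

/-- Operations of a direct image are defined through representatives. Their values are determined
since `L` is linear; suitable representatives exist since `σ` lifts coordinates linearly. -/
theorem IsTriv.image (h : V.IsTriv pr U c) (hpr : V.IsProj pr) (hg : Function.Surjective g)
    (hfg : ∀ x, pr' (f x) = g (pr x)) (hU : ∀ b, g b ∈ U' ↔ b ∈ U) (hc' : IsChart pr' U' c')
    {L : F →L[ℝ] F'} (hL : ∀ x, pr x ∈ U → c' (f x) = L (c x)) {σ : F' →L[ℝ] F}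
    (hσ : ∀ v, L (σ v) = v) : (V.image f g).IsTriv pr' U' c' := by
  -- All summands must be lifted over one and the same point `b` of the old base, since sums
  -- upstairs exist only inside a fibre.
  have lift : ∀ b ∈ U, ∀ x', pr' x' = g b → ∃ x, f x = x' ∧ pr x = b ∧ c x = σ (c' x') := by
    intro b hb x' hx'
    obtain ⟨x, hx, hcx⟩ := h.surj b hb (σ (c' x'))
    refine ⟨x, hc'.inj (by rw [hx', hU]; exact hb) (by rw [hfg, hx, hx']) ?_, hx, hcx⟩
    rw [hL x (by rwa [hx]), hcx, hσ]
  refine ⟨hc', fun {x y z} hz h1 h2 ↦ ⟨?_, fun hadd ↦ ?_⟩, fun {t x y} hy h1 ↦ ⟨?_, fun hs ↦ ?_⟩⟩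
  · rintro ⟨x, y, z, rfl, rfl, rfl, hadd⟩
    obtain ⟨h3, h4⟩ := hpr.add hadd
    have hz : pr z ∈ U := by rwa [hfg, hU] at hz
    rw [hL z hz, hL x (by rwa [h3]), hL y (by rwa [h4]), (h.add_iff hz h3 h4).1 hadd, map_add]
  · obtain ⟨b, hb⟩ := hg (pr' z)
    have hbU : b ∈ U := by rwa [← hU, hb]
    obtain ⟨x, rfl, hx, hcx⟩ := lift b hbU x (by rw [h1, hb])
    obtain ⟨y, rfl, hy, hcy⟩ := lift b hbU y (by rw [h2, hb])
    obtain ⟨z, rfl, hz, hcz⟩ := lift b hbU z hb.symm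
    exact ⟨x, y, z, rfl, rfl, rfl, (h.add_iff (by rwa [hz]) (by rw [hx, hz]) (by rw [hy, hz])).2
      (by rw [hcx, hcy, hcz, hadd, map_add])⟩
  · rintro ⟨x, y, rfl, rfl, hs⟩
    have h3 := hpr.smul hs
    have hy : pr y ∈ U := by rwa [hfg, hU] at hy
    rw [hL y hy, hL x (by rwa [h3]), (h.smul_iff hy h3).1 hs, map_smul]
  · obtain ⟨b, hb⟩ := hg (pr' y)
    have hbU : b ∈ U := by rwa [← hU, hb]
    obtain ⟨x, rfl, hx, hcx⟩ := lift b hbU x (by rw [h1, hb])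
    obtain ⟨y, rfl, hy, hcy⟩ := lift b hbU y hb.symm
    exact ⟨x, y, rfl, rfl, (h.smul_iff (by rwa [hy]) (by rw [hx, hy])).2
      (by rw [hcx, hcy, hs, map_smul])⟩

end VecFib

namespace DoubleVecFib

open VecFib

variable {D D₁ D₂ M : SmoothSpace} {A B C : Type*} [NormedAddCommGroup A] [NormedSpace ℝ A]
  [NormedAddCommGroup B] [NormedSpace ℝ B] [NormedAddCommGroup C] [NormedSpace ℝ C]
  {𝒟 : DoubleVecFib D D₁ D₂ M} {p₁ : D → D₁} {p₂ : D → D₂} {q₁ : D₁ → M} {q₂ : D₂ → M} {U : Set M}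
  {a : D₁ → A} {b : D₂ → B} {c : D → C}

/-! ### The core -/

theorem IsProj.core (h : 𝒟.IsProj p₁ p₂ q₁ q₂) :
    𝒟.core.IsProj (X := 𝒟.coreSpace) (fun k ↦ q₁ (p₁ (Subtype.val k))) where
  smooth n p hp := h.side₁.smooth _ _ (h.vert.smooth _ (fun t ↦ (Subtype.val (p t) : D)) hp)
  liesOver_iff {k m} := by
    constructor
    · rintro ⟨d₁, h1, h2⟩
      rw [← h.side₁.liesOver_iff.1 h2, ← h.vert.liesOver_iff.1 h1]
    · intro hm
      exact ⟨p₁ (Subtype.val k), h.vert.liesOver_iff.2 rfl, h.side₁.liesOver_iff.2 hm⟩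
  add hadd := ⟨congrArg q₁ (h.vert.add hadd).1, congrArg q₁ (h.vert.add hadd).2⟩
  smul hs := congrArg q₁ (h.vert.smul hs)

theorem IsDecomp.mem_coreSet_iff (h : 𝒟.IsProj p₁ p₂ q₁ q₂)
    (hd : 𝒟.IsDecomp p₁ p₂ q₁ q₂ U a b c) {x : D} (hx : q₁ (p₁ x) ∈ U) :
    x ∈ 𝒟.coreSet ↔ a (p₁ x) = 0 ∧ b (p₂ x) = 0 := by
  have h₂ : q₂ (p₂ x) ∈ U := by rwa [h.comm]
  rw [← hd.side₁.isZero_iff hx, ← hd.side₂.isZero_iff h₂]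
  constructor
  · rintro ⟨d₁, d₂, h1, h2, h3, h4⟩
    rw [h.vert.liesOver_iff] at h1
    rw [h.horiz.liesOver_iff] at h3
    subst h1 h3
    exact ⟨h2, h4⟩
  · rintro ⟨h1, h2⟩
    exact ⟨_, _, h.vert.liesOver_iff.2 rfl, h1, h.horiz.liesOver_iff.2 rfl, h2⟩

/-- The core is cut out by `a = 0` and `b = 0`, so `c` is what remains as coordinate. Two core
elements over the same point of `M` have the same side points, namely zero vectors, and their
vertical sum adds `c`. -/
theorem IsDecomp.core (h : 𝒟.IsProj p₁ p₂ q₁ q₂) (hd : 𝒟.IsDecomp p₁ p₂ q₁ q₂ U a b c) :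
    IsCoreTriv 𝒟.core (fun k : 𝒟.coreSpace ↦ (Subtype.val k : D))
      (fun k ↦ q₁ (p₁ (Subtype.val k))) p₁ p₂ q₁ U a b c (fun k ↦ c (Subtype.val k)) := by
  have ha : ∀ k : 𝒟.coreSpace, q₁ (p₁ (Subtype.val k)) ∈ U → a (p₁ (Subtype.val k)) = 0 :=
    fun k hk ↦ ((hd.mem_coreSet_iff h hk).1 (Subtype.property k)).1
  have hb : ∀ k : 𝒟.coreSpace, q₁ (p₁ (Subtype.val k)) ∈ U → b (p₂ (Subtype.val k)) = 0 :=
    fun k hk ↦ ((hd.mem_coreSet_iff h hk).1 (Subtype.property k)).2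
  have hp₁ : ∀ k l : 𝒟.coreSpace, q₁ (p₁ (Subtype.val l)) ∈ U →
      q₁ (p₁ (Subtype.val k)) = q₁ (p₁ (Subtype.val l)) →
      p₁ (Subtype.val k) = p₁ (Subtype.val l) := fun k l hl hkl ↦
    hd.side₁.inj hl hkl (by rw [ha l hl, ha k (by rwa [hkl])])
  refine ⟨⟨⟨hd.side₁.isOpen, ?_, ?_, ?_, ?_⟩, ?_, ?_⟩, fun _ _ ↦ rfl, ha, hb, fun _ _ ↦ rfl⟩
  · intro k l hl hkl hc
    have hk : q₁ (p₁ (Subtype.val k)) ∈ U := by rwa [hkl]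
    exact Subtype.ext (hd.total.inj hl hkl (by rw [ha _ hl, hb _ hl, ha _ hk, hb _ hk, hc]))
  · intro m hm w
    obtain ⟨x, hx, hc⟩ := hd.total.surj m hm (0, 0, w)
    rw [Prod.mk.injEq, Prod.mk.injEq] at hc
    exact ⟨⟨x, (hd.mem_coreSet_iff h (by rwa [hx])).2 ⟨hc.1, hc.2.1⟩⟩, hx, hc.2.2⟩
  · intro n p hp
    exact (hd.total.contDiffOn (fun t ↦ (Subtype.val (p t) : D)) hp).snd.snd
  · intro n p hU hp hs
    refine hd.total.isPlot (fun t ↦ (Subtype.val (p t) : D)) hU hp ?_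
    exact ((contDiff_const (c := (0 : A))).prodMk ((contDiff_const (c := (0 : B))).prodMk hs)).of_eq
      fun t ↦ Prod.ext (ha _ (hU t)) (Prod.ext (hb _ (hU t)) rfl)
  · intro k l m hm h1 h2
    refine (hd.vert_add hm (hp₁ k m hm h1) (hp₁ l m hm h2)).trans (and_iff_right ?_)
    rw [hb _ hm, hb k (by rwa [h1]), hb l (by rwa [h2]), add_zero]
  · intro t k m hm h1
    refine (hd.vert_smul hm (hp₁ k m hm h1)).trans (and_iff_right ?_)
    rw [hb _ hm, hb k (by rwa [h1]), smul_zero]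

/-! ### Direct images -/

section Image

variable {D' D₁' D₂' : SmoothSpace} {A' B' C' : Type*} [NormedAddCommGroup A'] [NormedSpace ℝ A']
  [NormedAddCommGroup B'] [NormedSpace ℝ B'] [NormedAddCommGroup C'] [NormedSpace ℝ C']
  {f : D → D'} {f₁ : D₁ → D₁'} {f₂ : D₂ → D₂'} {p₁' : D' → D₁'} {p₂' : D' → D₂'}
  {q₁' : D₁' → M} {q₂' : D₂' → M} {a' : D₁' → A'} {b' : D₂' → B'} {c' : D' → C'}

theorem IsProj.image (h : 𝒟.IsProj p₁ p₂ q₁ q₂) (hf : Function.Surjective f)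
    (hf₁ : Function.Surjective f₁) (hf₂ : Function.Surjective f₂)
    (hp₁ : ∀ d, p₁' (f d) = f₁ (p₁ d)) (hp₂ : ∀ d, p₂' (f d) = f₂ (p₂ d))
    (hq₁ : ∀ d, q₁' (f₁ d) = q₁ d) (hq₂ : ∀ d, q₂' (f₂ d) = q₂ d)
    (sp₁ : DSmooth p₁') (sp₂ : DSmooth p₂') (sq₁ : DSmooth q₁') (sq₂ : DSmooth q₂') :
    (𝒟.image f f₁ f₂).IsProj p₁' p₂' q₁' q₂' where
  vert := h.vert.image hf hp₁ sp₁
  horiz := h.horiz.image hf hp₂ sp₂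
  side₁ := h.side₁.image hf₁ hq₁ sq₁
  side₂ := h.side₂.image hf₂ hq₂ sq₂
  comm d := by
    obtain ⟨d, rfl⟩ := hf d
    rw [hp₁, hp₂, hq₁, hq₂, h.comm]

/-- A map that is a split linear surjection in each of the three coordinates carries decompositions
to decompositions: the vertical structure uses `LB × LC`, the horizontal one `LA × LC`. -/
theorem IsDecomp.image (h : 𝒟.IsProj p₁ p₂ q₁ q₂)
    (h' : (𝒟.image f f₁ f₂).IsProj p₁' p₂' q₁' q₂') (hd : 𝒟.IsDecomp p₁ p₂ q₁ q₂ U a b c)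
    (hf₁ : Function.Surjective f₁) (hf₂ : Function.Surjective f₂)
    (hp₁ : ∀ d, p₁' (f d) = f₁ (p₁ d)) (hp₂ : ∀ d, p₂' (f d) = f₂ (p₂ d))
    (hq₁ : ∀ d, q₁' (f₁ d) = q₁ d) (hq₂ : ∀ d, q₂' (f₂ d) = q₂ d)
    {LA : A →L[ℝ] A'} {LB : B →L[ℝ] B'} {LC : C →L[ℝ] C'}
    {σA : A' →L[ℝ] A} {σB : B' →L[ℝ] B} {σC : C' →L[ℝ] C}
    (hA : ∀ v, LA (σA v) = v) (hB : ∀ v, LB (σB v) = v) (hC : ∀ v, LC (σC v) = v)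
    (ha : ∀ d, q₁ d ∈ U → a' (f₁ d) = LA (a d)) (hb : ∀ d, q₂ d ∈ U → b' (f₂ d) = LB (b d))
    (hc : ∀ d, q₁ (p₁ d) ∈ U → c' (f d) = LC (c d))
    (hD : IsChart (fun d ↦ q₁' (p₁' d)) U (fun d ↦ (a' (p₁' d), b' (p₂' d), c' d)))
    (hD₁ : IsChart q₁' U a') (hD₂ : IsChart q₂' U b') :
    (𝒟.image f f₁ f₂).IsDecomp p₁' p₂' q₁' q₂' U a' b' c' := by
  have hv : (𝒟.image f f₁ f₂).vert.IsTriv p₁' (q₁' ⁻¹' U) (fun d ↦ (b' (p₂' d), c' d)) := by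
    refine (hd.vert h).image (L := LB.prodMap LC) (σ := σB.prodMap σC) h.vert hf₁ hp₁
      (fun d ↦ by simp [hq₁]) (hD₁.of_comp h'.side₁.smooth hD) (fun x hx ↦ ?_) (fun v ↦ ?_)
    · have hx' : q₂ (p₂ x) ∈ U := by rw [h.comm]; exact hx
      simp only [hp₂, hb _ hx', hc x hx]
      rfl
    · exact Prod.ext (hB _) (hC _)
  have hh : (𝒟.image f f₁ f₂).horiz.IsTriv p₂' (q₂' ⁻¹' U) (fun d ↦ (a' (p₁' d), c' d)) := by
    refine (hd.horiz h).image (L := LA.prodMap LC) (σ := σA.prodMap σC) h.horiz hf₂ hp₂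
      (fun d ↦ by simp [hq₂]) (hD₂.of_comp h'.side₂.smooth ?_) (fun x hx ↦ ?_) (fun v ↦ ?_)
    · simp only [h'.comm]
      exact hD.postcomp (prodSwap A' B' C')
    · have hx' : q₁ (p₁ x) ∈ U := by rw [← h.comm]; exact hx
      simp only [hp₁, ha _ hx', hc x hx']
      rfl
    · exact Prod.ext (hA _) (hC _)
  refine ⟨?_, ?_, hD, ?_, ?_, ?_, ?_⟩
  · exact hd.side₁.image h.side₁ Function.surjective_id hq₁ (fun _ ↦ Iff.rfl) hD₁ ha hA
  · exact hd.side₂.image h.side₂ Function.surjective_id hq₂ (fun _ ↦ Iff.rfl) hD₂ hb hB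
  · intro x y z hz h1 h2
    exact (hv.add_iff hz h1 h2).trans Prod.ext_iff
  · intro t x y hy h1
    exact (hv.smul_iff hy h1).trans Prod.ext_iff
  · intro x y z hz h1 h2
    exact (hh.add_iff (by rw [mem_preimage, h'.comm]; exact hz) h1 h2).trans Prod.ext_iff
  · intro t x y hy h1
    exact (hh.smul_iff (by rw [mem_preimage, h'.comm]; exact hy) h1).trans Prod.ext_iff

end Image

/-! ### Restrictions -/

theorem IsProj.restrict (h : 𝒟.IsProj p₁ p₂ q₁ q₂) (S : Set D) :
    (𝒟.restrict S).IsProj (D := D.sub S) (fun d ↦ p₁ (Subtype.val d)) (fun d ↦ p₂ (Subtype.val d))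
      q₁ q₂ where
  vert := ⟨fun _ p hp ↦ h.vert.smooth _ (fun t ↦ (Subtype.val (p t) : D)) hp, h.vert.liesOver_iff,
    fun h' ↦ h.vert.add h', fun h' ↦ h.vert.smul h'⟩
  horiz := ⟨fun _ p hp ↦ h.horiz.smooth _ (fun t ↦ (Subtype.val (p t) : D)) hp,
    h.horiz.liesOver_iff, fun h' ↦ h.horiz.add h', fun h' ↦ h.horiz.smul h'⟩
  side₁ := h.side₁
  side₂ := h.side₂
  comm _ := h.comm _

/-- The subset is cut out by the linear condition that the core coordinate lies in the range of `j`,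
with `P` a left inverse of `j`. Both side coordinates stay unconstrained, so both structures
restrict. -/
theorem IsDecomp.restrict {C' : Type*} [NormedAddCommGroup C'] [NormedSpace ℝ C']
    (h : 𝒟.IsProj p₁ p₂ q₁ q₂) (hd : 𝒟.IsDecomp p₁ p₂ q₁ q₂ U a b c) {S : Set D} {j : C' →L[ℝ] C} {P : C →L[ℝ] C'}
    (hP : ∀ v, P (j v) = v) (hS : ∀ d, q₁ (p₁ d) ∈ U → (d ∈ S ↔ c d = j (P (c d)))) :
    (𝒟.restrict S).IsDecomp (D := D.sub S) (fun d ↦ p₁ (Subtype.val d))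
      (fun d ↦ p₂ (Subtype.val d)) q₁ q₂ U a b (fun d ↦ P (c (Subtype.val d))) := by
  have hc : ∀ d : D.sub S, q₁ (p₁ (Subtype.val d)) ∈ U →
      c (Subtype.val d) = j (P (c (Subtype.val d))) := fun d hd ↦
    (hS _ hd).1 (Subtype.property d)
  have hinj : ∀ {v w}, j v = j w ↔ v = w := fun {v w} ↦
    ⟨fun e ↦ by rw [← hP v, e, hP], fun e ↦ e ▸ rfl⟩
  refine ⟨hd.side₁, hd.side₂, ⟨hd.side₁.isOpen, ?_, ?_, ?_, ?_⟩, ?_, ?_, ?_, ?_⟩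
  · intro x y hy hxy hcc
    rw [Prod.mk.injEq, Prod.mk.injEq] at hcc
    refine Subtype.ext (hd.total.inj hy hxy ?_)
    rw [hcc.1, hcc.2.1, hc x (by rwa [hxy]), hcc.2.2, ← hc y hy]
  · intro m hm ⟨v₁, v₂, v₃⟩
    obtain ⟨x, hx, hcx⟩ := hd.total.surj m hm (v₁, v₂, j v₃)
    rw [Prod.mk.injEq, Prod.mk.injEq] at hcx
    refine ⟨⟨x, (hS x (by rwa [hx])).2 ?_⟩, hx, ?_⟩
    · rw [hcx.2.2, hP]
    · simp only [hcx.1, hcx.2.1, hcx.2.2, hP]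
  · intro n p hp
    have := hd.total.contDiffOn (fun t ↦ (Subtype.val (p t) : D)) hp
    exact this.fst.prodMk (this.snd.fst.prodMk (P.contDiff.comp_contDiffOn this.snd.snd))
  · intro n p hU hp hs
    refine hd.total.isPlot (fun t ↦ (Subtype.val (p t) : D)) hU hp ?_
    exact (hs.fst.prodMk (hs.snd.fst.prodMk (j.contDiff.comp hs.snd.snd))).of_eq fun t ↦
      Prod.ext rfl (Prod.ext rfl (hc _ (hU t)))
  · intro x y z hz h1 h2
    refine (hd.vert_add hz h1 h2).trans (and_congr_right fun _ ↦ ?_)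
    rw [hc z hz, hc x (by rwa [h1]), hc y (by rwa [h2]), ← map_add, hinj, hP, hP, hP]
  · intro t x y hy h1
    refine (hd.vert_smul hy h1).trans (and_congr_right fun _ ↦ ?_)
    rw [hc y hy, hc x (by rwa [h1]), ← map_smul, hinj, hP, hP]
  · intro x y z hz h1 h2
    have e1 := (h.comm x.1).symm.trans ((congrArg q₂ h1).trans (h.comm z.1))
    have e2 := (h.comm y.1).symm.trans ((congrArg q₂ h2).trans (h.comm z.1))
    refine (hd.horiz_add hz h1 h2).trans (and_congr_right fun _ ↦ ?_)
    rw [hc z hz, hc x (by rwa [e1]), hc y (by rwa [e2]), ← map_add, hinj, hP, hP, hP]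
  · intro t x y hy h1
    have e1 := (h.comm x.1).symm.trans ((congrArg q₂ h1).trans (h.comm y.1))
    refine (hd.horiz_smul hy h1).trans (and_congr_right fun _ ↦ ?_)
    rw [hc y hy, hc x (by rwa [e1]), ← map_smul, hinj, hP, hP]

end DoubleVecFib

/-! ## Isomorphisms -/

/-- A relation over `M` that is the graph of a bijection of fibres in every chart is functional in
both directions. This produces global maps from a coordinate-free characterization without gluing
local formulas. -/
theorem exists_equiv_of_charts {X X' M : SmoothSpace} {pr : X → M} {pr' : X' → M}
    (R : X → X' → Prop) (hR : ∀ x x', R x x' → pr' x' = pr x)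
    (hloc : ∀ m : M, ∃ (U : Set M) (F F' : Type) (_ : NormedAddCommGroup F) (_ : NormedSpace ℝ F)
      (_ : NormedAddCommGroup F') (_ : NormedSpace ℝ F') (c : X → F) (c' : X' → F')
      (L : F ≃L[ℝ] F'), m ∈ U ∧ IsChart pr U c ∧ IsChart pr' U c' ∧
        ∀ x x', pr x ∈ U → pr' x' = pr x → (R x x' ↔ c' x' = L (c x))) :
    ∃ f : X ≃ X', ∀ x x', f x = x' ↔ R x x' := by
  have h1 : ∀ x, ∃! x', R x x' := by
    intro x
    obtain ⟨U, F, F', _, _, _, _, c, c', L, hm, hc, hc', hL⟩ := hloc (pr x)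
    obtain ⟨x', hx', hcx'⟩ := hc'.surj (pr x) hm (L (c x))
    refine ⟨x', (hL x x' hm hx').2 hcx', fun y hy ↦ ?_⟩
    have hy' := hR x y hy
    exact hc'.inj (by rwa [hx']) (by rw [hy', hx']) (by rw [(hL x y hm hy').1 hy, hcx'])
  have h2 : ∀ x', ∃! x, R x x' := by
    intro x'
    obtain ⟨U, F, F', _, _, _, _, c, c', L, hm, hc, hc', hL⟩ := hloc (pr' x')
    obtain ⟨x, hx, hcx⟩ := hc.surj (pr' x') hm (L.symm (c' x'))
    refine ⟨x, (hL x x' (by rwa [hx]) hx.symm).2 (by rw [hcx, L.apply_symm_apply]), fun y hy ↦ ?_⟩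
    have hy' := hR y x' hy
    refine hc.inj (by rwa [hx]) (by rw [← hy', hx]) ?_
    rw [hcx, (hL y x' (by rwa [← hy']) hy').1 hy, L.symm_apply_apply]
  choose f hf huf using h1
  choose g hg hug using h2
  exact ⟨⟨f, g, fun x ↦ (hug _ x (hf x)).symm, fun x' ↦ (huf _ x' (hg x')).symm⟩,
    fun x x' ↦ ⟨fun e ↦ e ▸ hf x, fun h ↦ (huf x x' h).symm⟩⟩

namespace VecFib

variable {X X' B B' : SmoothSpace} {V : VecFib X B} {V' : VecFib X' B'} {pr : X → B}
  {pr' : X' → B'}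

/-- Smoothness, additivity and homogeneity can all be read off in charts in which the map is linear
with constant coefficients on the fibres. -/
theorem isMorphism_of_isTriv (h : V.IsProj pr) (h' : V'.IsProj pr') {f : X → X'} {g : B → B'}
    (hg : DSmooth g) (hfg : ∀ x, pr' (f x) = g (pr x))
    (hloc : ∀ b : B, ∃ (U : Set B) (U' : Set B') (F F' : Type) (_ : NormedAddCommGroup F)
      (_ : NormedSpace ℝ F) (_ : NormedAddCommGroup F') (_ : NormedSpace ℝ F') (c : X → F)
      (c' : X' → F') (L : F →L[ℝ] F'), b ∈ U ∧ (∀ b ∈ U, g b ∈ U') ∧ V.IsTriv pr U c ∧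
        V'.IsTriv pr' U' c' ∧ ∀ x, pr x ∈ U → c' (f x) = L (c x)) :
    DSmooth f ∧ V.IsMorphism V' f g := by
  refine ⟨fun n p hp ↦ isPlot_of_locally fun t ↦ ?_, fun x b hx ↦ ?_, fun x y z hadd ↦ ?_,
    fun t x y hs ↦ ?_⟩
  · obtain ⟨U, U', F, F', _, _, _, _, c, c', L, hb, hU, hc, hc', hL⟩ := hloc (pr (p t))
    refine ⟨_, hc.isOpen_preimage (h.smooth _ _ hp), hb, fun m q hq hq' ↦ ?_⟩
    have hpq : IsPlot (p ∘ q) := isPlot_reparam hp hq'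
    refine hc'.isPlot _ (fun s ↦ ?_) ?_ ?_
    · have := hU _ (hq s)
      rwa [Function.comp_apply, Function.comp_apply, hfg]
    · have : (pr' ∘ (f ∘ p) ∘ q) = g ∘ (pr ∘ (p ∘ q)) := funext fun s ↦ hfg _
      rw [this]
      exact hg _ _ (h.smooth _ _ hpq)
    · exact (L.contDiff.comp (hc.contDiff hpq hq)).of_eq fun s ↦ hL _ (hq s)
  · rw [h.liesOver_iff] at hx
    rw [h'.liesOver_iff, hfg, hx]
  · obtain ⟨U, U', F, F', _, _, _, _, c, c', L, hb, hU, hc, hc', hL⟩ := hloc (pr z)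
    obtain ⟨h1, h2⟩ := h.add hadd
    refine (hc'.add_iff (by rw [hfg]; exact hU _ hb) (by rw [hfg, hfg, h1])
      (by rw [hfg, hfg, h2])).2 ?_
    rw [hL z hb, hL x (by rwa [h1]), hL y (by rwa [h2]), (hc.add_iff hb h1 h2).1 hadd, map_add]
  · obtain ⟨U, U', F, F', _, _, _, _, c, c', L, hb, hU, hc, hc', hL⟩ := hloc (pr y)
    have h1 := h.smul hs
    refine (hc'.smul_iff (by rw [hfg]; exact hU _ hb) (by rw [hfg, hfg, h1])).2 ?_
    rw [hL y hb, hL x (by rwa [h1]), (hc.smul_iff hb h1).1 hs, map_smul]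

/-- The inverse is given by `L.symm` in the same charts; requiring that `U'` and `U` correspond
exactly under `g` makes the argument symmetric. -/
theorem isIso_of_isTriv (h : V.IsProj pr) (h' : V'.IsProj pr') {f : X ≃ X'} {g : B ≃ B'}
    (hg : DSmooth g) (hg' : DSmooth g.symm) (hfg : ∀ x, pr' (f x) = g (pr x))
    (hloc : ∀ b : B, ∃ (U : Set B) (U' : Set B') (F F' : Type) (_ : NormedAddCommGroup F)
      (_ : NormedSpace ℝ F) (_ : NormedAddCommGroup F') (_ : NormedSpace ℝ F') (c : X → F)
      (c' : X' → F') (L : F ≃L[ℝ] F'), b ∈ U ∧ (∀ b, g b ∈ U' ↔ b ∈ U) ∧ V.IsTriv pr U c ∧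
        V'.IsTriv pr' U' c' ∧ ∀ x, pr x ∈ U → c' (f x) = L (c x)) : V.IsIso V' f g := by
  obtain ⟨h1, h2⟩ := isMorphism_of_isTriv (f := f) h h' hg hfg fun b ↦ by
    obtain ⟨U, U', F, F', i1, i2, i3, i4, c, c', L, hb, hU, hc, hc', hL⟩ := hloc b
    exact ⟨U, U', F, F', i1, i2, i3, i4, c, c', L, hb, fun b hb ↦ (hU b).2 hb, hc, hc', hL⟩
  have hfg' : ∀ x', pr (f.symm x') = g.symm (pr' x') := fun x' ↦ by
    rw [g.eq_symm_apply, ← hfg, f.apply_symm_apply]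
  obtain ⟨h3, h4⟩ := isMorphism_of_isTriv (f := f.symm) h' h hg' hfg' fun b' ↦ by
    obtain ⟨U, U', F, F', i1, i2, i3, i4, c, c', L, hb, hU, hc, hc', hL⟩ := hloc (g.symm b')
    have hU' : ∀ b', g.symm b' ∈ U ↔ b' ∈ U' := fun b' ↦ by rw [← hU, g.apply_symm_apply]
    refine ⟨U', U, F', F, i3, i4, i1, i2, c', c, L.symm, (hU' b').1 hb, fun b hb ↦ (hU' b).2 hb,
      hc', hc, fun x' hx' ↦ ?_⟩
    rw [ContinuousLinearEquiv.coe_coe, ContinuousLinearEquiv.eq_symm_apply, ← hL, f.apply_symm_apply]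
    rw [hfg', hU']
    exact hx'
  exact ⟨h1, h3, hg, hg', h2, h4⟩

end VecFib

namespace DoubleVecFib

variable {D D₁ D₂ M D' D₁' D₂' : SmoothSpace} {𝒟 : DoubleVecFib D D₁ D₂ M}
  {𝒟' : DoubleVecFib D' D₁' D₂' M} {p₁ : D → D₁} {p₂ : D → D₂} {q₁ : D₁ → M} {q₂ : D₂ → M}
  {p₁' : D' → D₁'} {p₂' : D' → D₂'} {q₁' : D₁' → M} {q₂' : D₂' → M}

/-- Each of the four bundles has a trivialization formed from two or one of the coordinates `a`,
`b`, `c`, and there the map is the corresponding product of linear isomorphisms. -/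
theorem isIso_of_isDecomp (h : 𝒟.IsProj p₁ p₂ q₁ q₂) (h' : 𝒟'.IsProj p₁' p₂' q₁' q₂')
    {f : D ≃ D'} {f₁ : D₁ ≃ D₁'} {f₂ : D₂ ≃ D₂'} (hp₁ : ∀ d, p₁' (f d) = f₁ (p₁ d))
    (hp₂ : ∀ d, p₂' (f d) = f₂ (p₂ d)) (hq₁ : ∀ d, q₁' (f₁ d) = q₁ d) (hq₂ : ∀ d, q₂' (f₂ d) = q₂ d)
    (hloc : ∀ m : M, ∃ (U : Set M) (A B C A' B' C' : Type)
      (_ : NormedAddCommGroup A) (_ : NormedSpace ℝ A) (_ : NormedAddCommGroup B)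
      (_ : NormedSpace ℝ B) (_ : NormedAddCommGroup C) (_ : NormedSpace ℝ C)
      (_ : NormedAddCommGroup A') (_ : NormedSpace ℝ A') (_ : NormedAddCommGroup B')
      (_ : NormedSpace ℝ B') (_ : NormedAddCommGroup C') (_ : NormedSpace ℝ C')
      (a : D₁ → A) (b : D₂ → B) (c : D → C) (a' : D₁' → A') (b' : D₂' → B') (c' : D' → C')
      (LA : A ≃L[ℝ] A') (LB : B ≃L[ℝ] B') (LC : C ≃L[ℝ] C'), m ∈ U ∧
      𝒟.IsDecomp p₁ p₂ q₁ q₂ U a b c ∧ 𝒟'.IsDecomp p₁' p₂' q₁' q₂' U a' b' c' ∧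
      (∀ d, q₁ d ∈ U → a' (f₁ d) = LA (a d)) ∧ (∀ d, q₂ d ∈ U → b' (f₂ d) = LB (b d)) ∧
      ∀ d, q₁ (p₁ d) ∈ U → c' (f d) = LC (c d)) : 𝒟.IsIso 𝒟' f f₁ f₂ := by
  have s₁ : 𝒟.side₁.IsIso 𝒟'.side₁ f₁ (Equiv.refl M) :=
    VecFib.isIso_of_isTriv h.side₁ h'.side₁ dSmooth_id dSmooth_id hq₁ fun m ↦ by
      obtain ⟨U, A, B, C, A', B', C', _, _, _, _, _, _, _, _, _, _, _, _, a, b, c, a', b', c',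
        LA, LB, LC, hm, hd, hd', ha, hb, hc⟩ := hloc m
      exact ⟨U, U, A, A', inferInstance, inferInstance, inferInstance, inferInstance, a, a', LA, hm,
        fun _ ↦ Iff.rfl, hd.side₁, hd'.side₁, ha⟩
  have s₂ : 𝒟.side₂.IsIso 𝒟'.side₂ f₂ (Equiv.refl M) :=
    VecFib.isIso_of_isTriv h.side₂ h'.side₂ dSmooth_id dSmooth_id hq₂ fun m ↦ by
      obtain ⟨U, A, B, C, A', B', C', _, _, _, _, _, _, _, _, _, _, _, _, a, b, c, a', b', c',
        LA, LB, LC, hm, hd, hd', ha, hb, hc⟩ := hloc m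
      exact ⟨U, U, B, B', inferInstance, inferInstance, inferInstance, inferInstance, b, b', LB, hm,
        fun _ ↦ Iff.rfl, hd.side₂, hd'.side₂, hb⟩
  refine ⟨VecFib.isIso_of_isTriv h.vert h'.vert s₁.1 s₁.2.1 hp₁ fun d₁ ↦ ?_,
    VecFib.isIso_of_isTriv h.horiz h'.horiz s₂.1 s₂.2.1 hp₂ fun d₂ ↦ ?_, s₁, s₂⟩
  · obtain ⟨U, A, B, C, A', B', C', _, _, _, _, _, _, _, _, _, _, _, _, a, b, c, a', b', c',
      LA, LB, LC, hm, hd, hd', ha, hb, hc⟩ := hloc (q₁ d₁)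
    refine ⟨_, _, B × C, B' × C', inferInstance, inferInstance, inferInstance, inferInstance,
      _, _, LB.prodCongr LC, hm, fun d ↦ ?_, hd.vert h, hd'.vert h', fun x hx ↦ ?_⟩
    · rw [mem_preimage, mem_preimage, hq₁]
    · refine Prod.ext ?_ (hc x hx)
      change b' (p₂' (f x)) = LB (b (p₂ x))
      rw [hp₂, hb]
      rw [h.comm]; exact hx
  · obtain ⟨U, A, B, C, A', B', C', _, _, _, _, _, _, _, _, _, _, _, _, a, b, c, a', b', c',
      LA, LB, LC, hm, hd, hd', ha, hb, hc⟩ := hloc (q₂ d₂)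
    refine ⟨_, _, A × C, A' × C', inferInstance, inferInstance, inferInstance, inferInstance,
      _, _, LA.prodCongr LC, hm, fun d ↦ ?_, hd.horiz h, hd'.horiz h', fun x hx ↦ ?_⟩
    · rw [mem_preimage, mem_preimage, hq₂]
    · rw [mem_preimage, h.comm] at hx
      refine Prod.ext ?_ (hc x hx)
      change a' (p₁' (f x)) = LA (a (p₁ x))
      rw [hp₁, ha _ hx]

end DoubleVecFib

/-! ## Local coordinates on manifolds and their tangent bundles -/

section LocalCoord

variable {E H : Type*} [NormedAddCommGroup E] [NormedSpace ℝ E] [TopologicalSpace H]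
  (I : ModelWithCorners ℝ E H) {N : Type u} [TopologicalSpace N] [ChartedSpace H N]
  {V : Type*} [NormedAddCommGroup V] [NormedSpace ℝ V]

theorem isPlot_ofManifold_iff {n : ℕ} {p : EuclideanSpace ℝ (Fin n) → N} :
    IsPlot (X := SmoothSpace.ofManifold I N) p ↔
      ContMDiff 𝓘(ℝ, EuclideanSpace ℝ (Fin n)) I ∞ p :=
  contMDiffOn_univ

theorem isOpen_dTopology_ofManifold {U : Set N} (hU : IsOpen U) :
    IsOpen[dTopology (X := SmoothSpace.ofManifold I N)] U :=
  isOpen_iff_preimages_plots.2 fun _ _ hp ↦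
    hU.preimage ((isPlot_ofManifold_iff (N := N) I).1 hp).continuous

theorem dSmooth_ofManifold {E' H' : Type*} [NormedAddCommGroup E'] [NormedSpace ℝ E']
    [TopologicalSpace H'] (I' : ModelWithCorners ℝ E' H') {N' : Type v} [TopologicalSpace N']
    [ChartedSpace H' N'] {f : N → N'} (hf : ContMDiff I I' ∞ f) :
    DSmooth (X := SmoothSpace.ofManifold I N) (Y := SmoothSpace.ofManifold I' N') f :=
  fun _ _ hp ↦ (isPlot_ofManifold_iff (N := N') I').2
    (hf.comp ((isPlot_ofManifold_iff (N := N) I).1 hp))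

/-- Mutually inverse smooth maps between open subsets of a manifold and of a vector space. -/
structure IsLocalCoord (W : Set N) (O : Set V) (Q : N → V) (S : V → N) : Prop where
  isOpen_source : IsOpen W
  isOpen_target : IsOpen O
  contMDiffOn : ContMDiffOn I 𝓘(ℝ, V) ∞ Q W
  contMDiffOn_symm : ContMDiffOn 𝓘(ℝ, V) I ∞ S O
  map_source : ∀ x ∈ W, Q x ∈ O
  map_target : ∀ v ∈ O, S v ∈ W
  left_inv : ∀ x ∈ W, S (Q x) = x
  right_inv : ∀ v ∈ O, Q (S v) = v

/-- The derivative of a vector valued function as a function on the tangent bundle. -/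
def dcoord (Q : N → V) (X : TangentBundle I N) : V := mfderiv I 𝓘(ℝ, V) Q X.1 X.2

variable {I} {W : Set N} {O : Set V} {Q : N → V} {S : V → N}

theorem tangentMap_eq_mk_dcoord (X : TangentBundle I N) :
    tangentMap I 𝓘(ℝ, V) Q X =
      (⟨Q X.1, (dcoord I Q X : V)⟩ : TangentBundle 𝓘(ℝ, V) V) := rfl

theorem IsLocalCoord.mdifferentiableAt (h : IsLocalCoord I W O Q S) {x : N} (hx : x ∈ W) :
    MDifferentiableAt I 𝓘(ℝ, V) Q x :=
  (h.contMDiffOn.contMDiffAt (h.isOpen_source.mem_nhds hx)).mdifferentiableAt (by simp)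

theorem IsLocalCoord.mdifferentiableAt_symm (h : IsLocalCoord I W O Q S) {v : V} (hv : v ∈ O) :
    MDifferentiableAt 𝓘(ℝ, V) I S v :=
  (h.contMDiffOn_symm.contMDiffAt (h.isOpen_target.mem_nhds hv)).mdifferentiableAt (by simp)

theorem tangentMap_congr_of_eventuallyEq {E' H' : Type*} [NormedAddCommGroup E'] [NormedSpace ℝ E']
    [TopologicalSpace H'] {I' : ModelWithCorners ℝ E' H'} {N' : Type v} [TopologicalSpace N']
    [ChartedSpace H' N'] {f g : N → N'} {X : TangentBundle I N} (h : f =ᶠ[𝓝 X.1] g) :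
    tangentMap I I' f X = tangentMap I I' g X := by
  have h1 : f X.1 = g X.1 := h.self_of_nhds
  have h2 : mfderiv I I' f X.1 = mfderiv I I' g X.1 := h.mfderiv_eq
  rcases X with ⟨x, w⟩
  simp only [tangentMap]
  exact TotalSpace.ext h1 (heq_of_eq (congrArg (fun L : E →L[ℝ] E' ↦ L w) h2))

theorem dcoord_congr_of_eventuallyEq {f g : N → V} {X : TangentBundle I N} (h : f =ᶠ[𝓝 X.1] g) :
    dcoord I f X = dcoord I g X := by
  have h2 : mfderiv I 𝓘(ℝ, V) f X.1 = mfderiv I 𝓘(ℝ, V) g X.1 := h.mfderiv_eq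
  exact congrArg (fun L : E →L[ℝ] V ↦ L X.2) h2

theorem dcoord_tangentMap {E' H' : Type*} [NormedAddCommGroup E'] [NormedSpace ℝ E']
    [TopologicalSpace H'] {I' : ModelWithCorners ℝ E' H'} {N' : Type v} [TopologicalSpace N']
    [ChartedSpace H' N'] {g : N' → N} {X : TangentBundle I' N'}
    (hQ : MDifferentiableAt I 𝓘(ℝ, V) Q (g X.1)) (hg : MDifferentiableAt I' I g X.1) :
    dcoord I Q (tangentMap I' I g X) = dcoord I' (Q ∘ g) X := by
  rw [dcoord, dcoord, mfderiv_comp X.1 hQ hg]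
  rfl

theorem IsLocalCoord.tangentMap_symm_tangentMap (h : IsLocalCoord I W O Q S)
    {X : TangentBundle I N} (hX : X.1 ∈ W) :
    tangentMap 𝓘(ℝ, V) I S (tangentMap I 𝓘(ℝ, V) Q X) = X := by
  rw [← tangentMap_comp_at X (h.mdifferentiableAt_symm (h.map_source _ hX)) (h.mdifferentiableAt hX)]
  have : S ∘ Q =ᶠ[𝓝 X.1] id := by
    filter_upwards [h.isOpen_source.mem_nhds hX] with x hx using h.left_inv x hx
  rw [tangentMap_congr_of_eventuallyEq this, tangentMap_id]
  rfl

theorem IsLocalCoord.dcoord_tangentMap_symm (h : IsLocalCoord I W O Q S) {v : V} (hv : v ∈ O)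
    (w : V) : dcoord I Q (tangentMap 𝓘(ℝ, V) I S ⟨v, w⟩) = w := by
  rw [dcoord_tangentMap (h.mdifferentiableAt (h.map_target v hv)) (h.mdifferentiableAt_symm hv)]
  have : Q ∘ S =ᶠ[𝓝 v] id := by
    filter_upwards [h.isOpen_target.mem_nhds hv] with x hx using h.right_inv x hx
  rw [dcoord_congr_of_eventuallyEq (X := ⟨v, w⟩) this]
  exact congrArg (fun L : V →L[ℝ] V ↦ L w) (mfderiv_id (I := 𝓘(ℝ, V)) (x := v))

/-- The differential of the inverse coordinate map recovers a tangent vector from its coordinates.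
-/
theorem IsLocalCoord.tangent_ext (h : IsLocalCoord I W O Q S) {X Y : TangentBundle I N}
    (hX : X.1 ∈ W) (hY : Y.1 ∈ W) (h1 : Q X.1 = Q Y.1) (h2 : dcoord I Q X = dcoord I Q Y) :
    X = Y := by
  rw [← h.tangentMap_symm_tangentMap hX, ← h.tangentMap_symm_tangentMap hY,
    tangentMap_eq_mk_dcoord, tangentMap_eq_mk_dcoord, h1, h2]

theorem contMDiff_mk_tangentBundle_vectorSpace {n : ℕ} {f g : EuclideanSpace ℝ (Fin n) → V}
    (hf : ContDiff ℝ ∞ f) (hg : ContDiff ℝ ∞ g) :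
    ContMDiff 𝓘(ℝ, EuclideanSpace ℝ (Fin n)) 𝓘(ℝ, V).tangent ∞
      (fun t ↦ (⟨f t, g t⟩ : TangentBundle 𝓘(ℝ, V) V)) := fun t ↦ by
  rw [contMDiffAt_totalSpace]
  refine ⟨hf.contMDiff.contMDiffAt, ?_⟩
  simp only [trivializationAt_model_space_apply]
  exact hg.contMDiff.contMDiffAt

variable [IsManifold I ∞ N]

/-- `Q` is smooth only on `W`, so the tangent map within `W` is used; on an open set it agrees with
the full one. -/
theorem IsLocalCoord.contDiffOn_dcoord (h : IsLocalCoord I W O Q S) {n : ℕ}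
    {p : EuclideanSpace ℝ (Fin n) → TangentBundle I N}
    (hp : ContMDiff 𝓘(ℝ, EuclideanSpace ℝ (Fin n)) I.tangent ∞ p) :
    ContDiffOn ℝ ∞ (fun t ↦ dcoord I Q (p t)) {t | (p t).1 ∈ W} := by
  have h1 : ContMDiffOn I.tangent 𝓘(ℝ, V).tangent ∞ (tangentMapWithin I 𝓘(ℝ, V) Q W)
      (TotalSpace.proj ⁻¹' W) :=
    h.contMDiffOn.contMDiffOn_tangentMapWithin (by simp) h.isOpen_source.uniqueMDiffOn
  have h2 := (contMDiff_snd_tangentBundle_modelSpace V 𝓘(ℝ, V) (n := ∞)).comp_contMDiffOn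
    (h1.comp hp.contMDiffOn (s := {t | (p t).1 ∈ W}) fun t ht ↦ ht)
  refine h2.contDiffOn.congr fun t ht ↦ ?_
  exact (congrArg (fun Y : TangentBundle 𝓘(ℝ, V) V ↦ (Y.2 : V)) (tangentMapWithin_eq_tangentMap
    (h.isOpen_source.uniqueMDiffOn _ ht) (h.mdifferentiableAt ht))).symm

theorem IsLocalCoord.contMDiff_of_dcoord (h : IsLocalCoord I W O Q S) {n : ℕ}
    {p : EuclideanSpace ℝ (Fin n) → TangentBundle I N} (hW : ∀ t, (p t).1 ∈ W)
    (hp : ContMDiff 𝓘(ℝ, EuclideanSpace ℝ (Fin n)) I ∞ (fun t ↦ (p t).1))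
    (hd : ContDiff ℝ ∞ (fun t ↦ dcoord I Q (p t))) :
    ContMDiff 𝓘(ℝ, EuclideanSpace ℝ (Fin n)) I.tangent ∞ p := by
  have hQ : ContDiff ℝ ∞ (fun t ↦ Q (p t).1) := by
    rw [← contMDiff_iff_contDiff, ← contMDiffOn_univ]
    exact h.contMDiffOn.comp hp.contMDiffOn fun t _ ↦ hW t
  have h1 : ContMDiffOn 𝓘(ℝ, V).tangent I.tangent ∞ (tangentMapWithin 𝓘(ℝ, V) I S O)
      (TotalSpace.proj ⁻¹' O) :=
    h.contMDiffOn_symm.contMDiffOn_tangentMapWithin (by simp) h.isOpen_target.uniqueMDiffOn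
  have h2 := h1.comp (contMDiff_mk_tangentBundle_vectorSpace hQ hd).contMDiffOn (s := univ)
    fun t _ ↦ h.map_source _ (hW t)
  rw [contMDiffOn_univ] at h2
  refine h2.congr fun t ↦ ?_
  simp only [Function.comp_apply]
  rw [tangentMapWithin_eq_tangentMap (h.isOpen_target.uniqueMDiffOn _ (h.map_source _ (hW t)))
    (h.mdifferentiableAt_symm (h.map_source _ (hW t)))]
  exact (h.tangentMap_symm_tangentMap (hW t)).symm

variable (I N) in
/-- The tangent bundle of a manifold. -/
def tangentFib : VecFib (SmoothSpace.ofManifold I.tangent (TangentBundle I N))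
    (SmoothSpace.ofManifold I N) where
  liesOver X e := TotalSpace.proj (E := (TangentSpace I : N → Type _)) X = e
  add X Y Z := ∃ (e : N) (a b : TangentSpace I e), X = (⟨e, a⟩ : TangentBundle I N) ∧
    Y = (⟨e, b⟩ : TangentBundle I N) ∧ Z = (⟨e, a + b⟩ : TangentBundle I N)
  smul t X Y := ∃ (e : N) (a : TangentSpace I e), X = (⟨e, a⟩ : TangentBundle I N) ∧
    Y = (⟨e, t • a⟩ : TangentBundle I N)

theorem tangentFib_isProj :
    (tangentFib I N).IsProj (TotalSpace.proj : TangentBundle I N → N) where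
  smooth := dSmooth_ofManifold I.tangent I (contMDiff_proj _)
  liesOver_iff := Iff.rfl
  add := by rintro _ _ _ ⟨e, a, b, rfl, rfl, rfl⟩; exact ⟨rfl, rfl⟩
  smul := by rintro t _ _ ⟨e, a, rfl, rfl⟩; rfl

/-- The differentials of `Q` and `S` are mutually inverse, smooth and linear on fibres. The same
lemma serves for `TM`, `TE` and the tangent bundle of `E ⊕ E`. -/
theorem IsLocalCoord.tangentFib_isTriv (h : IsLocalCoord I W O Q S) :
    (tangentFib I N).IsTriv (TotalSpace.proj : TangentBundle I N → N) W (dcoord I Q) where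
  isOpen := isOpen_dTopology_ofManifold I h.isOpen_source
  inj {X Y} hY hXY hc := h.tangent_ext (by rw [hXY]; exact hY) hY (by rw [hXY]) hc
  surj x hx w := by
    refine ⟨tangentMap 𝓘(ℝ, V) I S ⟨Q x, w⟩, h.left_inv x hx, ?_⟩
    exact h.dcoord_tangentMap_symm (h.map_source x hx) w
  contDiffOn p hp := h.contDiffOn_dcoord ((isPlot_ofManifold_iff (N := TangentBundle I N) I.tangent).1 hp)
  isPlot p hU hp hd := (isPlot_ofManifold_iff (N := TangentBundle I N) I.tangent).2
    (h.contMDiff_of_dcoord hU ((isPlot_ofManifold_iff (N := N) I).1 hp) hd)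
  add_iff {X Y Z} hZ h1 h2 := by
    obtain ⟨e, a⟩ := X
    obtain ⟨e', b⟩ := Y
    obtain ⟨e'', c⟩ := Z
    obtain rfl : e = e'' := h1
    obtain rfl : e' = e := h2
    constructor
    · rintro ⟨e, a, b, h3, h4, h5⟩
      rw [h3, h4, h5]
      simp [dcoord]
      rfl
    · intro hc
      refine ⟨e', a, b, rfl, rfl, h.tangent_ext hZ hZ rfl ?_⟩
      rw [hc]
      simp [dcoord]
      rfl
  smul_iff {t X Y} hY h1 := by
    obtain ⟨e, a⟩ := X
    obtain ⟨e', b⟩ := Y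
    obtain rfl : e = e' := h1
    constructor
    · rintro ⟨e, a, h3, h4⟩
      rw [h3, h4]
      simp [dcoord]
      rfl
    · intro hc
      refine ⟨e, a, rfl, h.tangent_ext hY hY rfl ?_⟩
      rw [hc]
      simp [dcoord]
      rfl

end LocalCoord

/-! ## Local coordinates on manifolds -/

section LocalCoord

variable {E H : Type*} [NormedAddCommGroup E] [NormedSpace ℝ E] [TopologicalSpace H]
  {I : ModelWithCorners ℝ E H} {N : Type u} [TopologicalSpace N] [ChartedSpace H N]
  {V : Type*} [NormedAddCommGroup V] [NormedSpace ℝ V]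
  {W : Set N} {O : Set V} {Q : N → V} {S : V → N}

theorem IsLocalCoord.restrict (h : IsLocalCoord I W O Q S) {W' : Set N} (hW' : IsOpen W') :
    IsLocalCoord I (W ∩ W') (O ∩ S ⁻¹' W') Q S where
  isOpen_source := h.isOpen_source.inter hW'
  isOpen_target := h.contMDiffOn_symm.continuousOn.isOpen_inter_preimage h.isOpen_target hW'
  contMDiffOn := h.contMDiffOn.mono inter_subset_left
  contMDiffOn_symm := h.contMDiffOn_symm.mono inter_subset_left
  map_source x hx := ⟨h.map_source x hx.1, by rw [mem_preimage, h.left_inv x hx.1]; exact hx.2⟩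
  map_target v hv := ⟨h.map_target v hv.1, hv.2⟩
  left_inv x hx := h.left_inv x hx.1
  right_inv v hv := h.right_inv v hv.1

theorem isLocalCoord_extChartAt [I.Boundaryless] [IsManifold I ∞ N] (x : N) :
    IsLocalCoord I (extChartAt I x).source (extChartAt I x).target (extChartAt I x)
      (extChartAt I x).symm where
  isOpen_source := isOpen_extChartAt_source x
  isOpen_target := isOpen_extChartAt_target x
  contMDiffOn := by rw [extChartAt_source]; exact contMDiffOn_extChartAt
  contMDiffOn_symm := contMDiffOn_extChartAt_symm x
  map_source _ hx := (extChartAt I x).map_source hx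
  map_target _ hv := (extChartAt I x).map_target hv
  left_inv _ hx := (extChartAt I x).left_inv hx
  right_inv _ hv := (extChartAt I x).right_inv hv

end LocalCoord

/-! ## Adapted frames of the vector hull -/

namespace AffineHull

variable {V P : Type v} [AddCommGroup V] [Module ℝ V] [AddTorsor V P]
  {F : Type*} [AddCommGroup F] [Module ℝ F]

theorem prodEquiv_modelIncl (e : P ≃ᵃ[ℝ] F) (w : V) :
    prodEquiv e (modelIncl (P := P) w) = (e.linear w, 0) := by
  rw [prodEquiv_apply, modelIncl, map_sub, toProd_incl, toProd_incl, AffineEquiv.map_vadd]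
  simp

theorem snd_prodEquiv (e : P ≃ᵃ[ℝ] F) (x : Hull P) : (prodEquiv e x).2 = height P x := by
  have : (LinearMap.snd ℝ F ℝ) ∘ₗ (toProd e) = height P := by
    refine Submodule.linearMap_qext _ (Finsupp.lhom_ext' fun a ↦ LinearMap.ext_ring ?_)
    simp [toProd, height]
  exact LinearMap.congr_fun this x

end AffineHull

/-- The linear automorphism of `ℝ × F` that sends a vector `v` with `v.1 ≠ 0` to `(1, 0)`. -/
def shear {F : Type*} [AddCommGroup F] [Module ℝ F] (v : ℝ × F) (hv : v.1 ≠ 0) :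
    (ℝ × F) ≃ₗ[ℝ] ℝ × F where
  toFun y := (y.1 / v.1, y.2 - (y.1 / v.1) • v.2)
  invFun z := (v.1 * z.1, z.2 + z.1 • v.2)
  map_add' y z := by ext <;> simp [add_div]; module
  map_smul' t y := by ext <;> simp [mul_div_assoc]; module
  left_inv y := by ext <;> simp; field_simp
  right_inv z := by ext <;> simp [hv]

namespace SpecialAffineBundle

variable {d k : ℕ} {M : Type u} [TopologicalSpace M] [ChartedSpace (EuclideanSpace ℝ (Fin d)) M]
  (𝒜 : SpecialAffineBundle.{u, v} d k M)
  {H H' : Type*} [NormedAddCommGroup H] [NormedSpace ℝ H] [NormedAddCommGroup H'] [NormedSpace ℝ H']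

/-- Linear coordinates on the fibres of the vector hull, smooth over `W`. -/
structure IsHullFrame (W : Set M) (C : ∀ x, 𝒜.E x ≃ₗ[ℝ] H) : Prop where
  isOpen : IsOpen W
  contMDiffOn : ContMDiffOn (modelE d k) 𝓘(ℝ, H) ∞ (fun e : 𝒜.Tot ↦ C e.1 e.2)
    ((TotalSpace.proj : 𝒜.Tot → M) ⁻¹' W)
  contMDiffOn_symm : ContMDiffOn ((𝓡 d).prod 𝓘(ℝ, H)) (modelE d k) ∞
    (fun p : M × H ↦ (⟨p.1, (C p.1).symm p.2⟩ : 𝒜.Tot)) (W ×ˢ univ)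

variable {𝒜} {W : Set M}

theorem IsHullFrame.mono {C : ∀ x, 𝒜.E x ≃ₗ[ℝ] H} (h : 𝒜.IsHullFrame W C) {W' : Set M}
    (hW' : IsOpen W') (hsub : W' ⊆ W) : 𝒜.IsHullFrame W' C where
  isOpen := hW'
  contMDiffOn := h.contMDiffOn.mono fun _ he ↦ hsub he
  contMDiffOn_symm := h.contMDiffOn_symm.mono fun _ hp ↦ ⟨hsub hp.1, hp.2⟩

/-- The change of frame and its inverse are both assumed smooth, so smoothness of inversion of
linear maps is not needed. -/
theorem IsHullFrame.trans {C : ∀ x, 𝒜.E x ≃ₗ[ℝ] H} (h : 𝒜.IsHullFrame W C)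
    (T : M → H ≃ₗ[ℝ] H')
    (hT : ContMDiffOn ((𝓡 d).prod 𝓘(ℝ, H)) 𝓘(ℝ, H') ∞ (fun p : M × H ↦ T p.1 p.2) (W ×ˢ univ))
    (hT' : ContMDiffOn ((𝓡 d).prod 𝓘(ℝ, H')) 𝓘(ℝ, H) ∞ (fun p : M × H' ↦ (T p.1).symm p.2)
      (W ×ˢ univ)) :
    𝒜.IsHullFrame W (fun x ↦ (C x).trans (T x)) where
  isOpen := h.isOpen
  contMDiffOn := hT.comp ((contMDiff_proj 𝒜.E).contMDiffOn.prodMk h.contMDiffOn)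
    fun _ he ↦ ⟨he, mem_univ _⟩
  contMDiffOn_symm := h.contMDiffOn_symm.comp (contMDiffOn_fst.prodMk hT')
    fun _ hp ↦ ⟨hp.1, mem_univ _⟩

theorem isHullFrame_hullCoord (x : M) :
    𝒜.IsHullFrame (𝒜.baseSet (𝒜.indexAt x)) (𝒜.hullCoord (𝒜.indexAt x)) where
  isOpen := 𝒜.isOpen_baseSet _
  contMDiffOn := contMDiff_snd.comp_contMDiffOn
    ((trivializationAt (HullModel k) 𝒜.E x).contMDiffOn (n := ∞) (IB := 𝓡 d))
  contMDiffOn_symm := (trivializationAt (HullModel k) 𝒜.E x).contMDiffOn_symm (n := ∞) (IB := 𝓡 d)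

variable {F : Type} [NormedAddCommGroup F] [NormedSpace ℝ F]

open scoped Classical in
/-- The change of frame that straightens the section `v`. -/
def straighten (G : EuclideanSpace ℝ (Fin k) ≃L[ℝ] ℝ × F) (v : EuclideanSpace ℝ (Fin k)) :
    HullModel k ≃ₗ[ℝ] (ℝ × F) × ℝ :=
  (G.toLinearEquiv.trans (if hv : (G v).1 ≠ 0 then shear (G v) hv else .refl ℝ _)).prodCongr
    (.refl ℝ ℝ)

theorem straighten_apply {G : EuclideanSpace ℝ (Fin k) ≃L[ℝ] ℝ × F} {v : EuclideanSpace ℝ (Fin k)}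
    (hv : (G v).1 ≠ 0) (p : HullModel k) : straighten G v p =
      (((G p.1).1 / (G v).1, (G p.1).2 - ((G p.1).1 / (G v).1) • (G v).2), p.2) := by
  rw [straighten, dif_pos hv]
  rfl

theorem straighten_symm_apply {G : EuclideanSpace ℝ (Fin k) ≃L[ℝ] ℝ × F}
    {v : EuclideanSpace ℝ (Fin k)} (hv : (G v).1 ≠ 0) (q : (ℝ × F) × ℝ) :
    (straighten G v).symm q =
      (G.symm ((G v).1 * q.1.1, q.1.2 + q.1.1 • (G v).2), q.2) := by
  rw [straighten, dif_pos hv]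
  rfl

/-- The forward formula is smooth where its only denominator, the first component of `G v`, does not
vanish; the inverse formula has no denominator. Over `W` the fallback branch of `straighten` is
never met. -/
theorem IsHullFrame.straighten (G : EuclideanSpace ℝ (Fin k) ≃L[ℝ] ℝ × F)
    {C : ∀ x, 𝒜.E x ≃ₗ[ℝ] HullModel k} (h : 𝒜.IsHullFrame W C) {v : M → EuclideanSpace ℝ (Fin k)}
    (hv : ContMDiffOn (𝓡 d) 𝓘(ℝ, EuclideanSpace ℝ (Fin k)) ∞ v W)
    (hne : ∀ x ∈ W, (G (v x)).1 ≠ 0) :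
    𝒜.IsHullFrame W (fun x ↦ (C x).trans (SpecialAffineBundle.straighten G (v x))) := by
  have hvx : ∀ {H : Type} [NormedAddCommGroup H] [NormedSpace ℝ H],
      ContMDiffOn ((𝓡 d).prod 𝓘(ℝ, H)) 𝓘(ℝ, EuclideanSpace ℝ (Fin k) × H) ∞
        (fun p : M × H ↦ (v p.1, p.2)) (W ×ˢ univ) := fun {H} _ _ ↦
    (hv.comp contMDiffOn_fst fun p hp ↦ hp.1).prodMk_space contMDiffOn_snd
  refine h.trans _ ?_ ?_
  · have h1 : ContDiffOn ℝ ∞ (fun q : EuclideanSpace ℝ (Fin k) × HullModel k ↦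
        ((((G q.2.1).1 / (G q.1).1, (G q.2.1).2 - ((G q.2.1).1 / (G q.1).1) • (G q.1).2), q.2.2) :
          (ℝ × F) × ℝ)) {q | (G q.1).1 ≠ 0} := by
      have hd : ContDiffOn ℝ ∞ (fun q : EuclideanSpace ℝ (Fin k) × HullModel k ↦
          (G q.2.1).1 / (G q.1).1) {q | (G q.1).1 ≠ 0} :=
        ContDiffOn.div (by fun_prop) (by fun_prop) fun q hq ↦ hq
      exact (hd.prodMk (ContDiffOn.sub (by fun_prop) (hd.smul (by fun_prop)))).prodMk (by fun_prop)
    exact (h1.contMDiffOn.comp hvx fun p hp ↦ hne _ hp.1).congr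
      fun p hp ↦ straighten_apply (hne _ hp.1) _
  · have h1 : ContDiff ℝ ∞ (fun q : EuclideanSpace ℝ (Fin k) × ((ℝ × F) × ℝ) ↦
        ((G.symm ((G q.1).1 * q.2.1.1, q.2.1.2 + q.2.1.1 • (G q.1).2), q.2.2) : HullModel k)) := by
      fun_prop
    exact (h1.contMDiff.comp_contMDiffOn (hvx (H := (ℝ × F) × ℝ))).congr
      fun p hp ↦ straighten_symm_apply (hne _ hp.1) _

variable (𝒜) in
/-- Frames of the hull in which `v_A` and `α_A` are constant. -/
structure IsSpecialFrame (W : Set M) (C : ∀ x, 𝒜.E x ≃ₗ[ℝ] (ℝ × F) × ℝ) : Prop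
    extends 𝒜.IsHullFrame W C where
  vA_eq : ∀ x ∈ W, C x (𝒜.vA x) = ((1, 0), 0)
  height_eq : ∀ x ∈ W, ∀ e : 𝒜.E x, AffineHull.height (𝒜.Fiber x) e = (C x e).2

variable (𝒜) in
-- A vector that is nonzero at `x₀` keeps a nonzero component along its value there in a
-- neighbourhood, and then a shear makes it constant. The shear acts on the model part only, so the
-- height remains the last coordinate.
theorem exists_isSpecialFrame (x₀ : M) : ∃ (F : Submodule ℝ (EuclideanSpace ℝ (Fin k))) (W : Set M)
    (C : ∀ x, 𝒜.E x ≃ₗ[ℝ] (ℝ × F) × ℝ), x₀ ∈ W ∧ 𝒜.IsSpecialFrame W C := by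
  set i := 𝒜.indexAt x₀
  let v : M → EuclideanSpace ℝ (Fin k) := fun x ↦ (𝒜.triv i x).linear (𝒜.special x)
  have hv0 : v x₀ ≠ 0 := by
    simpa [v] using 𝒜.special_ne_zero x₀
  have hsq : inner ℝ (v x₀) (v x₀) ≠ (0 : ℝ) := inner_self_ne_zero.2 hv0
  -- The normalization makes `l` equal to one on `v x₀`; thus `s` is a right inverse and `ℝ^k`
  -- splits into the line of `v x₀` and its orthogonal complement, the kernel of `l`.
  let l : EuclideanSpace ℝ (Fin k) →L[ℝ] ℝ := (inner ℝ (v x₀) (v x₀) : ℝ)⁻¹ • innerSL ℝ (v x₀)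
  let s : ℝ →L[ℝ] EuclideanSpace ℝ (Fin k) := ContinuousLinearMap.toSpanSingleton ℝ (v x₀)
  have hs : Function.RightInverse s l := fun t ↦ by
    simp only [s, l, ContinuousLinearMap.toSpanSingleton_apply, map_smul, smul_apply,
      innerSL_apply_apply, smul_eq_mul, inv_mul_cancel₀ hsq, mul_one]
  let G := ContinuousLinearEquiv.equivOfRightInverse l s hs
  have hG : ∀ y, (G y).1 = l y := fun y ↦ rfl
  have hl : l (v x₀) = 1 := by simpa [s] using hs 1
  have hv : ContMDiffOn (𝓡 d) 𝓘(ℝ, EuclideanSpace ℝ (Fin k)) ∞ v (𝒜.baseSet i) :=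
    𝒜.smooth_special i
  let W := 𝒜.baseSet i ∩ v ⁻¹' {y | l y ≠ 0}
  have hW : IsOpen W := hv.continuousOn.isOpen_inter_preimage (𝒜.isOpen_baseSet i)
    (isOpen_ne_fun l.continuous continuous_const)
  refine ⟨LinearMap.ker (l : EuclideanSpace ℝ (Fin k) →ₗ[ℝ] ℝ), W,
    fun x ↦ (𝒜.hullCoord i x).trans (SpecialAffineBundle.straighten G (v x)),
    ⟨𝒜.mem_baseSet_indexAt x₀, by simp [hl]⟩, ?_, fun x hx ↦ ?_, fun x hx e ↦ ?_⟩
  · exact ((isHullFrame_hullCoord x₀).mono hW inter_subset_left).straighten G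
      (hv.mono inter_subset_left) fun x hx ↦ hx.2
  · have h1 : 𝒜.hullCoord i x (𝒜.vA x) = (v x, 0) := AffineHull.prodEquiv_modelIncl _ _
    have hx2 : (G (v x)).1 ≠ 0 := hx.2
    rw [LinearEquiv.trans_apply, h1, straighten_apply hx2]
    simp [hx2]
  · have hx2 : (G (v x)).1 ≠ 0 := hx.2
    rw [LinearEquiv.trans_apply, straighten_apply hx2]
    exact (AffineHull.snd_prodEquiv (𝒜.triv i x) e).symm

/-! ### Local coordinates on the total space -/

variable {O : Set (EuclideanSpace ℝ (Fin d))} {φ : M → EuclideanSpace ℝ (Fin d)}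
  {S : EuclideanSpace ℝ (Fin d) → M} {C : ∀ x, 𝒜.E x ≃ₗ[ℝ] H}

theorem IsHullFrame.isLocalCoord (h : 𝒜.IsHullFrame W C) (hφ : IsLocalCoord (𝓡 d) W O φ S) :
    IsLocalCoord (modelE d k) ((TotalSpace.proj : 𝒜.Tot → M) ⁻¹' W) (O ×ˢ univ)
      (fun e : 𝒜.Tot ↦ (φ e.1, C e.1 e.2))
      (fun q : EuclideanSpace ℝ (Fin d) × H ↦ (⟨S q.1, (C (S q.1)).symm q.2⟩ : 𝒜.Tot)) where
  isOpen_source := h.isOpen.preimage (contMDiff_proj (n := ∞) (IB := 𝓡 d) 𝒜.E).continuous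
  isOpen_target := hφ.isOpen_target.prod isOpen_univ
  contMDiffOn := (hφ.contMDiffOn.comp (contMDiff_proj 𝒜.E).contMDiffOn fun _ he ↦ he).prodMk_space
    h.contMDiffOn
  contMDiffOn_symm := by
    refine h.contMDiffOn_symm.comp (g := fun p : M × H ↦ (⟨p.1, (C p.1).symm p.2⟩ : 𝒜.Tot))
      (f := fun q : EuclideanSpace ℝ (Fin d) × H ↦ (S q.1, q.2))
      ((hφ.contMDiffOn_symm.comp contDiff_fst.contMDiff.contMDiffOn fun q hq ↦ hq.1).prodMk
        contDiff_snd.contMDiff.contMDiffOn) fun q hq ↦ ⟨hφ.map_target _ hq.1, mem_univ _⟩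
  map_source e he := ⟨hφ.map_source _ he, mem_univ _⟩
  map_target q hq := hφ.map_target _ hq.1
  left_inv e he := by
    rcases e with ⟨x, e⟩
    have hx : S (φ x) = x := hφ.left_inv x he
    simp only
    rw [hx, LinearEquiv.symm_apply_apply]
  right_inv q hq := by
    simp [hφ.right_inv _ hq.1]

end SpecialAffineBundle

/-! ### Charts and derivatives under a change of the coordinate function. -/

theorem IsChart.congr {X : SmoothSpace.{u}} {B : SmoothSpace.{v}} {F : Type*}
    [NormedAddCommGroup F] [NormedSpace ℝ F] {pr : X → B} {U : Set B} {c c' : X → F}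
    (h : IsChart pr U c) (hc : ∀ x, pr x ∈ U → c' x = c x) : IsChart pr U c' where
  isOpen := h.isOpen
  inj {x y} hy hxy h' := h.inj hy hxy (by rw [← hc _ hy, ← hc x (by rwa [hxy]), h'])
  surj b hb f := by
    obtain ⟨x, hx, hf⟩ := h.surj b hb f
    exact ⟨x, hx, by rw [hc x (by rwa [hx]), hf]⟩
  contDiffOn p hp := (h.contDiffOn p hp).congr fun t ht ↦ hc _ ht
  isPlot p hU hp hd := h.isPlot p hU hp (hd.of_eq fun t ↦ (hc _ (hU t)).symm)

theorem VecFib.IsTriv.congr {X : SmoothSpace.{u}} {B : SmoothSpace.{v}} {F : Type*}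
    [NormedAddCommGroup F] [NormedSpace ℝ F] {V : VecFib X B} {pr : X → B} {U : Set B}
    {c c' : X → F} (h : V.IsTriv pr U c) (hc : ∀ x, pr x ∈ U → c' x = c x) :
    V.IsTriv pr U c' where
  toIsChart := h.toIsChart.congr hc
  add_iff {x y z} hz h1 h2 := by
    rw [hc z hz, hc x (by rwa [h1]), hc y (by rwa [h2]), h.add_iff hz h1 h2]
  smul_iff {t x y} hy h1 := by rw [hc y hy, hc x (by rwa [h1]), h.smul_iff hy h1]

section LocalCoord

variable {E H : Type*} [NormedAddCommGroup E] [NormedSpace ℝ E] [TopologicalSpace H]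
  {I : ModelWithCorners ℝ E H} {N : Type u} [TopologicalSpace N] [ChartedSpace H N]
  {V V' : Type*} [NormedAddCommGroup V] [NormedSpace ℝ V] [NormedAddCommGroup V']
  [NormedSpace ℝ V'] {Q : N → V}

theorem dcoord_clm_comp (L : V →L[ℝ] V') {X : TangentBundle I N}
    (hQ : MDifferentiableAt I 𝓘(ℝ, V) Q X.1) :
    dcoord I (fun x ↦ L (Q x)) X = L (dcoord I Q X) := by
  have h1 := mfderiv_comp X.1 (L.mdifferentiableAt (x := Q X.1)) hQ
  have h2 := congrArg (fun T : E →L[ℝ] V' ↦ T X.2) h1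
  rw [ContinuousLinearMap.mfderiv_eq] at h2
  exact h2

theorem dcoord_add_const (v : V) (X : TangentBundle I N) :
    dcoord I (fun x ↦ Q x + v) X = dcoord I Q X := by
  have h1 : mfderiv I 𝓘(ℝ, V) (fun x ↦ Q x + v) X.1 = mfderiv I 𝓘(ℝ, V) Q X.1 := by
    -- If `Q` is not differentiable, neither is its translate, and both derivatives are zero by
    -- convention.
    by_cases hQ : MDifferentiableAt I 𝓘(ℝ, V) Q X.1
    · exact ((hQ.hasMFDerivAt.add (hasMFDerivAt_const v X.1)).mfderiv).trans (add_zero _)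
    · have hQ' : ¬ MDifferentiableAt I 𝓘(ℝ, V) (fun x ↦ Q x + v) X.1 := fun h ↦ hQ <| by
        refine (h.add (mdifferentiableAt_const (c := -v))).congr_of_eventuallyEq
          (.of_forall fun y ↦ ?_)
        simp
      rw [mfderiv_zero_of_not_mdifferentiableAt hQ, mfderiv_zero_of_not_mdifferentiableAt hQ']
      rfl
  exact congrArg (fun T : E →L[ℝ] V ↦ T X.2) h1

end LocalCoord

/-! ### Smoothness of the fibre operations on the hull and on `E ⊕ E`. -/

namespace SpecialAffineBundle

variable {d k : ℕ} {M : Type u} [TopologicalSpace M] [ChartedSpace (EuclideanSpace ℝ (Fin d)) M]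
  {𝒜 : SpecialAffineBundle.{u, v} d k M}
  {H : Type} [NormedAddCommGroup H] [NormedSpace ℝ H] {W : Set M}
  {C : ∀ x, 𝒜.E x ≃ₗ[ℝ] H}
  {O : Set (EuclideanSpace ℝ (Fin d))} {φ : M → EuclideanSpace ℝ (Fin d)}
  {S : EuclideanSpace ℝ (Fin d) → M}

/-- The fibre coordinate on the vector hull defined by a frame. -/
abbrev fibreCoord (C : ∀ x, 𝒜.E x ≃ₗ[ℝ] H) (e : 𝒜.Tot) : H := C e.1 e.2

section Smooth

variable {E' H' : Type*} [NormedAddCommGroup E'] [NormedSpace ℝ E'] [TopologicalSpace H']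
  {I' : ModelWithCorners ℝ E' H'} {N : Type*} [TopologicalSpace N] [ChartedSpace H' N]

/-- The map is recovered from its base point and its fibre coordinate through the smooth inverse of
the frame. -/
theorem IsHullFrame.contMDiffAt (h : 𝒜.IsHullFrame W C) {f : N → 𝒜.Tot} {x : N}
    (hx : (f x).1 ∈ W) (hf : ContMDiffAt I' (𝓡 d) ∞ (fun y ↦ (f y).1) x)
    (hc : ContMDiffAt I' 𝓘(ℝ, H) ∞ (fun y ↦ fibreCoord C (f y)) x) :
    ContMDiffAt I' (modelE d k) ∞ f x := by
  have h1 : ContMDiffAt ((𝓡 d).prod 𝓘(ℝ, H)) (modelE d k) ∞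
      (fun p : M × H ↦ (⟨p.1, (C p.1).symm p.2⟩ : 𝒜.Tot)) ((f x).1, fibreCoord C (f x)) :=
    h.contMDiffOn_symm.contMDiffAt
      ((h.isOpen.prod isOpen_univ).mem_nhds ⟨hx, mem_univ _⟩)
  refine (h1.comp x (hf.prodMk hc)).congr_of_eventuallyEq (.of_forall fun y ↦ ?_)
  simp [fibreCoord]

theorem contMDiff_of_hullCoord {f : N → 𝒜.Tot} (hf : ContMDiff I' (𝓡 d) ∞ (fun y ↦ (f y).1))
    (hc : ∀ x, ContMDiffAt I' 𝓘(ℝ, HullModel k) ∞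
      (fun y ↦ 𝒜.hullCoord (𝒜.indexAt (f x).1) (f y).1 (f y).2) x) :
    ContMDiff I' (modelE d k) ∞ f := fun x ↦
  (isHullFrame_hullCoord (f x).1).contMDiffAt (𝒜.mem_baseSet_indexAt _) hf.contMDiffAt (hc x)

theorem contMDiffAt_hullCoord (e : 𝒜.Tot) : ContMDiffAt (modelE d k) 𝓘(ℝ, HullModel k) ∞
    (fun f : 𝒜.Tot ↦ 𝒜.hullCoord (𝒜.indexAt e.1) f.1 f.2) e :=
  (isHullFrame_hullCoord e.1).contMDiffOn.contMDiffAt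
    (((𝒜.isOpen_baseSet _).preimage (contMDiff_proj (n := ∞) (IB := 𝓡 d) 𝒜.E).continuous).mem_nhds
      (𝒜.mem_baseSet_indexAt _))

variable (𝒜) in
theorem contMDiff_scale (t : ℝ) : ContMDiff (modelE d k) (modelE d k) ∞ (𝒜.scale t) :=
  contMDiff_of_hullCoord (contMDiff_proj 𝒜.E) fun e ↦ by
    have h : ContDiff ℝ ∞ fun p : HullModel k ↦ t • p := by fun_prop
    refine (h.contMDiff.contMDiffAt.comp e (contMDiffAt_hullCoord e)).congr_of_eventuallyEq
      (.of_forall fun f ↦ ?_)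
    exact map_smul _ _ _

theorem contMDiff_scale_const (e : 𝒜.Tot) :
    ContMDiff 𝓘(ℝ, ℝ) (modelE d k) ∞ (fun t : ℝ ↦ 𝒜.scale t e) :=
  contMDiff_of_hullCoord contMDiff_const fun t ↦ by
    have h : ContDiff ℝ ∞ fun s : ℝ ↦ s • 𝒜.hullCoord (𝒜.indexAt e.1) e.1 e.2 := by fun_prop
    refine h.contMDiff.contMDiffAt.congr_of_eventuallyEq (.of_forall fun f ↦ ?_)
    exact map_smul _ _ _

theorem contMDiffAt_hullCoord_sum (p : 𝒜.TotSum) :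
    ContMDiffAt (modelSum d k) 𝓘(ℝ, HullModel k × HullModel k) ∞
    (fun q : 𝒜.TotSum ↦ (𝒜.hullCoord (𝒜.indexAt p.1) q.1 q.2.1,
      𝒜.hullCoord (𝒜.indexAt p.1) q.1 q.2.2)) p := by
  have h := (trivializationAt (HullModel k × HullModel k) (𝒜.E ×ᵇ 𝒜.E) p.1).contMDiffOn
    (n := ∞) (IB := 𝓡 d)
  exact (contMDiff_snd.comp_contMDiffOn h).contMDiffAt
    ((trivializationAt (HullModel k × HullModel k) (𝒜.E ×ᵇ 𝒜.E) p.1).open_source.mem_nhds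
      (FiberBundle.mem_trivializationAt_proj_source))

variable (𝒜) in
theorem contMDiff_sum_fst : ContMDiff (modelSum d k) (modelE d k) ∞
    (fun p : 𝒜.TotSum ↦ (⟨p.1, p.2.1⟩ : 𝒜.Tot)) :=
  contMDiff_of_hullCoord (contMDiff_proj (𝒜.E ×ᵇ 𝒜.E)) fun p ↦
    contDiff_fst.contMDiff.contMDiffAt.comp p (contMDiffAt_hullCoord_sum p)

variable (𝒜) in
theorem contMDiff_sum_snd : ContMDiff (modelSum d k) (modelE d k) ∞
    (fun p : 𝒜.TotSum ↦ (⟨p.1, p.2.2⟩ : 𝒜.Tot)) :=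
  contMDiff_of_hullCoord (contMDiff_proj (𝒜.E ×ᵇ 𝒜.E)) fun p ↦
    contDiff_snd.contMDiff.contMDiffAt.comp p (contMDiffAt_hullCoord_sum p)

variable (𝒜) in
theorem contMDiff_sum_add : ContMDiff (modelSum d k) (modelE d k) ∞
    (fun p : 𝒜.TotSum ↦ (⟨p.1, p.2.1 + p.2.2⟩ : 𝒜.Tot)) :=
  contMDiff_of_hullCoord (contMDiff_proj (𝒜.E ×ᵇ 𝒜.E)) fun p ↦ by
    refine ((contDiff_fst.add contDiff_snd).contMDiff.contMDiffAt.comp p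
      (contMDiffAt_hullCoord_sum p)).congr_of_eventuallyEq (.of_forall fun q ↦ ?_)
    exact map_add _ _ _

theorem IsHullFrame.contMDiffAt_sum (h : 𝒜.IsHullFrame W C) {f : N → 𝒜.TotSum} {x : N}
    (hx : (f x).1 ∈ W) (hf : ContMDiffAt I' (𝓡 d) ∞ (fun y ↦ (f y).1) x)
    (h1 : ContMDiffAt I' 𝓘(ℝ, H) ∞ (fun y ↦ C (f y).1 (f y).2.1) x)
    (h2 : ContMDiffAt I' 𝓘(ℝ, H) ∞ (fun y ↦ C (f y).1 (f y).2.2) x) :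
    ContMDiffAt I' (modelSum d k) ∞ f x := by
  have h3 : ContMDiffAt I' (modelE d k) ∞ (fun y ↦ (⟨(f y).1, (f y).2.1⟩ : 𝒜.Tot)) x :=
    h.contMDiffAt hx hf h1
  have h4 : ContMDiffAt I' (modelE d k) ∞ (fun y ↦ (⟨(f y).1, (f y).2.2⟩ : 𝒜.Tot)) x :=
    h.contMDiffAt hx hf h2
  exact contMDiffAt_totalSpace.2 ⟨hf, ((contMDiffAt_hullCoord (⟨_, (f x).2.1⟩ : 𝒜.Tot)).comp x
    h3).prodMk_space ((contMDiffAt_hullCoord (⟨_, (f x).2.2⟩ : 𝒜.Tot)).comp x h4)⟩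

end Smooth

theorem IsHullFrame.isLocalCoord_sum (h : 𝒜.IsHullFrame W C)
    (hφ : IsLocalCoord (𝓡 d) W O φ S) :
    IsLocalCoord (modelSum d k) ((TotalSpace.proj : 𝒜.TotSum → M) ⁻¹' W) (O ×ˢ univ)
      (fun p : 𝒜.TotSum ↦ (φ p.1, C p.1 p.2.1, C p.1 p.2.2))
      (fun q : EuclideanSpace ℝ (Fin d) × H × H ↦
        (⟨S q.1, ((C (S q.1)).symm q.2.1, (C (S q.1)).symm q.2.2)⟩ : 𝒜.TotSum)) where
  isOpen_source := h.isOpen.preimage (contMDiff_proj (n := ∞) (IB := 𝓡 d) (𝒜.E ×ᵇ 𝒜.E)).continuous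
  isOpen_target := hφ.isOpen_target.prod isOpen_univ
  contMDiffOn := (hφ.contMDiffOn.comp (contMDiff_proj (𝒜.E ×ᵇ 𝒜.E)).contMDiffOn
    fun _ he ↦ he).prodMk_space
      ((h.contMDiffOn.comp (contMDiff_sum_fst 𝒜).contMDiffOn fun _ he ↦ he).prodMk_space
        (h.contMDiffOn.comp (contMDiff_sum_snd 𝒜).contMDiffOn fun _ he ↦ he))
  contMDiffOn_symm q hq := by
    have hS : ContMDiffAt 𝓘(ℝ, EuclideanSpace ℝ (Fin d) × H × H) (𝓡 d) ∞
        (fun q : EuclideanSpace ℝ (Fin d) × H × H ↦ S q.1) q :=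
      ContMDiffAt.comp (g := S) q (hφ.contMDiffOn_symm.contMDiffAt
        (hφ.isOpen_target.mem_nhds hq.1)) contDiff_fst.contMDiff.contMDiffAt
    refine (h.contMDiffAt_sum (hφ.map_target _ hq.1) hS ?_ ?_).contMDiffWithinAt
    · simp only [LinearEquiv.apply_symm_apply]
      exact ContDiff.contMDiff (by fun_prop) |>.contMDiffAt
    · simp only [LinearEquiv.apply_symm_apply]
      exact ContDiff.contMDiff (by fun_prop) |>.contMDiffAt
  map_source e he := ⟨hφ.map_source _ he, mem_univ _⟩
  map_target q hq := hφ.map_target _ hq.1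
  left_inv e he := by
    rcases e with ⟨x, e, e'⟩
    have hx : S (φ x) = x := hφ.left_inv x he
    simp only
    rw [hx, LinearEquiv.symm_apply_apply, LinearEquiv.symm_apply_apply]
  right_inv q hq := by
    simp [hφ.right_inv _ hq.1]

end SpecialAffineBundle

/-! ### The double vector bundle `TE` in local coordinates. -/

namespace SpecialAffineBundle

variable {d k : ℕ} {M : Type u} [TopologicalSpace M] [ChartedSpace (EuclideanSpace ℝ (Fin d)) M]
  (𝒜 : SpecialAffineBundle.{u, v} d k M)

/-- The projection `E → M`. -/
def projE (e : 𝒜.spaceE) : 𝒜.spaceM := TotalSpace.proj (F := HullModel k) (E := 𝒜.E) e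

theorem fibE_isProj : 𝒜.fibE.IsProj 𝒜.projE where
  smooth := dSmooth_ofManifold (N := 𝒜.Tot) (N' := M) (modelE d k) (𝓡 d) (contMDiff_proj 𝒜.E)
  liesOver_iff := Iff.rfl
  add := by rintro _ _ _ ⟨x, a, b, rfl, rfl, rfl⟩; exact ⟨rfl, rfl⟩
  smul := by rintro t _ _ rfl; rfl

variable {𝒜} {H : Type} [NormedAddCommGroup H] [NormedSpace ℝ H] {W : Set M}
  {C : ∀ x, 𝒜.E x ≃ₗ[ℝ] H}
  {O : Set (EuclideanSpace ℝ (Fin d))} {φ : M → EuclideanSpace ℝ (Fin d)}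
  {S : EuclideanSpace ℝ (Fin d) → M}

theorem IsHullFrame.fibE_isTriv (h : 𝒜.IsHullFrame W C) :
    𝒜.fibE.IsTriv 𝒜.projE W (fibreCoord C) where
  isOpen := isOpen_dTopology_ofManifold (𝓡 d) h.isOpen
  inj {e f} _ he hc := by
    rcases e with ⟨x, e⟩
    rcases f with ⟨y, f⟩
    obtain rfl : x = y := he
    exact congrArg (fun v ↦ (⟨x, v⟩ : 𝒜.Tot)) ((C x).injective hc)
  surj := fun (x : M) _ v ↦ ⟨(⟨x, (C x).symm v⟩ : 𝒜.Tot), rfl, (C x).apply_symm_apply v⟩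
  contDiffOn p hp := (h.contMDiffOn.comp ((isPlot_ofManifold_iff (N := 𝒜.Tot)
    (modelE d k)).1 hp).contMDiffOn fun _ ht ↦ ht).contDiffOn
  isPlot p hU hp hc := (isPlot_ofManifold_iff (N := 𝒜.Tot) (modelE d k)).2 fun t ↦
    h.contMDiffAt (hU t) ((isPlot_ofManifold_iff (N := M) (𝓡 d)).1 hp t) hc.contMDiff.contMDiffAt
  add_iff {e f g} _ he hf := by
    rcases e with ⟨x, e⟩
    rcases f with ⟨y, f⟩
    rcases g with ⟨z, g⟩
    obtain rfl : x = z := he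
    obtain rfl : y = x := hf
    constructor
    · rintro ⟨x, a, b, h1, h2, h3⟩
      rw [h1, h2, h3]
      exact map_add _ _ _
    · intro hc
      refine ⟨y, e, f, rfl, rfl, ?_⟩
      exact congrArg (fun v ↦ (⟨y, v⟩ : 𝒜.Tot)) ((C y).injective (hc.trans (map_add (C y) e f).symm))
  smul_iff {t e f} _ he := by
    rcases e with ⟨x, e⟩
    rcases f with ⟨y, f⟩
    obtain rfl : x = y := he
    constructor
    · intro h1
      have h1 : (⟨x, f⟩ : 𝒜.Tot) = ⟨x, t • e⟩ := h1
      rw [h1]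
      exact map_smul _ _ _
    · intro hc
      exact congrArg (fun v ↦ (⟨x, v⟩ : 𝒜.Tot)) ((C x).injective (hc.trans (map_smul (C x) t e).symm))

/-- The coordinate on the tangent bundle of the vector hull defined by a frame. -/
abbrev fibreVelocity (C : ∀ x, 𝒜.E x ≃ₗ[ℝ] H) (X : TangentBundle (modelE d k) 𝒜.Tot) : H :=
  dcoord (modelE d k) (fibreCoord C) X

theorem IsHullFrame.mdifferentiableAt (h : 𝒜.IsHullFrame W C) {e : 𝒜.Tot} (he : e.1 ∈ W) :
    MDifferentiableAt (modelE d k) 𝓘(ℝ, H) (fibreCoord C) e :=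
  (h.contMDiffOn.contMDiffAt ((h.isOpen.preimage
    (contMDiff_proj (n := ∞) (IB := 𝓡 d) 𝒜.E).continuous).mem_nhds he)).mdifferentiableAt (by simp)

theorem IsHullFrame.dcoord_eq (h : 𝒜.IsHullFrame W C) (hφ : IsLocalCoord (𝓡 d) W O φ S)
    {X : TangentBundle (modelE d k) 𝒜.Tot} (hX : X.1.1 ∈ W) :
    dcoord (modelE d k) (fun e : 𝒜.Tot ↦ (φ e.1, C e.1 e.2)) X =
      (dcoord (𝓡 d) φ (tangentMap (modelE d k) (𝓡 d) (TotalSpace.proj : 𝒜.Tot → M) X),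
        fibreVelocity C X) := by
  have hQ := (h.isLocalCoord hφ).mdifferentiableAt hX
  have h1 := dcoord_clm_comp (ContinuousLinearMap.fst ℝ (EuclideanSpace ℝ (Fin d)) H) hQ
  have h2 := dcoord_clm_comp (ContinuousLinearMap.snd ℝ (EuclideanSpace ℝ (Fin d)) H) hQ
  rw [dcoord_tangentMap (hφ.mdifferentiableAt hX)
    ((contMDiff_proj (n := ∞) (IB := 𝓡 d) 𝒜.E).mdifferentiable (by simp) _)]
  exact Prod.ext h1.symm h2.symm

/-- Both summand projections and the addition `E ⊕ E → E` are restrictions of linear maps `L` in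
coordinates, so their tangent maps are given by the same `L`. -/
theorem IsHullFrame.dcoord_tangentMap_sum (h : 𝒜.IsHullFrame W C) (hφ : IsLocalCoord (𝓡 d) W O φ S)
    {f : 𝒜.TotSum → 𝒜.Tot} (hf : ContMDiff (modelSum d k) (modelE d k) ∞ f)
    {L : EuclideanSpace ℝ (Fin d) × H × H →L[ℝ] EuclideanSpace ℝ (Fin d) × H}
    (hL : ∀ p, (φ (f p).1, C (f p).1 (f p).2) = L (φ p.1, C p.1 p.2.1, C p.1 p.2.2))
    {Y : TangentBundle (modelSum d k) 𝒜.TotSum} (hY : Y.1.1 ∈ W) (hfY : (f Y.1).1 ∈ W) :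
    (dcoord (𝓡 d) φ (tangentMap (modelE d k) (𝓡 d) (TotalSpace.proj : 𝒜.Tot → M)
        (tangentMap (modelSum d k) (modelE d k) f Y)),
      fibreVelocity C (tangentMap (modelSum d k) (modelE d k) f Y)) =
    L (dcoord (modelSum d k) (fun p : 𝒜.TotSum ↦ (φ p.1, C p.1 p.2.1, C p.1 p.2.2)) Y) := by
  rw [← h.dcoord_eq hφ (X := tangentMap (modelSum d k) (modelE d k) f Y) hfY,
    dcoord_tangentMap ((h.isLocalCoord hφ).mdifferentiableAt hfY)
      (hf.mdifferentiable (by simp) _),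
    ← dcoord_clm_comp L ((h.isLocalCoord_sum hφ).mdifferentiableAt hY)]
  congr 1
  exact funext hL

theorem IsHullFrame.tangent_ext (h : 𝒜.IsHullFrame W C) (hφ : IsLocalCoord (𝓡 d) W O φ S)
    {X Y : TangentBundle (modelE d k) 𝒜.Tot} (hX : X.1 = Y.1) (hY : Y.1.1 ∈ W)
    (h1 : (dcoord (𝓡 d) φ (tangentMap (modelE d k) (𝓡 d) (TotalSpace.proj : 𝒜.Tot → M) X),
      fibreVelocity C X) =
      (dcoord (𝓡 d) φ (tangentMap (modelE d k) (𝓡 d) (TotalSpace.proj : 𝒜.Tot → M) Y),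
      fibreVelocity C Y)) : X = Y := by
  have hX' : X.1.1 ∈ W := by rwa [hX]
  refine (h.isLocalCoord hφ).tangent_ext hX' hY (by rw [hX]) ?_
  rw [h.dcoord_eq hφ hX', h.dcoord_eq hφ hY, h1]

variable [IsManifold (𝓡 d) ∞ M]

variable (𝒜)

/-- The projection `TM → M`. -/
def projTM (X : 𝒜.spaceTM) : 𝒜.spaceM :=
  TotalSpace.proj (F := EuclideanSpace ℝ (Fin d)) (E := (TangentSpace (𝓡 d) : M → Type)) X

/-- The projection `TE → E`. -/
def projTE (X : 𝒜.spaceTE) : 𝒜.spaceE :=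
  TotalSpace.proj (F := EuclideanSpace ℝ (Fin d) × HullModel k)
    (E := (TangentSpace (modelE d k) : 𝒜.Tot → Type)) X

/-- The projection `TE → TM`. -/
def tangentProj (X : 𝒜.spaceTE) : 𝒜.spaceTM :=
  tangentMap (modelE d k) (𝓡 d) (TotalSpace.proj : 𝒜.Tot → M) X

variable {𝒜}

theorem dcoord_tangentMap_const {E₁ H₁ E₂ H₂ V : Type*} [NormedAddCommGroup E₁]
    [NormedSpace ℝ E₁] [TopologicalSpace H₁] [NormedAddCommGroup E₂] [NormedSpace ℝ E₂]
    [TopologicalSpace H₂] [NormedAddCommGroup V] [NormedSpace ℝ V]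
    {I₁ : ModelWithCorners ℝ E₁ H₁} {I₂ : ModelWithCorners ℝ E₂ H₂}
    {N₁ N₂ : Type*} [TopologicalSpace N₁] [ChartedSpace H₁ N₁] [TopologicalSpace N₂]
    [ChartedSpace H₂ N₂] {Q : N₂ → V} (x : N₂) (X : TangentBundle I₁ N₁) :
    dcoord I₂ Q (tangentMap I₁ I₂ (fun _ ↦ x) X) = 0 := by
  have h := mfderiv_const (I := I₁) (I' := I₂) (c := x) (x := X.1)
  have h' : mfderiv I₁ I₂ (fun _ ↦ x) X.1 X.2 = 0 := congrArg (fun T : E₁ →L[ℝ] E₂ ↦ T X.2) h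
  exact (congrArg (mfderiv I₂ 𝓘(ℝ, V) Q x) h').trans (map_zero _)

theorem tangentMap_comp_of_contMDiff {E₁ H₁ E₂ H₂ E₃ H₃ : Type*} [NormedAddCommGroup E₁]
    [NormedSpace ℝ E₁] [TopologicalSpace H₁] [NormedAddCommGroup E₂] [NormedSpace ℝ E₂]
    [TopologicalSpace H₂] [NormedAddCommGroup E₃] [NormedSpace ℝ E₃] [TopologicalSpace H₃]
    {I₁ : ModelWithCorners ℝ E₁ H₁} {I₂ : ModelWithCorners ℝ E₂ H₂} {I₃ : ModelWithCorners ℝ E₃ H₃}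
    {N₁ N₂ N₃ : Type*} [TopologicalSpace N₁] [ChartedSpace H₁ N₁] [TopologicalSpace N₂]
    [ChartedSpace H₂ N₂] [TopologicalSpace N₃] [ChartedSpace H₃ N₃] {g : N₂ → N₃} {f : N₁ → N₂}
    (hg : ContMDiff I₂ I₃ ∞ g) (hf : ContMDiff I₁ I₂ ∞ f) (X : TangentBundle I₁ N₁) :
    tangentMap I₂ I₃ g (tangentMap I₁ I₂ f X) = tangentMap I₁ I₃ (g ∘ f) X :=
  (tangentMap_comp_at X (hg.mdifferentiable (by simp) _) (hf.mdifferentiable (by simp) _)).symm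

variable (𝒜) in
theorem tangentDouble_isProj :
    𝒜.tangentDouble.IsProj 𝒜.projTE 𝒜.tangentProj 𝒜.projE 𝒜.projTM where
  vert := tangentFib_isProj (I := modelE d k) (N := 𝒜.Tot)
  horiz :=
    { smooth := dSmooth_ofManifold (N := TangentBundle (modelE d k) 𝒜.Tot)
        (N' := TangentBundle (𝓡 d) M) (modelE d k).tangent (𝓡 d).tangent
        ((contMDiff_proj (n := ∞) (IB := 𝓡 d) 𝒜.E).contMDiff_tangentMap (m := ∞) (by simp))
      liesOver_iff := Iff.rfl
      add := by
        rintro _ _ _ ⟨Y, rfl, rfl, rfl⟩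
        have h := fun (f : 𝒜.TotSum → 𝒜.Tot) (hf : ContMDiff (modelSum d k) (modelE d k) ∞ f) ↦
          tangentMap_comp_of_contMDiff (contMDiff_proj (n := ∞) (IB := 𝓡 d) 𝒜.E) hf Y
        exact ⟨(h _ (contMDiff_sum_fst 𝒜)).trans (h _ (contMDiff_sum_add 𝒜)).symm,
          (h _ (contMDiff_sum_snd 𝒜)).trans (h _ (contMDiff_sum_add 𝒜)).symm⟩
      smul := by
        rintro t X _ rfl
        exact (tangentMap_comp_of_contMDiff (contMDiff_proj (n := ∞) (IB := 𝓡 d) 𝒜.E)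
          (contMDiff_scale 𝒜 t) X).symm }
  side₁ := 𝒜.fibE_isProj
  side₂ := tangentFib_isProj (I := 𝓡 d) (N := M)
  comm _ := rfl

/-- A tangent vector of `E ⊕ E` consists of one base velocity and two fibre velocities. Vectors of
`TE` over one vector of `TM` thus combine uniquely, and the tangent map of addition adds the fibre
velocities. -/
theorem IsHullFrame.horiz_add_iff (h : 𝒜.IsHullFrame W C) (hφ : IsLocalCoord (𝓡 d) W O φ S)
    {X Y Z : 𝒜.spaceTE} (hZ : 𝒜.projE (𝒜.projTE Z) ∈ W) (hX : 𝒜.tangentProj X = 𝒜.tangentProj Z)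
    (hY : 𝒜.tangentProj Y = 𝒜.tangentProj Z) :
    𝒜.tangentDouble.horiz.add X Y Z ↔
      fibreCoord C (𝒜.projTE Z) = fibreCoord C (𝒜.projTE X) + fibreCoord C (𝒜.projTE Y) ∧
      fibreVelocity C Z = fibreVelocity C X + fibreVelocity C Y := by
  let L₁ : EuclideanSpace ℝ (Fin d) × H × H →L[ℝ] EuclideanSpace ℝ (Fin d) × H :=
    (ContinuousLinearMap.fst ℝ _ _).prod
      ((ContinuousLinearMap.fst ℝ _ _).comp (ContinuousLinearMap.snd ℝ _ _))
  let L₂ : EuclideanSpace ℝ (Fin d) × H × H →L[ℝ] EuclideanSpace ℝ (Fin d) × H :=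
    (ContinuousLinearMap.fst ℝ _ _).prod
      ((ContinuousLinearMap.snd ℝ _ _).comp (ContinuousLinearMap.snd ℝ _ _))
  let L₃ : EuclideanSpace ℝ (Fin d) × H × H →L[ℝ] EuclideanSpace ℝ (Fin d) × H :=
    (ContinuousLinearMap.fst ℝ _ _).prod
      (((ContinuousLinearMap.fst ℝ _ _).comp (ContinuousLinearMap.snd ℝ _ _)) +
      ((ContinuousLinearMap.snd ℝ _ _).comp (ContinuousLinearMap.snd ℝ _ _)))
  have e₁ := fun {T} hT ↦ h.dcoord_tangentMap_sum hφ (contMDiff_sum_fst 𝒜) (L := L₁) (Y := T)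
    (fun p ↦ rfl) hT hT
  have e₂ := fun {T} hT ↦ h.dcoord_tangentMap_sum hφ (contMDiff_sum_snd 𝒜) (L := L₂) (Y := T)
    (fun p ↦ rfl) hT hT
  have e₃ := fun {T} hT ↦ h.dcoord_tangentMap_sum hφ (contMDiff_sum_add 𝒜) (L := L₃) (Y := T)
    (fun p ↦ by simp [L₃]) hT hT
  constructor
  · rintro ⟨T, rfl, rfl, rfl⟩
    have hT : T.1.1 ∈ W := hZ
    exact ⟨map_add (C T.1.1) _ _, by
      have h1 := (Prod.ext_iff.1 (e₁ hT)).2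
      have h2 := (Prod.ext_iff.1 (e₂ hT)).2
      have h3 := (Prod.ext_iff.1 (e₃ hT)).2
      exact h3.trans (congrArg₂ (· + ·) h1 h2).symm⟩
  · rintro ⟨ha, hc⟩
    obtain ⟨⟨x, a⟩, X'⟩ := X
    obtain ⟨⟨y, b⟩, Y'⟩ := Y
    obtain ⟨⟨z, c⟩, Z'⟩ := Z
    obtain rfl : x = z := congrArg 𝒜.projTM hX
    obtain rfl : y = x := congrArg 𝒜.projTM hY
    have hc' : c = a + b := (C y).injective (ha.trans (map_add (C y) a b).symm)
    subst hc'
    have hQ := h.isLocalCoord_sum hφ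
    -- `T` sits at `(a, b)`, with the common base velocity and the fibre velocities of the two
    -- summands.
    obtain ⟨T, hT, hTd⟩ := hQ.tangentFib_isTriv.surj (⟨y, (a, b)⟩ : 𝒜.TotSum) hZ
      (dcoord (𝓡 d) φ (𝒜.tangentProj (⟨⟨y, a + b⟩, Z'⟩ : TangentBundle (modelE d k) 𝒜.Tot)),
        fibreVelocity C (⟨⟨y, a⟩, X'⟩ : TangentBundle (modelE d k) 𝒜.Tot),
        fibreVelocity C (⟨⟨y, b⟩, Y'⟩ : TangentBundle (modelE d k) 𝒜.Tot))
    obtain ⟨T₀, T'⟩ := T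
    obtain rfl : T₀ = ⟨y, (a, b)⟩ := hT
    refine ⟨⟨⟨y, (a, b)⟩, T'⟩, h.tangent_ext hφ rfl hZ ?_, h.tangent_ext hφ rfl hZ ?_,
      h.tangent_ext hφ rfl hZ ?_⟩
    · rw [e₁ (T := ⟨⟨y, (a, b)⟩, T'⟩) hZ, hTd]
      exact Prod.ext (congrArg (dcoord (𝓡 d) φ) hX.symm) rfl
    · rw [e₂ (T := ⟨⟨y, (a, b)⟩, T'⟩) hZ, hTd]
      exact Prod.ext (congrArg (dcoord (𝓡 d) φ) hY.symm) rfl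
    · rw [e₃ (T := ⟨⟨y, (a, b)⟩, T'⟩) hZ, hTd]
      exact Prod.ext rfl hc.symm

/-- Scaling by `t` is linear in the frame and covers the identity of `M`, so its tangent map scales
the fibre velocity and keeps the base velocity. -/
theorem IsHullFrame.horiz_smul_iff (h : 𝒜.IsHullFrame W C) (hφ : IsLocalCoord (𝓡 d) W O φ S)
    {t : ℝ} {X Y : 𝒜.spaceTE} (hY : 𝒜.projE (𝒜.projTE Y) ∈ W)
    (hX : 𝒜.tangentProj X = 𝒜.tangentProj Y) :
    𝒜.tangentDouble.horiz.smul t X Y ↔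
      fibreCoord C (𝒜.projTE Y) = t • fibreCoord C (𝒜.projTE X) ∧
      fibreVelocity C Y = t • fibreVelocity C X := by
  have key : ∀ {T : TangentBundle (modelE d k) 𝒜.Tot}, T.1.1 ∈ W → fibreVelocity C
      (tangentMap (modelE d k) (modelE d k) (𝒜.scale t) T) = t • fibreVelocity C T := fun {T} hT ↦ by
    rw [fibreVelocity, dcoord_tangentMap (h.mdifferentiableAt hT)
      ((contMDiff_scale 𝒜 t).mdifferentiable (by simp) _)]
    refine Eq.trans ?_ (dcoord_clm_comp (t • ContinuousLinearMap.id ℝ H) (h.mdifferentiableAt hT))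
    congr 1
    exact funext fun e ↦ map_smul (C e.1) t e.2
  constructor
  · rintro rfl
    exact ⟨map_smul (C _) _ _, key hY⟩
  · rintro ⟨ha, hc⟩
    obtain ⟨⟨x, a⟩, X'⟩ := X
    obtain ⟨⟨y, b⟩, Y'⟩ := Y
    obtain rfl : x = y := congrArg 𝒜.projTM hX
    have hb : b = t • a := (C x).injective (ha.trans (map_smul (C x) t a).symm)
    subst hb
    refine h.tangent_ext hφ rfl hY (Prod.ext ?_ ((key (T := ⟨⟨x, a⟩, X'⟩) hY).trans hc.symm))
    have hX' : tangentMap (modelE d k) (𝓡 d) (TotalSpace.proj : 𝒜.Tot → M) ⟨⟨x, a⟩, X'⟩ =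
      tangentMap (modelE d k) (𝓡 d) (TotalSpace.proj : 𝒜.Tot → M) ⟨⟨x, t • a⟩, Y'⟩ := hX
    simp only
    rw [tangentMap_comp_of_contMDiff (contMDiff_proj (n := ∞) (IB := 𝓡 d) 𝒜.E) (contMDiff_scale 𝒜 t)]
    exact congrArg (dcoord (𝓡 d) φ) hX'

theorem IsHullFrame.tangentDouble_isDecomp (h : 𝒜.IsHullFrame W C)
    (hφ : IsLocalCoord (𝓡 d) W O φ S) :
    𝒜.tangentDouble.IsDecomp 𝒜.projTE 𝒜.tangentProj 𝒜.projE 𝒜.projTM W (fibreCoord C)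
      (dcoord (𝓡 d) φ) (fibreVelocity C) := by
  have hv : 𝒜.tangentDouble.vert.IsTriv 𝒜.projTE (𝒜.projE ⁻¹' W)
      (fun X ↦ (dcoord (𝓡 d) φ (𝒜.tangentProj X), fibreVelocity C X)) :=
    (h.isLocalCoord hφ).tangentFib_isTriv.congr fun X hX ↦ (h.dcoord_eq hφ hX).symm
  exact
    { side₁ := h.fibE_isTriv
      side₂ := hφ.tangentFib_isTriv
      total := h.fibE_isTriv.toIsChart.comp 𝒜.tangentDouble_isProj.vert.smooth hv.toIsChart
      vert_add := fun hz h1 h2 ↦ (hv.add_iff hz h1 h2).trans Prod.ext_iff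
      vert_smul := fun hy h1 ↦ (hv.smul_iff hy h1).trans Prod.ext_iff
      horiz_add := h.horiz_add_iff hφ
      horiz_smul := h.horiz_smul_iff hφ }

/-- In the frame the curve is `t ↦ t • e` through zero: its point at time zero vanishes, it does not
move in `M`, and its fibre velocity is the coordinate of `e`. -/
theorem IsHullFrame.coreLift_isCoreTriv (h : 𝒜.IsHullFrame W C) (φ : M → EuclideanSpace ℝ (Fin d)) :
    DoubleVecFib.IsCoreTriv 𝒜.fibE 𝒜.coreLift 𝒜.projE 𝒜.projTE 𝒜.tangentProj 𝒜.projE W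
      (fibreCoord C) (dcoord (𝓡 d) φ) (fibreVelocity C) (fibreCoord C) where
  triv := h.fibE_isTriv
  base _ _ := rfl
  a_eq e _ := by
    have h1 : C (TotalSpace.proj (E := 𝒜.E) e) ((0 : ℝ) • TotalSpace.snd (E := 𝒜.E) e) = 0 := by
      rw [zero_smul, map_zero]
    exact h1
  b_eq e _ :=
    (congrArg (dcoord (𝓡 d) φ) (tangentMap_comp_of_contMDiff
      (contMDiff_proj (n := ∞) (IB := 𝓡 d) 𝒜.E) (contMDiff_scale_const e)
      (⟨0, (1 : ℝ)⟩ : TangentBundle 𝓘(ℝ, ℝ) ℝ))).trans (dcoord_tangentMap_const _ _)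
  c_eq e he := by
    have h1 : fibreVelocity C (𝒜.coreLift e) =
        dcoord 𝓘(ℝ, ℝ) (fun t : ℝ ↦ fibreCoord C (𝒜.scale t e))
          (⟨0, (1 : ℝ)⟩ : TangentBundle 𝓘(ℝ, ℝ) ℝ) :=
      dcoord_tangentMap (h.mdifferentiableAt he)
        ((contMDiff_scale_const e).mdifferentiable (by simp) _)
    rw [h1]
    have h2 : (fun t : ℝ ↦ fibreCoord C (𝒜.scale t e)) = fun t ↦ t • fibreCoord C e :=
      funext fun t ↦ map_smul _ _ _
    rw [h2, dcoord, mfderiv_eq_fderiv]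
    have h3 : HasFDerivAt (fun t : ℝ ↦ t • fibreCoord C e)
      (ContinuousLinearMap.toSpanSingleton ℝ (fibreCoord C e)) 0 :=
      (ContinuousLinearMap.toSpanSingleton ℝ (fibreCoord C e)).hasFDerivAt
    rw [h3.fderiv]
    exact one_smul ℝ _

end SpecialAffineBundle

/-! ### Orbit quotients of decomposed double vector bundles. -/

namespace DoubleVecFib

variable {D D₁ D₂ D₂' M : SmoothSpace} {𝒟 : DoubleVecFib D D₁ D₂ M} {p₁ : D → D₁}
  {p₂ : D → D₂} {q₁ : D₁ → M} {q₂ : D₂ → M} {r : D → D → Prop} {r₁ : D₁ → D₁ → Prop}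
  {f₂ : D₂ → D₂'} {p₁' : D.quot r → D₁.quot r₁} {p₂' : D.quot r → D₂'} {q₁' : D₁.quot r₁ → M}
  {q₂' : D₂' → M} {U : Set M}
  {A B C A' B' C' : Type*} [NormedAddCommGroup A] [NormedSpace ℝ A] [NormedAddCommGroup B]
  [NormedSpace ℝ B] [NormedAddCommGroup C] [NormedSpace ℝ C] [NormedAddCommGroup A']
  [NormedSpace ℝ A'] [NormedAddCommGroup B'] [NormedSpace ℝ B'] [NormedAddCommGroup C']
  [NormedSpace ℝ C'] {a : D₁ → A} {b : D₂ → B} {c : D → C} {b' : D₂' → B'}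

/-- The hypotheses `hr₁L` and `hrL` say that over `U` orbits are exactly the level sets of split
linear surjections of the coordinates. So the quotient coordinates are charts and the structure maps
descend. -/
theorem IsDecomp.quot (h : 𝒟.IsProj p₁ p₂ q₁ q₂)
    (h' : (𝒟.image (Quot.mk r) (Quot.mk r₁) f₂).IsProj (D := D.quot r) (D₁ := D₁.quot r₁)
      p₁' p₂' q₁' q₂')
    (hd : 𝒟.IsDecomp p₁ p₂ q₁ q₂ U a b c) (hf₂ : Function.Surjective f₂)
    (hp₁ : ∀ d, p₁' (Quot.mk r d) = Quot.mk r₁ (p₁ d)) (hp₂ : ∀ d, p₂' (Quot.mk r d) = f₂ (p₂ d))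
    (hq₁ : ∀ d, q₁' (Quot.mk r₁ d) = q₁ d) (hq₂ : ∀ d, q₂' (f₂ d) = q₂ d)
    {LA : A →L[ℝ] A'} {LB : B →L[ℝ] B'} {LC : C →L[ℝ] C'}
    {σA : A' →L[ℝ] A} {σB : B' →L[ℝ] B} {σC : C' →L[ℝ] C}
    (hA : ∀ v, LA (σA v) = v) (hB : ∀ v, LB (σB v) = v) (hC : ∀ v, LC (σC v) = v)
    (hr₁ : ∀ x y, r₁ x y → q₁ x = q₁ y)
    (hr₁L : ∀ x y, q₁ y ∈ U → q₁ x = q₁ y → (r₁ x y ↔ LA (a x) = LA (a y)))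
    (hr : ∀ x y, r x y → q₁ (p₁ x) = q₁ (p₁ y))
    (hrL : ∀ x y, q₁ (p₁ y) ∈ U → q₁ (p₁ x) = q₁ (p₁ y) → (r x y ↔ LA (a (p₁ x)) = LA (a (p₁ y)) ∧
      LB (b (p₂ x)) = LB (b (p₂ y)) ∧ LC (c x) = LC (c y)))
    (hD₂ : IsChart q₂' U b') (hb : ∀ d, q₂ d ∈ U → b' (f₂ d) = LB (b d)) :
    (𝒟.image (Quot.mk r) (Quot.mk r₁) f₂).IsDecomp (D := D.quot r) (D₁ := D₁.quot r₁)
      p₁' p₂' q₁' q₂' U (quotCoord r₁ a LA) b' (quotCoord r c LC) := by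
  have ha : ∀ d, q₁ d ∈ U → quotCoord r₁ a LA (Quot.mk r₁ d) = LA (a d) := fun d hd ↦
    quotCoord_mk hr₁ (fun x y hy hxy ↦ (hr₁L x y hy (hr₁ x y hxy)).1 hxy) hd
  have hc : ∀ d, q₁ (p₁ d) ∈ U → quotCoord r c LC (Quot.mk r d) = LC (c d) := fun d hd ↦
    quotCoord_mk (pr := fun d ↦ q₁ (p₁ d)) hr
      (fun x y hy hxy ↦ ((hrL x y hy (hr x y hxy)).1 hxy).2.2) hd
  have hD₁ : IsChart q₁' U (quotCoord r₁ a LA) :=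
    hd.side₁.toIsChart.quot h.side₁.smooth (fun x y hy hxy hL ↦ (hr₁L x y hy hxy).2 hL) hA hq₁ ha
  refine hd.image (D' := D.quot r) (D₁' := D₁.quot r₁) (a' := quotCoord r₁ a LA)
    (c' := quotCoord r c LC) h h' (fun ξ ↦ Quot.exists_rep ξ)
    hf₂ hp₁ hp₂ hq₁ hq₂ hA hB hC ha hb hc ?_ hD₁ hD₂
  refine hd.total.quot (L := LA.prodMap (LB.prodMap LC)) (σ := σA.prodMap (σB.prodMap σC)) ?_ ?_ ?_
    ?_ ?_
  · exact fun _ p hp ↦ h.side₁.smooth _ _ (h.vert.smooth _ _ hp)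
  · intro x y hy hxy hL
    obtain ⟨h1, h2⟩ := Prod.ext_iff.1 hL
    obtain ⟨h2, h3⟩ := Prod.ext_iff.1 h2
    exact (hrL x y hy hxy).2 ⟨h1, h2, h3⟩
  · exact fun v ↦ Prod.ext (hA _) (Prod.ext (hB _) (hC _))
  · intro x
    rw [hp₁, hq₁]
  · intro x hx
    have hx' : q₂ (p₂ x) ∈ U := by rw [h.comm]; exact hx
    rw [hp₁, hp₂, hc x hx, ha _ hx, hb _ hx']
    rfl

end DoubleVecFib

/-! ### Finite-dimensional double duals. -/

section DoubleDual

variable (F : Type*) [NormedAddCommGroup F] [NormedSpace ℝ F] [FiniteDimensional ℝ F]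

/-- A finite dimensional space as its double dual. -/
def evalEquiv : F ≃L[ℝ] ((F →L[ℝ] ℝ) →L[ℝ] ℝ) :=
  (LinearEquiv.ofInjectiveOfFinrankEq (ContinuousLinearMap.apply ℝ ℝ : F →L[ℝ] _).toLinearMap
    (fun x y hxy ↦ by
      by_contra hne
      obtain ⟨f, hf⟩ := SeparatingDual.exists_separating_of_ne (R := ℝ) hne
      exact hf (congrArg (fun L : (F →L[ℝ] ℝ) →L[ℝ] ℝ ↦ L f) hxy))
    (by
      have h : ∀ (G : Type _) [NormedAddCommGroup G] [NormedSpace ℝ G] [FiniteDimensional ℝ G],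
          Module.finrank ℝ (G →L[ℝ] ℝ) = Module.finrank ℝ G := fun G _ _ _ ↦
        (LinearMap.toContinuousLinearMap (𝕜 := ℝ) (E := G) (F' := ℝ)).finrank_eq.symm.trans
          Subspace.dual_finrank_eq
      rw [h, h])).toContinuousLinearEquiv

theorem evalEquiv_apply (x : F) (f : F →L[ℝ] ℝ) : evalEquiv F x f = f x := rfl

end DoubleDual

/-! ### Adapted charts and the orbit relations on `E` and `E*`. -/

namespace SpecialAffineBundle

variable {d k : ℕ} {M : Type u} [TopologicalSpace M] [ChartedSpace (EuclideanSpace ℝ (Fin d)) M]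
  (𝒜 : SpecialAffineBundle.{u, v} d k M)
  {F : Type} [NormedAddCommGroup F] [NormedSpace ℝ F] {W : Set M}
  {C : ∀ x, 𝒜.E x ≃ₗ[ℝ] (ℝ × F) × ℝ} {φ : M → EuclideanSpace ℝ (Fin d)}

/-- Local coordinates in which `v_A` and `α_A` are constant. -/
structure IsSpecialChart (W : Set M) (C : ∀ x, 𝒜.E x ≃ₗ[ℝ] (ℝ × F) × ℝ)
    (φ : M → EuclideanSpace ℝ (Fin d)) : Prop extends 𝒜.IsSpecialFrame W C where
  exists_isLocalCoord : ∃ O S, IsLocalCoord (𝓡 d) W O φ S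

theorem exists_isSpecialChart [IsManifold (𝓡 d) ∞ M] (x₀ : M) :
    ∃ (F : Type) (_ : NormedAddCommGroup F) (_ : NormedSpace ℝ F) (_ : FiniteDimensional ℝ F)
    (W : Set M) (C : ∀ x, 𝒜.E x ≃ₗ[ℝ] (ℝ × F) × ℝ) (φ : M → EuclideanSpace ℝ (Fin d)),
    x₀ ∈ W ∧ 𝒜.IsSpecialChart W C φ := by
  obtain ⟨F, W, C, hx, h⟩ := 𝒜.exists_isSpecialFrame x₀
  have hφ := (isLocalCoord_extChartAt (I := 𝓡 d) x₀).restrict h.isOpen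
  have h' : 𝒜.IsSpecialFrame ((extChartAt (𝓡 d) x₀).source ∩ W) C :=
    ⟨h.mono hφ.isOpen_source inter_subset_right, fun x hx ↦ h.vA_eq x hx.2,
      fun x hx ↦ h.height_eq x hx.2⟩
  exact ⟨F, inferInstance, inferInstance, inferInstance, (extChartAt (𝓡 d) x₀).source ∩ W, C, extChartAt (𝓡 d) x₀,
    ⟨mem_extChartAt_source x₀, hx⟩, ⟨h', _, _, hφ⟩⟩

variable {𝒜}

theorem IsSpecialFrame.fibreCoord_translate (h : 𝒜.IsSpecialFrame W C) (t : ℝ) {e : 𝒜.Tot}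
    (he : e.1 ∈ W) :
    fibreCoord C (𝒜.translate t e) = fibreCoord C e + t • (((1, 0), 0) : (ℝ × F) × ℝ) := by
  have h1 : C e.1 (e.2 + t • 𝒜.vA e.1) = C e.1 e.2 + t • C e.1 (𝒜.vA e.1) := by
    rw [map_add, map_smul]
  rw [h.vA_eq e.1 he] at h1
  exact h1

theorem translate_neg_translate (t : ℝ) (e : 𝒜.Tot) : 𝒜.translate (-t) (𝒜.translate t e) = e := by
  rcases e with ⟨x, e⟩
  refine congrArg (fun v ↦ (⟨x, v⟩ : 𝒜.Tot)) ((𝒜.hullCoord (𝒜.indexAt x) x).injective ?_)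
  change 𝒜.hullCoord _ x (e + t • 𝒜.vA x + -t • 𝒜.vA x) = _
  rw [map_add, map_add, map_smul, map_smul]
  module

variable (𝒜) in
theorem contMDiff_translate (t : ℝ) : ContMDiff (modelE d k) (modelE d k) ∞ (𝒜.translate t) := by
  intro e
  obtain ⟨F, W, C, he, h⟩ := 𝒜.exists_isSpecialFrame e.1
  have hW := (h.isOpen.preimage (contMDiff_proj (n := ∞) (IB := 𝓡 d) 𝒜.E).continuous).mem_nhds he
  refine h.contMDiffAt he (contMDiff_proj 𝒜.E).contMDiffAt ?_
  have h1 : ContDiff ℝ ∞ fun p : (ℝ × F) × ℝ ↦ p + t • (((1, 0), 0) : (ℝ × F) × ℝ) := by fun_prop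
  refine (h1.contMDiff.contMDiffAt.comp e
    (h.contMDiffOn.contMDiffAt hW)).congr_of_eventuallyEq ?_
  filter_upwards [hW] with f hf using h.fibreCoord_translate t hf

theorem IsSpecialFrame.relE_iff (h : 𝒜.IsSpecialFrame W C) {e f : 𝒜.spaceE}
    (hf : 𝒜.projE f ∈ W) (hef : 𝒜.projE e = 𝒜.projE f) :
    𝒜.relE e f ↔ ∃ t : ℝ, fibreCoord C f = fibreCoord C e + t • (((1, 0), 0) : (ℝ × F) × ℝ) := by
  have he : 𝒜.projE e ∈ W := by rwa [hef]
  refine exists_congr fun t ↦ ⟨?_, fun hc ↦ ?_⟩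
  · rintro rfl
    exact h.fibreCoord_translate t he
  · exact h.fibE_isTriv.inj he hef.symm (hc.trans (h.fibreCoord_translate t he).symm)

variable (F) in
/-- The projection along `v_A` in adapted coordinates. -/
def dropSpecial : (ℝ × F) × ℝ →L[ℝ] F × ℝ :=
  ((ContinuousLinearMap.snd ℝ ℝ F).comp (ContinuousLinearMap.fst ℝ (ℝ × F) ℝ)).prod
    (ContinuousLinearMap.snd ℝ (ℝ × F) ℝ)

variable (F) in
/-- A section of `dropSpecial`. -/
def liftSpecial : F × ℝ →L[ℝ] (ℝ × F) × ℝ :=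
  ((ContinuousLinearMap.inr ℝ ℝ F).comp (ContinuousLinearMap.fst ℝ F ℝ)).prod
    (ContinuousLinearMap.snd ℝ F ℝ)

theorem dropSpecial_eq_iff {p q : (ℝ × F) × ℝ} : dropSpecial F p = dropSpecial F q ↔
    ∃ t : ℝ, q = p + t • (((1, 0), 0) : (ℝ × F) × ℝ) := by
  obtain ⟨⟨x, y⟩, z⟩ := p
  obtain ⟨⟨x', y'⟩, z'⟩ := q
  constructor
  · intro h
    obtain ⟨h1, h2⟩ := Prod.ext_iff.1 h
    exact ⟨x' - x, by simp_all [dropSpecial]⟩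
  · rintro ⟨t, h⟩
    simp only [Prod.smul_mk, Prod.mk_add_mk, Prod.mk.injEq] at h
    simp [dropSpecial, h]

theorem IsSpecialFrame.relE_iff_dropSpecial (h : 𝒜.IsSpecialFrame W C) (e f : 𝒜.spaceE)
    (hf : 𝒜.projE f ∈ W) (hef : 𝒜.projE e = 𝒜.projE f) :
    𝒜.relE e f ↔ dropSpecial F (fibreCoord C e) = dropSpecial F (fibreCoord C f) :=
  (h.relE_iff hf hef).trans dropSpecial_eq_iff.symm

theorem projE_eq_of_relE (e f : 𝒜.spaceE) (h : 𝒜.relE e f) : 𝒜.projE e = 𝒜.projE f := by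
  obtain ⟨t, rfl⟩ := h
  rfl

variable (F) in
/-- The restriction of functionals to the kernel of `α_A` in adapted coordinates. -/
def dropHeight : (((ℝ × F) × ℝ) →L[ℝ] ℝ) →L[ℝ] (ℝ × F →L[ℝ] ℝ) :=
  ContinuousLinearMap.precomp ℝ (ContinuousLinearMap.inl ℝ (ℝ × F) ℝ)

variable (F) in
/-- A section of `dropHeight`. -/
def liftHeight : (ℝ × F →L[ℝ] ℝ) →L[ℝ] (((ℝ × F) × ℝ) →L[ℝ] ℝ) :=
  ContinuousLinearMap.precomp ℝ (ContinuousLinearMap.fst ℝ (ℝ × F) ℝ)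

theorem dropHeight_liftHeight (L : ℝ × F →L[ℝ] ℝ) : dropHeight F (liftHeight F L) = L := by
  ext p <;> simp [dropHeight, liftHeight]

/-- Two functionals agree on the hyperplane where the last coordinate vanishes exactly when they
differ by a multiple of that coordinate. -/
theorem dropHeight_eq_iff {L L' : ((ℝ × F) × ℝ) →L[ℝ] ℝ} : dropHeight F L = dropHeight F L' ↔
    ∃ t : ℝ, ∀ p, L' p = L p + t * p.2 := by
  constructor
  · intro h
    -- The multiple is read off on the vector on which the last coordinate is one.
    refine ⟨L' (0, 1) - L (0, 1), fun ⟨p, s⟩ ↦ ?_⟩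
    have h1 : L (p, 0) = L' (p, 0) := congrArg (fun T : ℝ × F →L[ℝ] ℝ ↦ T p) h
    have h2 : ((p, s) : (ℝ × F) × ℝ) = (p, 0) + s • (0, 1) := by simp
    rw [h2, map_add, map_add, map_smul, map_smul, h1]
    simp only [smul_eq_mul, Prod.snd_add, Prod.smul_snd]
    ring
  · rintro ⟨t, h⟩
    refine ContinuousLinearMap.ext fun p ↦ ?_
    have := h (p, 0)
    simp only [mul_zero, add_zero] at this
    exact this.symm

/-- In an adapted frame `α_A` is the last coordinate, so the class modulo `α_A` is the restriction
of the functional to the kernel of `α_A`. -/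
theorem IsSpecialFrame.relEDual_iff [FiniteDimensional ℝ F] (h : 𝒜.IsSpecialFrame W C)
    (f g : 𝒜.fibE.dualSpace) (hg : VecFib.Dual.base g ∈ W)
    (hfg : VecFib.Dual.base f = VecFib.Dual.base g) :
    𝒜.relEDual f g ↔ dropHeight F (VecFib.dualCoord 𝒜.fibE (fibreCoord C) f) =
      dropHeight F (VecFib.dualCoord 𝒜.fibE (fibreCoord C) g) := by
  have hf : VecFib.Dual.base f ∈ W := by rwa [hfg]
  rw [dropHeight_eq_iff]
  refine exists_congr fun t ↦ ?_
  have e1 := fun x ↦ h.fibE_isTriv.toFun_eq 𝒜.fibE_isProj (φ := f) hf x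
  have e2 := fun x ↦ h.fibE_isTriv.toFun_eq 𝒜.fibE_isProj (φ := g) hg x
  have hα : ∀ e : 𝒜.spaceE, 𝒜.projE e ∈ W → 𝒜.αA e = (fibreCoord C e).2 :=
    fun e he ↦ h.height_eq _ he _
  constructor
  · rintro ⟨_, h2⟩ p
    obtain ⟨e, he, rfl⟩ := h.fibE_isTriv.surj _ hg p
    have h3 := h2 e (he.trans hfg.symm) he
    rwa [e1, e2, hα e (by rwa [he])] at h3
  · intro h2
    refine ⟨hfg.symm, fun e he he' ↦ ?_⟩
    have he'' : 𝒜.projE e = VecFib.Dual.base g := he'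
    rw [e1, e2, hα e (by rwa [he'']), h2]

theorem base_eq_of_relEDual (f g : 𝒜.fibE.dualSpace) (h : 𝒜.relEDual f g) :
    VecFib.Dual.base f = VecFib.Dual.base g := by
  obtain ⟨t, h, _⟩ := h
  exact h.symm

end SpecialAffineBundle

namespace SpecialAffineBundle

variable {d k : ℕ} {M : Type u} [TopologicalSpace M] [ChartedSpace (EuclideanSpace ℝ (Fin d)) M]
  {𝒜 : SpecialAffineBundle.{u, v} d k M} [IsManifold (𝓡 d) ∞ M]
  {F : Type} [NormedAddCommGroup F] [NormedSpace ℝ F] {W : Set M}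
  {C : ∀ x, 𝒜.E x ≃ₗ[ℝ] (ℝ × F) × ℝ} {φ : M → EuclideanSpace ℝ (Fin d)}

/-! ### Translations and the differential of `α_A` in adapted coordinates -/

theorem IsSpecialFrame.dα_eq (h : 𝒜.IsSpecialFrame W C) {X : 𝒜.spaceTE}
    (hX : 𝒜.projE (𝒜.projTE X) ∈ W) : 𝒜.dα X = (fibreVelocity C X).2 := by
  have h1 := dcoord_clm_comp (ContinuousLinearMap.snd ℝ (ℝ × F) ℝ) (h.mdifferentiableAt hX)
  refine Eq.trans ?_ h1
  refine dcoord_congr_of_eventuallyEq (I := modelE d k) (f := 𝒜.αA) ?_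
  filter_upwards [(h.isOpen.preimage
    (contMDiff_proj (n := ∞) (IB := 𝓡 d) 𝒜.E).continuous).mem_nhds hX] with e he
    using h.height_eq _ he e.2

/-- In an adapted frame the translation adds a constant vector, which differentiation does not see.
-/
theorem IsSpecialFrame.fibreVelocity_translateT (h : 𝒜.IsSpecialFrame W C) (t : ℝ) {X : 𝒜.spaceTE}
    (hX : 𝒜.projE (𝒜.projTE X) ∈ W) :
    fibreVelocity C (𝒜.translateT t X) = fibreVelocity C X := by
  have h1 : fibreVelocity C (𝒜.translateT t X) =
      dcoord (modelE d k) (fibreCoord C ∘ 𝒜.translate t) X :=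
    dcoord_tangentMap (h.mdifferentiableAt hX)
      ((contMDiff_translate 𝒜 t).mdifferentiable (by simp) _)
  rw [h1]
  refine Eq.trans ?_ (dcoord_add_const (t • (((1, 0), 0) : (ℝ × F) × ℝ)) _)
  refine dcoord_congr_of_eventuallyEq ?_
  filter_upwards [(h.isOpen.preimage
    (contMDiff_proj (n := ∞) (IB := 𝓡 d) 𝒜.E).continuous).mem_nhds hX] with e he
    using h.fibreCoord_translate t he

theorem tangentProj_translateT (t : ℝ) (X : 𝒜.spaceTE) :
    𝒜.tangentProj (𝒜.translateT t X) = 𝒜.tangentProj X :=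
  tangentMap_comp_of_contMDiff (contMDiff_proj (n := ∞) (IB := 𝓡 d) 𝒜.E) (contMDiff_translate 𝒜 t) X

theorem projTE_translateT (t : ℝ) (X : 𝒜.spaceTE) :
    𝒜.projTE (𝒜.translateT t X) = 𝒜.translate t (𝒜.projTE X) := rfl

theorem IsSpecialChart.tangentDouble_isDecomp (h : 𝒜.IsSpecialChart W C φ) :
    𝒜.tangentDouble.IsDecomp 𝒜.projTE 𝒜.tangentProj 𝒜.projE 𝒜.projTM W (fibreCoord C)
      (dcoord (𝓡 d) φ) (fibreVelocity C) := by
  obtain ⟨O, S, hφ⟩ := h.exists_isLocalCoord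
  exact h.toIsHullFrame.tangentDouble_isDecomp hφ

/-! ### The cotangent bundle -/

variable (𝒜) in
theorem exists_cotangentProj : ∃ p : 𝒜.spaceTEDual → 𝒜.fibE.dualSpace,
    𝒜.cotangentDouble.IsProj VecFib.Dual.base p 𝒜.projE VecFib.Dual.base :=
  DoubleVecFib.exists_isProj_verticalDualOf 𝒜.tangentDouble_isProj 𝒜.fibE_isProj fun m ↦ by
    obtain ⟨F, _, _, _, W, C, φ, hm, h⟩ := 𝒜.exists_isSpecialChart m
    exact ⟨W, _, _, _, inferInstance, inferInstance, inferInstance, inferInstance, inferInstance,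
      inferInstance, inferInstance, inferInstance, inferInstance, _, _, _, _, hm,
      h.tangentDouble_isDecomp, h.coreLift_isCoreTriv φ⟩

variable (𝒜) in
/-- The projection `T*E → E*`. -/
def cotangentProj : 𝒜.spaceTEDual → 𝒜.fibE.dualSpace := 𝒜.exists_cotangentProj.choose

variable (𝒜) in
/-- The projection `T*E → E`. -/
abbrev cotangentBase (η : 𝒜.spaceTEDual) : 𝒜.spaceE := VecFib.Dual.base η

variable (𝒜) in
/-- The projection `E* → M`. -/
abbrev projEDual (f : 𝒜.fibE.dualSpace) : 𝒜.spaceM := VecFib.Dual.base f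

variable (𝒜) in
theorem cotangentDouble_isProj : 𝒜.cotangentDouble.IsProj 𝒜.cotangentBase 𝒜.cotangentProj 𝒜.projE
    𝒜.projEDual :=
  𝒜.exists_cotangentProj.choose_spec

/-- The component of a covector along the base in adapted coordinates. -/
abbrev baseCovector (C : ∀ x, 𝒜.E x ≃ₗ[ℝ] (ℝ × F) × ℝ) (φ : M → EuclideanSpace ℝ (Fin d))
    (η : 𝒜.spaceTEDual) : EuclideanSpace ℝ (Fin d) →L[ℝ] ℝ :=
  𝒜.tangentDouble.sideFunctional 𝒜.tangentProj (dcoord (𝓡 d) φ) (fibreVelocity C) η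

/-- The component of a covector along the fibre in adapted coordinates. -/
abbrev fibreCovector (C : ∀ x, 𝒜.E x ≃ₗ[ℝ] (ℝ × F) × ℝ) (φ : M → EuclideanSpace ℝ (Fin d))
    (η : 𝒜.spaceTEDual) : (ℝ × F) × ℝ →L[ℝ] ℝ :=
  𝒜.tangentDouble.coreFunctional 𝒜.tangentProj (dcoord (𝓡 d) φ) (fibreVelocity C) η

theorem IsSpecialChart.toFun_eq [FiniteDimensional ℝ F] (h : 𝒜.IsSpecialChart W C φ) {η : 𝒜.spaceTEDual}
    (hη : 𝒜.projE (𝒜.cotangentBase η) ∈ W) (X : 𝒜.spaceTE)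
    (hX : 𝒜.tangentDouble.vert.liesOver X (𝒜.cotangentBase η)) :
    VecFib.Dual.toFun η ⟨X, hX⟩ = baseCovector C φ η (dcoord (𝓡 d) φ (𝒜.tangentProj X)) +
      fibreCovector C φ η (fibreVelocity C X) :=
  h.tangentDouble_isDecomp.toFun_eq 𝒜.tangentDouble_isProj hη ⟨X, hX⟩

theorem IsSpecialChart.dualCoord_cotangentProj [FiniteDimensional ℝ F] (h : 𝒜.IsSpecialChart W C φ) {η : 𝒜.spaceTEDual}
    (hη : 𝒜.projE (𝒜.cotangentBase η) ∈ W) :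
    VecFib.dualCoord 𝒜.fibE (fibreCoord C) (𝒜.cotangentProj η) = fibreCovector C φ η :=
  ((h.tangentDouble_isDecomp.lies_iff 𝒜.tangentDouble_isProj 𝒜.fibE_isProj
    (h.coreLift_isCoreTriv φ) hη).1 (𝒜.cotangentDouble_isProj.horiz.liesOver_iff.2 rfl)).2

theorem IsSpecialChart.cotangentDouble_isDecomp [FiniteDimensional ℝ F] (h : 𝒜.IsSpecialChart W C φ) :
    𝒜.cotangentDouble.IsDecomp 𝒜.cotangentBase 𝒜.cotangentProj 𝒜.projE 𝒜.projEDual W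
      (fibreCoord C) (VecFib.dualCoord 𝒜.fibE (fibreCoord C)) (baseCovector C φ) :=
  h.tangentDouble_isDecomp.verticalDualOf 𝒜.tangentDouble_isProj 𝒜.fibE_isProj
    (h.coreLift_isCoreTriv φ) 𝒜.cotangentDouble_isProj

/-- Translation preserves both velocities, so pulling back along it does not change the components
of a covector; adding `t dα_A` changes only the last component of the fibre covector. Hence an orbit
is given by the point modulo `v_A`, the fibre covector modulo the last component and the base
covector. -/
theorem IsSpecialChart.relTEDual_iff [FiniteDimensional ℝ F] (h : 𝒜.IsSpecialChart W C φ) (η θ : 𝒜.spaceTEDual)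
    (hθ : 𝒜.projE (𝒜.cotangentBase θ) ∈ W)
    (hηθ : 𝒜.projE (𝒜.cotangentBase η) = 𝒜.projE (𝒜.cotangentBase θ)) :
    𝒜.relTEDual η θ ↔
      dropSpecial F (fibreCoord C (𝒜.cotangentBase η)) =
        dropSpecial F (fibreCoord C (𝒜.cotangentBase θ)) ∧
      dropHeight F (VecFib.dualCoord 𝒜.fibE (fibreCoord C) (𝒜.cotangentProj η)) =
        dropHeight F (VecFib.dualCoord 𝒜.fibE (fibreCoord C) (𝒜.cotangentProj θ)) ∧
      baseCovector C φ η = baseCovector C φ θ := by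
  have hη : 𝒜.projE (𝒜.cotangentBase η) ∈ W := by rwa [hηθ]
  rw [h.dualCoord_cotangentProj hη, h.dualCoord_cotangentProj hθ, dropHeight_eq_iff,
    ← h.relE_iff_dropSpecial _ _ hθ hηθ]
  have hd := h.tangentDouble_isDecomp
  constructor
  · rintro ⟨s, t, h1, h2⟩
    -- Vectors over the base point of `θ` with arbitrary velocities `(y, z)` turn the relation
    -- between the covectors into an identity; setting `y` or `z` to zero then separates the
    -- components.
    have key : ∀ y z, baseCovector C φ θ y + fibreCovector C φ θ z =
        baseCovector C φ η y + fibreCovector C φ η z + t * z.2 := by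
      intro y z
      obtain ⟨Z, hZ, rfl⟩ := hd.side₂.surj _ hθ y
      obtain ⟨Y, hY₁, rfl, rfl⟩ := hd.exists_mk 𝒜.tangentDouble_isProj hθ hZ z
      have hX : 𝒜.tangentDouble.vert.liesOver (𝒜.translateT (-s) Y) (𝒜.cotangentBase η) := by
        refine (𝒜.tangentDouble_isProj.vert.liesOver_iff).2 ?_
        rw [projTE_translateT, hY₁]
        exact (congrArg (𝒜.translate (-s)) h1).trans (translate_neg_translate s _)
      have hYW : 𝒜.projE (𝒜.projTE Y) ∈ W := by rwa [hY₁]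
      have h3 := h2 Y (𝒜.tangentDouble_isProj.vert.liesOver_iff.2 hY₁) hX
      rwa [h.toFun_eq hθ, h.toFun_eq hη, tangentProj_translateT, h.fibreVelocity_translateT _ hYW,
        h.dα_eq hYW] at h3
    refine ⟨⟨s, h1⟩, ⟨t, fun z ↦ ?_⟩, ContinuousLinearMap.ext fun y ↦ ?_⟩
    · have := key 0 z
      rwa [map_zero, map_zero, zero_add, zero_add] at this
    · have := key y 0
      rw [map_zero, map_zero, add_zero, add_zero, Prod.snd_zero, mul_zero, add_zero] at this
      exact this.symm
  · rintro ⟨⟨s, h1⟩, ⟨t, h2⟩, h3⟩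
    refine ⟨s, t, h1, fun Y hY hX ↦ ?_⟩
    have hYW : 𝒜.projE (𝒜.projTE Y) ∈ W := by
      rwa [𝒜.tangentDouble_isProj.vert.liesOver_iff.1 hY]
    rw [h.toFun_eq hθ, h.toFun_eq hη, tangentProj_translateT, h.fibreVelocity_translateT _ hYW,
      h.dα_eq hYW, h2, h3, add_assoc]

theorem IsSpecialChart.mem_horizontal_iff (h : 𝒜.IsSpecialChart W C φ) (X : 𝒜.spaceTE)
    (hX : 𝒜.projE (𝒜.projTE X) ∈ W) :
    X ∈ 𝒜.horizontal ↔ fibreVelocity C X =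
      ContinuousLinearMap.inl ℝ (ℝ × F) ℝ (ContinuousLinearMap.fst ℝ (ℝ × F) ℝ (fibreVelocity C X)) := by
  have h1 : X ∈ 𝒜.horizontal ↔ (fibreVelocity C X).2 = 0 := by
    rw [← h.dα_eq hX]
    rfl
  rw [h1]
  constructor
  · intro h2
    exact Prod.ext rfl h2
  · intro h2
    rw [h2]
    rfl

/-! ### Horizontal tangent vectors -/

variable (𝒜) in
/-- The projection of horizontal vectors to `E`. -/
abbrev horProj₁ (X : 𝒜.spaceTE.sub 𝒜.horizontal) : 𝒜.spaceE := 𝒜.projTE (Subtype.val X)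

variable (𝒜) in
/-- The projection of horizontal vectors to `TM`. -/
abbrev horProj₂ (X : 𝒜.spaceTE.sub 𝒜.horizontal) : 𝒜.spaceTM := 𝒜.tangentProj (Subtype.val X)

/-- The velocity of horizontal vectors along the fibre in adapted coordinates. -/
abbrev horVelocity (C : ∀ x, 𝒜.E x ≃ₗ[ℝ] (ℝ × F) × ℝ) (X : 𝒜.spaceTE.sub 𝒜.horizontal) : ℝ × F :=
  ContinuousLinearMap.fst ℝ (ℝ × F) ℝ (fibreVelocity C (Subtype.val X))

variable (𝒜) in
theorem restrict_isProj : (𝒜.tangentDouble.restrict 𝒜.horizontal).IsProj 𝒜.horProj₁ 𝒜.horProj₂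
    𝒜.projE 𝒜.projTM := 𝒜.tangentDouble_isProj.restrict _

theorem IsSpecialChart.restrict_isDecomp (h : 𝒜.IsSpecialChart W C φ) :
    (𝒜.tangentDouble.restrict 𝒜.horizontal).IsDecomp 𝒜.horProj₁ 𝒜.horProj₂ 𝒜.projE 𝒜.projTM W
      (fibreCoord C) (dcoord (𝓡 d) φ) (horVelocity C) :=
  h.tangentDouble_isDecomp.restrict 𝒜.tangentDouble_isProj
    (j := ContinuousLinearMap.inl ℝ (ℝ × F) ℝ) (fun _ ↦ rfl) h.mem_horizontal_iff

/-- Translation moves the point along `v_A` and keeps both velocities. For horizontal vectors the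
last component of the fibre velocity is zero, so equality of the part in `ℝ × F` gives equality of
the whole. -/
theorem IsSpecialChart.relHor_iff (h : 𝒜.IsSpecialChart W C φ)
    (X Y : 𝒜.spaceTE.sub 𝒜.horizontal) (hY : 𝒜.projE (𝒜.horProj₁ Y) ∈ W)
    (hXY : 𝒜.projE (𝒜.horProj₁ X) = 𝒜.projE (𝒜.horProj₁ Y)) :
    𝒜.relHor X Y ↔
      dropSpecial F (fibreCoord C (𝒜.horProj₁ X)) = dropSpecial F (fibreCoord C (𝒜.horProj₁ Y)) ∧
      dcoord (𝓡 d) φ (𝒜.horProj₂ X) = dcoord (𝓡 d) φ (𝒜.horProj₂ Y) ∧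
      horVelocity C X = horVelocity C Y := by
  have hX : 𝒜.projE (𝒜.horProj₁ X) ∈ W := by rwa [hXY]
  rw [← h.relE_iff_dropSpecial _ _ hY hXY]
  constructor
  · rintro ⟨t, ht⟩
    have ht' : Subtype.val Y = 𝒜.translateT t (Subtype.val X) := ht
    refine ⟨⟨t, congrArg 𝒜.projTE ht'⟩, congrArg (dcoord (𝓡 d) φ) ?_, congrArg Prod.fst ?_⟩
    · exact ((congrArg 𝒜.tangentProj ht').trans (tangentProj_translateT t _)).symm
    · exact ((congrArg (fibreVelocity C) ht').trans (h.fibreVelocity_translateT t hX)).symm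
  · rintro ⟨⟨t, ht⟩, h2, h3⟩
    refine ⟨t, h.tangentDouble_isDecomp.total.inj (y := 𝒜.translateT t (Subtype.val X)) hX hXY.symm
      (Prod.ext (congrArg (fibreCoord C) ht) (Prod.ext ?_ ?_))⟩
    · exact h2.symm.trans (congrArg (dcoord (𝓡 d) φ) (tangentProj_translateT t _).symm)
    · refine Eq.trans ?_ (h.fibreVelocity_translateT t hX).symm
      refine ((h.mem_horizontal_iff _ hY).1 (Subtype.property Y)).trans (Eq.trans ?_
        ((h.mem_horizontal_iff _ hX).1 (Subtype.property X)).symm)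
      exact congrArg (ContinuousLinearMap.inl ℝ (ℝ × F) ℝ) h3.symm

end SpecialAffineBundle

namespace SpecialAffineBundle

variable {d k : ℕ} {M : Type u} [TopologicalSpace M] [ChartedSpace (EuclideanSpace ℝ (Fin d)) M]
  (𝒜 : SpecialAffineBundle.{u, v} d k M)

/-! ### The reduced double vector bundles -/

/-- The projection `E/⟨v_A⟩ → M`. -/
def projReducedE : 𝒜.reducedE → 𝒜.spaceM := Quot.lift 𝒜.projE projE_eq_of_relE

theorem dSmooth_projReducedE : DSmooth 𝒜.projReducedE :=
  dSmooth_of_comp_quot_mk 𝒜.fibE_isProj.smooth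

variable {F : Type} [NormedAddCommGroup F] [NormedSpace ℝ F] {W : Set M}
  {C : ∀ x, 𝒜.E x ≃ₗ[ℝ] (ℝ × F) × ℝ}

variable {𝒜}

/-- The coordinate on `E/⟨v_A⟩`. -/
abbrev reducedFibreCoord (C : ∀ x, 𝒜.E x ≃ₗ[ℝ] (ℝ × F) × ℝ) : 𝒜.reducedE → F × ℝ :=
  quotCoord 𝒜.relE (fibreCoord C) (dropSpecial F)

theorem IsSpecialFrame.reducedFibreCoord_mk (h : 𝒜.IsSpecialFrame W C) {e : 𝒜.spaceE}
    (he : 𝒜.projE e ∈ W) :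
    reducedFibreCoord C (Quot.mk _ e : 𝒜.reducedE) = dropSpecial F (fibreCoord C e) :=
  quotCoord_mk projE_eq_of_relE (fun e f hf hef ↦
    (h.relE_iff_dropSpecial e f hf (projE_eq_of_relE e f hef)).1 hef) he

variable [IsManifold (𝓡 d) ∞ M] {φ : M → EuclideanSpace ℝ (Fin d)}

variable (𝒜)

/-- The projection `E*/⟨α_A⟩ → M`. -/
def projReducedEDual : 𝒜.reducedEDual → 𝒜.spaceM := Quot.lift 𝒜.projEDual base_eq_of_relEDual

theorem projE_eq_of_relTEDual (η θ : 𝒜.spaceTEDual) (h : 𝒜.relTEDual η θ) :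
    𝒜.projE (𝒜.cotangentBase η) = 𝒜.projE (𝒜.cotangentBase θ) := by
  obtain ⟨s, t, h, -⟩ := h
  exact (congrArg 𝒜.projE h).symm

theorem projE_eq_of_relHor (X Y : 𝒜.spaceTE.sub 𝒜.horizontal) (h : 𝒜.relHor X Y) :
    𝒜.projE (𝒜.horProj₁ X) = 𝒜.projE (𝒜.horProj₁ Y) := by
  obtain ⟨t, h⟩ := h
  exact (congrArg (fun Z ↦ 𝒜.projE (𝒜.projTE Z)) h).symm

theorem relE_of_relTEDual (η θ : 𝒜.spaceTEDual) (h : 𝒜.relTEDual η θ) :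
    𝒜.relE (𝒜.cotangentBase η) (𝒜.cotangentBase θ) := by
  obtain ⟨s, t, h, -⟩ := h
  exact ⟨s, h⟩

theorem relE_of_relHor (X Y : 𝒜.spaceTE.sub 𝒜.horizontal) (h : 𝒜.relHor X Y) :
    𝒜.relE (𝒜.horProj₁ X) (𝒜.horProj₁ Y) := by
  obtain ⟨t, h⟩ := h
  exact ⟨t, congrArg 𝒜.projTE h⟩

/-- The projection to `E*` is known only through its graph, so the compatibility is checked in a
chart: the action changes the fibre covector by a multiple of `α_A`. -/
theorem relEDual_of_relTEDual (η θ : 𝒜.spaceTEDual) (h : 𝒜.relTEDual η θ) :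
    𝒜.relEDual (𝒜.cotangentProj η) (𝒜.cotangentProj θ) := by
  have hηθ := 𝒜.projE_eq_of_relTEDual η θ h
  obtain ⟨F, _, _, _, W, C, φ, hW, hC⟩ := 𝒜.exists_isSpecialChart (𝒜.projE (𝒜.cotangentBase θ))
  have hb := 𝒜.cotangentDouble_isProj.comm
  exact (hC.relEDual_iff _ _ (Eq.subst (motive := fun m ↦ m ∈ W) (hb θ).symm hW)
    ((hb η).trans (hηθ.trans (hb θ).symm))).2
    ((hC.relTEDual_iff η θ hW hηθ).1 h).2.1

theorem horProj₂_eq_of_relHor (X Y : 𝒜.spaceTE.sub 𝒜.horizontal) (h : 𝒜.relHor X Y) :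
    𝒜.horProj₂ X = 𝒜.horProj₂ Y := by
  obtain ⟨t, h⟩ := h
  exact ((congrArg 𝒜.tangentProj h).trans (tangentProj_translateT t _)).symm

/-- The projection of the reduced cotangent bundle to `E/⟨v_A⟩`. -/
def reducedCotangentProj₁ : 𝒜.reducedTEDual → 𝒜.reducedE :=
  Quot.lift (fun η ↦ (Quot.mk _ (𝒜.cotangentBase η) : 𝒜.reducedE))
    fun η θ h ↦ Quot.sound (𝒜.relE_of_relTEDual η θ h)

/-- The projection of the reduced cotangent bundle to `E*/⟨α_A⟩`. -/
def reducedCotangentProj₂ : 𝒜.reducedTEDual → 𝒜.reducedEDual :=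
  Quot.lift (fun η ↦ (Quot.mk _ (𝒜.cotangentProj η) : 𝒜.reducedEDual))
    fun η θ h ↦ Quot.sound (𝒜.relEDual_of_relTEDual η θ h)

/-- The projection of the bundle of orbits of horizontal vectors to `E/⟨v_A⟩`. -/
def reducedHorProj₁ : 𝒜.reducedHor → 𝒜.reducedE :=
  Quot.lift (fun X ↦ (Quot.mk _ (𝒜.horProj₁ X) : 𝒜.reducedE))
    fun X Y h ↦ Quot.sound (𝒜.relE_of_relHor X Y h)

/-- The projection of the bundle of orbits of horizontal vectors to `TM`. -/
def reducedHorProj₂ : 𝒜.reducedHor → 𝒜.spaceTM := Quot.lift 𝒜.horProj₂ 𝒜.horProj₂_eq_of_relHor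

theorem reducedCotangent_isProj : 𝒜.reducedCotangent.IsProj 𝒜.reducedCotangentProj₁
    𝒜.reducedCotangentProj₂ 𝒜.projReducedE 𝒜.projReducedEDual :=
  𝒜.cotangentDouble_isProj.image (fun ξ ↦ Quot.exists_rep ξ) (fun ξ ↦ Quot.exists_rep ξ)
    (fun ξ ↦ Quot.exists_rep ξ) (fun _ ↦ rfl) (fun _ ↦ rfl) (fun _ ↦ rfl) (fun _ ↦ rfl)
    (dSmooth_of_comp_quot_mk (dSmooth_quot_mk.comp 𝒜.cotangentDouble_isProj.vert.smooth))
    (dSmooth_of_comp_quot_mk (dSmooth_quot_mk.comp 𝒜.cotangentDouble_isProj.horiz.smooth))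
    𝒜.dSmooth_projReducedE
    (dSmooth_of_comp_quot_mk 𝒜.cotangentDouble_isProj.side₂.smooth)

theorem reducedHorizontal_isProj : 𝒜.reducedHorizontal.IsProj 𝒜.reducedHorProj₁ 𝒜.reducedHorProj₂
    𝒜.projReducedE 𝒜.projTM :=
  𝒜.restrict_isProj.image (fun ξ ↦ Quot.exists_rep ξ) (fun ξ ↦ Quot.exists_rep ξ)
    Function.surjective_id (fun _ ↦ rfl) (fun _ ↦ rfl) (fun _ ↦ rfl) (fun _ ↦ rfl)
    (dSmooth_of_comp_quot_mk (dSmooth_quot_mk.comp 𝒜.restrict_isProj.vert.smooth))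
    (dSmooth_of_comp_quot_mk 𝒜.restrict_isProj.horiz.smooth)
    𝒜.dSmooth_projReducedE 𝒜.restrict_isProj.side₂.smooth

variable {𝒜}

/-- The coordinate on `E*/⟨α_A⟩`. -/
abbrev reducedDualCoord (C : ∀ x, 𝒜.E x ≃ₗ[ℝ] (ℝ × F) × ℝ) :
    𝒜.reducedEDual → (ℝ × F →L[ℝ] ℝ) :=
  quotCoord 𝒜.relEDual (VecFib.dualCoord 𝒜.fibE (fibreCoord C)) (dropHeight F)

/-- The coordinate on the core part of the reduced cotangent bundle. -/
abbrev reducedBaseCovector (C : ∀ x, 𝒜.E x ≃ₗ[ℝ] (ℝ × F) × ℝ) (φ : M → EuclideanSpace ℝ (Fin d)) :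
    𝒜.reducedTEDual → (EuclideanSpace ℝ (Fin d) →L[ℝ] ℝ) :=
  quotCoord 𝒜.relTEDual (baseCovector C φ) (.id ℝ _)

/-- The coordinate on the core part of the bundle of orbits of horizontal vectors. -/
abbrev reducedHorVelocity (C : ∀ x, 𝒜.E x ≃ₗ[ℝ] (ℝ × F) × ℝ) : 𝒜.reducedHor → ℝ × F :=
  quotCoord 𝒜.relHor (horVelocity C) (.id ℝ _)

/-- The core coordinate is the base covector, on which the action of `ℝ × ℝ` is trivial; the
reduction affects the two sides only, by `dropSpecial` and `dropHeight`. -/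
theorem IsSpecialChart.reducedCotangent_isDecomp [FiniteDimensional ℝ F]
    (h : 𝒜.IsSpecialChart W C φ) :
    𝒜.reducedCotangent.IsDecomp 𝒜.reducedCotangentProj₁ 𝒜.reducedCotangentProj₂ 𝒜.projReducedE
      𝒜.projReducedEDual W (reducedFibreCoord C) (reducedDualCoord C)
      (reducedBaseCovector C φ) := by
  have hd := h.cotangentDouble_isDecomp
  have hb : ∀ f, 𝒜.projEDual f ∈ W → reducedDualCoord C (Quot.mk _ f) =
      dropHeight F (VecFib.dualCoord 𝒜.fibE (fibreCoord C) f) := fun f hf ↦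
    quotCoord_mk base_eq_of_relEDual
      (fun f g hg hfg ↦ (h.relEDual_iff f g hg (base_eq_of_relEDual f g hfg)).1 hfg) hf
  refine hd.quot (LA := dropSpecial F) (LB := dropHeight F) (LC := .id ℝ _) (σA := liftSpecial F)
    (σB := liftHeight F) (σC := .id ℝ _) 𝒜.cotangentDouble_isProj 𝒜.reducedCotangent_isProj
    (fun ξ ↦ Quot.exists_rep ξ) (fun _ ↦ rfl) (fun _ ↦ rfl) (fun _ ↦ rfl) (fun _ ↦ rfl)
    (fun _ ↦ rfl) dropHeight_liftHeight (fun _ ↦ rfl) projE_eq_of_relE h.relE_iff_dropSpecial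
    𝒜.projE_eq_of_relTEDual h.relTEDual_iff ?_ hb
  exact hd.side₂.toIsChart.quot 𝒜.cotangentDouble_isProj.side₂.smooth
    (fun f g hg hfg hL ↦ (h.relEDual_iff f g hg hfg).2 hL) dropHeight_liftHeight (fun _ ↦ rfl) hb

/-- Passing to horizontal vectors has already cut the core down to `ℝ × F`; the quotient then
affects only the first side. -/
theorem IsSpecialChart.reducedHorizontal_isDecomp (h : 𝒜.IsSpecialChart W C φ) :
    𝒜.reducedHorizontal.IsDecomp 𝒜.reducedHorProj₁ 𝒜.reducedHorProj₂ 𝒜.projReducedE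
      𝒜.projTM W (reducedFibreCoord C) (dcoord (𝓡 d) φ) (reducedHorVelocity C) :=
  h.restrict_isDecomp.quot (LA := dropSpecial F) (LB := .id ℝ _) (LC := .id ℝ _)
    (σA := liftSpecial F) (σB := .id ℝ _) (σC := .id ℝ _) 𝒜.restrict_isProj
    𝒜.reducedHorizontal_isProj Function.surjective_id (fun _ ↦ rfl) (fun _ ↦ rfl) (fun _ ↦ rfl)
    (fun _ ↦ rfl) (fun _ ↦ rfl) (fun _ ↦ rfl) (fun _ ↦ rfl) projE_eq_of_relE
    h.relE_iff_dropSpecial 𝒜.projE_eq_of_relHor h.relHor_iff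
    h.restrict_isDecomp.side₂.toIsChart (fun _ _ ↦ rfl)

theorem IsSpecialChart.reducedDualCoord_mk [FiniteDimensional ℝ F] (h : 𝒜.IsSpecialChart W C φ)
    {η : 𝒜.spaceTEDual} (hη : 𝒜.projE (𝒜.cotangentBase η) ∈ W) :
    reducedDualCoord C (𝒜.reducedCotangentProj₂ (Quot.mk _ η)) =
      dropHeight F (fibreCovector C φ η) := by
  rw [← h.dualCoord_cotangentProj hη]
  exact quotCoord_mk (pr := 𝒜.projEDual) base_eq_of_relEDual
    (fun f g hg hfg ↦ (h.relEDual_iff f g hg (base_eq_of_relEDual f g hfg)).1 hfg)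
    (by rw [𝒜.cotangentDouble_isProj.comm]; exact hη)

theorem IsSpecialChart.reducedBaseCovector_mk [FiniteDimensional ℝ F] (h : 𝒜.IsSpecialChart W C φ)
    {η : 𝒜.spaceTEDual} (hη : 𝒜.projE (𝒜.cotangentBase η) ∈ W) :
    reducedBaseCovector C φ (Quot.mk _ η : 𝒜.reducedTEDual) = baseCovector C φ η :=
  quotCoord_mk (pr := fun η ↦ 𝒜.projE (𝒜.cotangentBase η)) 𝒜.projE_eq_of_relTEDual
    (fun η θ hθ hηθ ↦ ((h.relTEDual_iff η θ hθ (𝒜.projE_eq_of_relTEDual η θ hηθ)).1 hηθ).2.2) hη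

theorem IsSpecialChart.reducedHorVelocity_mk (h : 𝒜.IsSpecialChart W C φ)
    {X : 𝒜.spaceTE.sub 𝒜.horizontal} (hX : 𝒜.projE (𝒜.horProj₁ X) ∈ W) :
    reducedHorVelocity C (Quot.mk _ X : 𝒜.reducedHor) = horVelocity C X :=
  quotCoord_mk (pr := fun X ↦ 𝒜.projE (𝒜.horProj₁ X)) 𝒜.projE_eq_of_relHor
    (fun X Y hY hXY ↦ ((h.relHor_iff X Y hY (𝒜.projE_eq_of_relHor X Y hXY)).1 hXY).2.2) hX

/-! ### The vertical dual of the reduced cotangent bundle -/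

variable (𝒜) in
/-- The projection of the core of the reduced cotangent bundle to `M`. -/
abbrev reducedCoreProj (x : 𝒜.reducedCotangent.coreSpace) : 𝒜.spaceM :=
  𝒜.projReducedE (𝒜.reducedCotangentProj₁ (Subtype.val x))

/-- The coordinate on the core of the reduced cotangent bundle. -/
abbrev reducedCoreCoord (C : ∀ x, 𝒜.E x ≃ₗ[ℝ] (ℝ × F) × ℝ) (φ : M → EuclideanSpace ℝ (Fin d))
    (x : 𝒜.reducedCotangent.coreSpace) : EuclideanSpace ℝ (Fin d) →L[ℝ] ℝ :=
  reducedBaseCovector C φ (Subtype.val x)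

variable (𝒜) in
theorem reducedCore_isProj : 𝒜.reducedCotangent.core.IsProj 𝒜.reducedCoreProj :=
  𝒜.reducedCotangent_isProj.core

theorem IsSpecialChart.reducedCore_isCoreTriv [FiniteDimensional ℝ F]
    (h : 𝒜.IsSpecialChart W C φ) :
    DoubleVecFib.IsCoreTriv 𝒜.reducedCotangent.core (fun x ↦ Subtype.val x) 𝒜.reducedCoreProj
      𝒜.reducedCotangentProj₁ 𝒜.reducedCotangentProj₂ 𝒜.projReducedE W (reducedFibreCoord C)
      (reducedDualCoord C) (reducedBaseCovector C φ) (reducedCoreCoord C φ) :=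
  h.reducedCotangent_isDecomp.core 𝒜.reducedCotangent_isProj

variable (𝒜) in
/-- The projection of the vertical dual of the reduced cotangent bundle to `E/⟨v_A⟩`. -/
abbrev verticalDualProj₁ (ξ : 𝒜.reducedCotangent.vert.dualSpace) : 𝒜.reducedE :=
  VecFib.Dual.base ξ

variable (𝒜) in
/-- The projection of the dual of the core of the reduced cotangent bundle to `M`. -/
abbrev projCoreDual (f : 𝒜.reducedCotangent.core.dualSpace) : 𝒜.spaceM := VecFib.Dual.base f

variable (𝒜) in
theorem exists_verticalDualProj : ∃ p : 𝒜.reducedCotangent.vert.dualSpace →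
    𝒜.reducedCotangent.core.dualSpace, 𝒜.reducedCotangent.verticalDual.IsProj
      𝒜.verticalDualProj₁ p 𝒜.projReducedE 𝒜.projCoreDual :=
  DoubleVecFib.exists_isProj_verticalDualOf 𝒜.reducedCotangent_isProj 𝒜.reducedCore_isProj
    fun m ↦ by
      obtain ⟨F, _, _, _, W, C, φ, hm, h⟩ := 𝒜.exists_isSpecialChart m
      exact ⟨W, _, _, _, inferInstance, inferInstance, inferInstance, inferInstance, inferInstance,
        inferInstance, inferInstance, inferInstance, inferInstance, _, _, _, _, hm,
        h.reducedCotangent_isDecomp, h.reducedCore_isCoreTriv⟩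

variable (𝒜) in
/-- The projection of the vertical dual of the reduced cotangent bundle to the dual of the core. -/
def verticalDualProj₂ : 𝒜.reducedCotangent.vert.dualSpace → 𝒜.reducedCotangent.core.dualSpace :=
  𝒜.exists_verticalDualProj.choose

variable (𝒜) in
theorem verticalDual_isProj : 𝒜.reducedCotangent.verticalDual.IsProj 𝒜.verticalDualProj₁
    𝒜.verticalDualProj₂ 𝒜.projReducedE 𝒜.projCoreDual :=
  𝒜.exists_verticalDualProj.choose_spec

/-- The fibre component of a vector in the vertical dual in adapted coordinates. -/
abbrev dualVelocity (C : ∀ x, 𝒜.E x ≃ₗ[ℝ] (ℝ × F) × ℝ) (φ : M → EuclideanSpace ℝ (Fin d))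
    (ξ : 𝒜.reducedCotangent.vert.dualSpace) : (ℝ × F →L[ℝ] ℝ) →L[ℝ] ℝ :=
  𝒜.reducedCotangent.sideFunctional 𝒜.reducedCotangentProj₂ (reducedDualCoord C)
    (reducedBaseCovector C φ) ξ

/-- The base component of a vector in the vertical dual in adapted coordinates. -/
abbrev dualBaseVelocity (C : ∀ x, 𝒜.E x ≃ₗ[ℝ] (ℝ × F) × ℝ) (φ : M → EuclideanSpace ℝ (Fin d))
    (ξ : 𝒜.reducedCotangent.vert.dualSpace) : (EuclideanSpace ℝ (Fin d) →L[ℝ] ℝ) →L[ℝ] ℝ :=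
  𝒜.reducedCotangent.coreFunctional 𝒜.reducedCotangentProj₂ (reducedDualCoord C)
    (reducedBaseCovector C φ) ξ

theorem IsSpecialChart.dualCoord_verticalDualProj₂ [FiniteDimensional ℝ F]
    (h : 𝒜.IsSpecialChart W C φ) {ξ : 𝒜.reducedCotangent.vert.dualSpace}
    (hξ : 𝒜.projReducedE (𝒜.verticalDualProj₁ ξ) ∈ W) :
    VecFib.dualCoord 𝒜.reducedCotangent.core (reducedCoreCoord C φ) (𝒜.verticalDualProj₂ ξ) =
      dualBaseVelocity C φ ξ :=
  ((h.reducedCotangent_isDecomp.lies_iff 𝒜.reducedCotangent_isProj 𝒜.reducedCore_isProj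
    h.reducedCore_isCoreTriv hξ).1 (𝒜.verticalDual_isProj.horiz.liesOver_iff.2 rfl)).2

theorem IsSpecialChart.verticalDual_isDecomp [FiniteDimensional ℝ F]
    (h : 𝒜.IsSpecialChart W C φ) :
    𝒜.reducedCotangent.verticalDual.IsDecomp 𝒜.verticalDualProj₁ 𝒜.verticalDualProj₂
      𝒜.projReducedE 𝒜.projCoreDual W (reducedFibreCoord C)
      (VecFib.dualCoord 𝒜.reducedCotangent.core (reducedCoreCoord C φ)) (dualVelocity C φ) :=
  h.reducedCotangent_isDecomp.verticalDualOf 𝒜.reducedCotangent_isProj 𝒜.reducedCore_isProj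
    h.reducedCore_isCoreTriv 𝒜.verticalDual_isProj

theorem IsSpecialChart.verticalDual_toFun_eq [FiniteDimensional ℝ F]
    (h : 𝒜.IsSpecialChart W C φ) {ξ : 𝒜.reducedCotangent.vert.dualSpace}
    (hξ : 𝒜.projReducedE (𝒜.verticalDualProj₁ ξ) ∈ W) (η : 𝒜.reducedTEDual)
    (hη : 𝒜.reducedCotangent.vert.liesOver η (𝒜.verticalDualProj₁ ξ)) :
    VecFib.Dual.toFun ξ ⟨η, hη⟩ = dualVelocity C φ ξ (reducedDualCoord C
      (𝒜.reducedCotangentProj₂ η)) + dualBaseVelocity C φ ξ (reducedBaseCovector C φ η) :=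
  h.reducedCotangent_isDecomp.toFun_eq 𝒜.reducedCotangent_isProj hξ ⟨η, hη⟩

end SpecialAffineBundle

/-! ### The model bundle as the kernel of `α_A`. -/

namespace AffineHull

variable {V P : Type v} [AddCommGroup V] [Module ℝ V] [AddTorsor V P]

/-- In affine coordinates the hull is `F × ℝ`, the height is the last component, and the model space
is the part where it vanishes. -/
theorem exists_modelIncl_eq {F : Type*} [AddCommGroup F] [Module ℝ F] (e : P ≃ᵃ[ℝ] F) {x : Hull P}
    (hx : height P x = 0) : ∃ w : V, modelIncl (P := P) w = x := by
  refine ⟨e.linear.symm (prodEquiv e x).1, (prodEquiv e).injective ?_⟩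
  rw [prodEquiv_modelIncl, LinearEquiv.apply_symm_apply]
  exact Prod.ext rfl ((snd_prodEquiv e x).trans hx).symm

theorem height_modelIncl {F : Type*} [AddCommGroup F] [Module ℝ F] (e : P ≃ᵃ[ℝ] F) (w : V) :
    height P (modelIncl (P := P) w) = 0 := by
  rw [← snd_prodEquiv e, prodEquiv_modelIncl]

end AffineHull

namespace SpecialAffineBundle

variable {d k : ℕ} {M : Type u} [TopologicalSpace M] [ChartedSpace (EuclideanSpace ℝ (Fin d)) M]
  (𝒜 : SpecialAffineBundle.{u, v} d k M)
  {F : Type} [NormedAddCommGroup F] [NormedSpace ℝ F] {W : Set M}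
  {C : ∀ x, 𝒜.E x ≃ₗ[ℝ] (ℝ × F) × ℝ}

/-! ### The model vector bundle -/

theorem hullCoord_modelIncl (i : 𝒜.ι) (x : M) (w : 𝒜.Model x) :
    𝒜.hullCoord i x (𝒜.modelIncl x w) = ((𝒜.triv i x).linear w, 0) :=
  AffineHull.prodEquiv_modelIncl _ _

theorem modelIncl_add (x : M) (w w' : 𝒜.Model x) :
    𝒜.modelIncl x (w + w') = 𝒜.modelIncl x w + 𝒜.modelIncl x w' := by
  refine (𝒜.hullCoord (𝒜.indexAt x) x).injective ?_
  rw [map_add, hullCoord_modelIncl, hullCoord_modelIncl, hullCoord_modelIncl, map_add,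
    Prod.mk_add_mk, add_zero]

theorem modelIncl_smul (x : M) (t : ℝ) (w : 𝒜.Model x) :
    𝒜.modelIncl x (t • w) = t • 𝒜.modelIncl x w := by
  refine (𝒜.hullCoord (𝒜.indexAt x) x).injective ?_
  rw [map_smul, hullCoord_modelIncl, hullCoord_modelIncl, map_smul, Prod.smul_mk, smul_zero]

theorem modelIncl_injective (x : M) : Function.Injective (𝒜.modelIncl x) := fun w w' h ↦ by
  have h1 := congrArg (𝒜.hullCoord (𝒜.indexAt x) x) h
  rw [hullCoord_modelIncl, hullCoord_modelIncl] at h1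
  exact (𝒜.triv (𝒜.indexAt x) x).linear.injective (Prod.ext_iff.1 h1).1

/-- The embedding of the total spaces `V(A) → E`. -/
def modelTot (w : 𝒜.spaceV) : 𝒜.spaceE :=
  (⟨Sigma.fst (β := 𝒜.Model) w, 𝒜.modelIncl _ (Sigma.snd (β := 𝒜.Model) w)⟩ : 𝒜.Tot)

/-- The projection `V(A) → M`. -/
def projV (w : 𝒜.spaceV) : 𝒜.spaceM := Sigma.fst (β := 𝒜.Model) w

theorem fibV_isProj : 𝒜.fibV.IsProj 𝒜.projV where
  smooth n p hp := 𝒜.fibE_isProj.smooth n (fun t ↦ 𝒜.modelTot (p t)) hp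
  liesOver_iff := Iff.rfl
  add := by rintro _ _ _ ⟨x, a, b, rfl, rfl, rfl⟩; exact ⟨rfl, rfl⟩
  smul := by rintro t _ _ ⟨x, a, rfl, rfl⟩; rfl

variable {𝒜}

/-- The coordinate on the model vector bundle defined by an adapted frame. -/
abbrev modelCoord (C : ∀ x, 𝒜.E x ≃ₗ[ℝ] (ℝ × F) × ℝ) (w : 𝒜.spaceV) : ℝ × F :=
  (fibreCoord C (𝒜.modelTot w)).1

theorem IsSpecialFrame.fibreCoord_modelTot (h : 𝒜.IsSpecialFrame W C) {w : 𝒜.spaceV}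
    (hw : 𝒜.projV w ∈ W) : fibreCoord C (𝒜.modelTot w) = (modelCoord C w, 0) := by
  rcases w with ⟨x, w⟩
  exact Prod.ext rfl ((h.height_eq x hw _).symm.trans
    (AffineHull.height_modelIncl (𝒜.triv (𝒜.indexAt x) x) w))

theorem IsSpecialFrame.modelTot_ext (h : 𝒜.IsSpecialFrame W C) {x : M} (hx : x ∈ W)
    {w w' : 𝒜.Model x} (hc : modelCoord C (⟨x, w⟩ : Σ x, 𝒜.Model x) =
      modelCoord C (⟨x, w'⟩ : Σ x, 𝒜.Model x)) : w = w' := by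
  refine 𝒜.modelIncl_injective x ((C x).injective ?_)
  refine (h.fibreCoord_modelTot (w := (⟨x, w⟩ : Σ x, 𝒜.Model x)) hx).trans (Eq.trans ?_
    (h.fibreCoord_modelTot (w := (⟨x, w'⟩ : Σ x, 𝒜.Model x)) hx).symm)
  rw [hc]

/-- The fibre of `V(A)` is the kernel of the last coordinate of an adapted frame, so the remaining
part `ℝ × F` trivializes it; plots are compared inside `E`. -/
theorem IsSpecialFrame.fibV_isTriv (h : 𝒜.IsSpecialFrame W C) :
    𝒜.fibV.IsTriv 𝒜.projV W (modelCoord C) where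
  isOpen := h.fibE_isTriv.isOpen
  inj {w w'} hw' hw hc := by
    rcases w with ⟨x, w⟩
    rcases w' with ⟨y, w'⟩
    obtain rfl : x = y := hw
    rw [h.modelTot_ext hw' hc]
  surj := fun (x : M) hx p ↦ by
    have h0 : AffineHull.height (𝒜.Fiber x) ((C x).symm (p, 0)) = 0 := by
      rw [h.height_eq x hx, LinearEquiv.apply_symm_apply]
    obtain ⟨w, hw⟩ := AffineHull.exists_modelIncl_eq (𝒜.triv (𝒜.indexAt x) x) h0
    refine ⟨(⟨x, w⟩ : Σ x, 𝒜.Model x), rfl, ?_⟩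
    have h1 : C x (𝒜.modelIncl x w) = (p, 0) :=
      (congrArg (C x) hw).trans ((C x).apply_symm_apply (p, 0))
    exact congrArg Prod.fst h1
  contDiffOn p hp := (h.fibE_isTriv.contDiffOn (fun t ↦ 𝒜.modelTot (p t)) hp).fst
  isPlot p hU hp hc := h.fibE_isTriv.isPlot (fun t ↦ 𝒜.modelTot (p t)) hU hp
    ((hc.prodMk contDiff_const).of_eq fun t ↦ h.fibreCoord_modelTot (hU t))
  add_iff {w w' w''} hx h1 h2 := by
    rcases w with ⟨x, w⟩
    rcases w' with ⟨y, w'⟩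
    rcases w'' with ⟨z, w''⟩
    obtain rfl : x = z := h1
    obtain rfl : y = x := h2
    have key : modelCoord C (⟨y, w + w'⟩ : Σ x, 𝒜.Model x) =
        modelCoord C (⟨y, w⟩ : Σ x, 𝒜.Model x) + modelCoord C (⟨y, w'⟩ : Σ x, 𝒜.Model x) :=
      congrArg Prod.fst ((congrArg (C y) (𝒜.modelIncl_add y w w')).trans (map_add (C y) _ _))
    constructor
    · rintro ⟨x, a, b, h3, h4, h5⟩
      cases h3
      cases h4
      cases h5
      exact key
    · intro hc
      exact ⟨y, w, w', rfl, rfl, congrArg (Sigma.mk y) (h.modelTot_ext hx (hc.trans key.symm))⟩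
  smul_iff {t w w'} hx h1 := by
    rcases w with ⟨x, w⟩
    rcases w' with ⟨y, w'⟩
    obtain rfl : x = y := h1
    have key : modelCoord C (⟨x, t • w⟩ : Σ x, 𝒜.Model x) =
        t • modelCoord C (⟨x, w⟩ : Σ x, 𝒜.Model x) :=
      congrArg Prod.fst ((congrArg (C x) (𝒜.modelIncl_smul x t w)).trans (map_smul (C x) _ _))
    constructor
    · rintro ⟨x, a, h3, h4⟩
      cases h3
      cases h4
      exact key
    · intro hc
      exact ⟨x, w, rfl, congrArg (Sigma.mk x) (h.modelTot_ext hx (hc.trans key.symm))⟩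

end SpecialAffineBundle

namespace SpecialAffineBundle

variable {d k : ℕ} {M : Type u} [TopologicalSpace M] [ChartedSpace (EuclideanSpace ℝ (Fin d)) M]
  {𝒜 : SpecialAffineBundle.{u, v} d k M} [IsManifold (𝓡 d) ∞ M]
  {F : Type} [NormedAddCommGroup F] [NormedSpace ℝ F] {W : Set M}
  {C : ∀ x, 𝒜.E x ≃ₗ[ℝ] (ℝ × F) × ℝ} {φ : M → EuclideanSpace ℝ (Fin d)}

/-! ### The pairing between the reduced bundles -/

/-- The vector `ξ` of the vertical dual is the functional `[η] ↦ ⟨η, X⟩`. -/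
def IsPairing (X : 𝒜.spaceTE.sub 𝒜.horizontal) (ξ : 𝒜.reducedCotangent.vert.dualSpace) : Prop :=
  ∀ (η : 𝒜.spaceTEDual)
    (h : 𝒜.tangentDouble.vert.liesOver (Subtype.val X) (𝒜.cotangentBase η))
    (h' : 𝒜.reducedCotangent.vert.liesOver (Quot.mk _ η) (𝒜.verticalDualProj₁ ξ)),
    VecFib.Dual.toFun ξ ⟨Quot.mk _ η, h'⟩ = VecFib.Dual.toFun η ⟨Subtype.val X, h⟩

/-- A horizontal vector does not see the last component of a fibre covector, so its pairing with a
covector depends only on the reduced components of the covector. As these are arbitrary, a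
functional on the reduced fibre agrees with the pairing exactly when its two components are the
evaluations at the two velocities. -/
theorem IsSpecialChart.isPairing_iff [FiniteDimensional ℝ F] (h : 𝒜.IsSpecialChart W C φ)
    {X : 𝒜.spaceTE.sub 𝒜.horizontal} (hX : 𝒜.projE (𝒜.horProj₁ X) ∈ W)
    {ξ : 𝒜.reducedCotangent.vert.dualSpace}
    (hξ : 𝒜.verticalDualProj₁ ξ = (Quot.mk _ (𝒜.horProj₁ X) : 𝒜.reducedE)) :
    IsPairing X ξ ↔
      dualBaseVelocity C φ ξ = evalEquiv _ (dcoord (𝓡 d) φ (𝒜.horProj₂ X)) ∧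
      dualVelocity C φ ξ = evalEquiv _ (horVelocity C X) := by
  have hξW : 𝒜.projReducedE (𝒜.verticalDualProj₁ ξ) ∈ W := by rw [hξ]; exact hX
  have hbase : ∀ {η : 𝒜.spaceTEDual}, 𝒜.cotangentBase η = 𝒜.horProj₁ X →
      𝒜.projE (𝒜.cotangentBase η) ∈ W := fun hη ↦ by rw [hη]; exact hX
  have hl : ∀ (η : 𝒜.spaceTEDual) (hη : 𝒜.cotangentBase η = 𝒜.horProj₁ X)
      (h' : 𝒜.reducedCotangent.vert.liesOver (Quot.mk _ η) (𝒜.verticalDualProj₁ ξ)),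
      VecFib.Dual.toFun ξ ⟨Quot.mk _ η, h'⟩ =
        dualVelocity C φ ξ (dropHeight F (fibreCovector C φ η)) +
          dualBaseVelocity C φ ξ (baseCovector C φ η) := fun η hη h' ↦ by
    refine (h.verticalDual_toFun_eq hξW _ h').trans ?_
    rw [h.reducedDualCoord_mk (hbase hη), h.reducedBaseCovector_mk (hbase hη)]
  have hr : ∀ (η : 𝒜.spaceTEDual) (hη : 𝒜.cotangentBase η = 𝒜.horProj₁ X)
      (h' : 𝒜.tangentDouble.vert.liesOver (Subtype.val X) (𝒜.cotangentBase η)),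
      VecFib.Dual.toFun η ⟨Subtype.val X, h'⟩ =
        dropHeight F (fibreCovector C φ η) (horVelocity C X) +
          baseCovector C φ η (dcoord (𝓡 d) φ (𝒜.horProj₂ X)) := fun η hη h' ↦ by
    rw [h.toFun_eq (hbase hη), (h.mem_horizontal_iff _ hX).1 (Subtype.property X), add_comm]
    rfl
  constructor
  · intro hp
    have key : ∀ y z, dualVelocity C φ ξ z + dualBaseVelocity C φ ξ y =
        z (horVelocity C X) + y (dcoord (𝓡 d) φ (𝒜.horProj₂ X)) := by
      intro y z
      -- `liftHeight` extends `z` by zero on the last coordinate, so some covector at the given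
      -- point has the prescribed reduced components `(z, y)`.
      obtain ⟨f, hf, hfz⟩ := h.cotangentDouble_isDecomp.side₂.surj _ hX (liftHeight F z)
      obtain ⟨η, hη, rfl, rfl⟩ :=
        h.cotangentDouble_isDecomp.exists_mk 𝒜.cotangentDouble_isProj hX hf y
      have h1 := hp η (𝒜.tangentDouble_isProj.vert.liesOver_iff.2 hη.symm)
        (𝒜.reducedCotangent_isProj.vert.liesOver_iff.2
          ((congrArg (Quot.mk 𝒜.relE) hη).trans hξ.symm))
      rw [h.dualCoord_cotangentProj (hbase hη)] at hfz
      rwa [hl η hη, hr η hη, hfz, dropHeight_liftHeight] at h1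
    refine ⟨ContinuousLinearMap.ext fun y ↦ ?_, ContinuousLinearMap.ext fun z ↦ ?_⟩
    · have h1 := key y 0
      rw [map_zero, zero_add, zero_apply, zero_add] at h1
      exact h1
    · have h1 := key 0 z
      rw [map_zero, add_zero, zero_apply, add_zero] at h1
      exact h1
  · rintro ⟨h1, h2⟩ η hη hη'
    have hη : 𝒜.cotangentBase η = 𝒜.horProj₁ X :=
      (𝒜.tangentDouble_isProj.vert.liesOver_iff.1 hη).symm
    rw [hl η hη, hr η hη, h1, h2, evalEquiv_apply, evalEquiv_apply]

/-- The vector `ξ` of the vertical dual corresponds to the orbit `ζ` of horizontal vectors. -/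
def IsOrbitPairing (ζ : 𝒜.reducedHor) (ξ : 𝒜.reducedCotangent.vert.dualSpace) : Prop :=
  𝒜.verticalDualProj₁ ξ = 𝒜.reducedHorProj₁ ζ ∧
    ∀ X : 𝒜.spaceTE.sub 𝒜.horizontal, Quot.mk _ X = ζ → IsPairing X ξ

/-- The coordinate condition involves the orbit only. So the pairing condition for one
representative is equivalent to that for all, which is the independence of the representative. -/
theorem IsSpecialChart.isOrbitPairing_iff [FiniteDimensional ℝ F]
    (h : 𝒜.IsSpecialChart W C φ) {ζ : 𝒜.reducedHor}
    (hζ : 𝒜.projReducedE (𝒜.reducedHorProj₁ ζ) ∈ W) {ξ : 𝒜.reducedCotangent.vert.dualSpace} :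
    IsOrbitPairing ζ ξ ↔ 𝒜.verticalDualProj₁ ξ = 𝒜.reducedHorProj₁ ζ ∧
      VecFib.dualCoord 𝒜.reducedCotangent.core (reducedCoreCoord C φ) (𝒜.verticalDualProj₂ ξ) =
        evalEquiv _ (dcoord (𝓡 d) φ (𝒜.reducedHorProj₂ ζ)) ∧
      dualVelocity C φ ξ = evalEquiv _ (reducedHorVelocity C ζ) := by
  refine and_congr_right fun hξ ↦ ?_
  have hξW : 𝒜.projReducedE (𝒜.verticalDualProj₁ ξ) ∈ W := by rwa [hξ]
  rw [h.dualCoord_verticalDualProj₂ hξW]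
  constructor
  · intro h1
    obtain ⟨X, rfl⟩ := Quot.exists_rep ζ
    rw [h.reducedHorVelocity_mk hζ]
    exact (h.isPairing_iff hζ hξ).1 (h1 X rfl)
  · rintro h1 X rfl
    rw [h.reducedHorVelocity_mk hζ] at h1
    exact (h.isPairing_iff hζ hξ).2 h1

variable (𝒜)

/-- In adapted coordinates the pairing is the identity on the point modulo `v_A` and the canonical
map to the double dual on both velocities, hence the graph of a linear isomorphism. -/
theorem exists_orbitPairingEquiv : ∃ Ψ : 𝒜.reducedHor ≃ 𝒜.reducedCotangent.vert.dualSpace,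
    ∀ ζ ξ, Ψ ζ = ξ ↔ IsOrbitPairing ζ ξ := by
  refine exists_equiv_of_charts (pr := fun ζ ↦ 𝒜.projReducedE (𝒜.reducedHorProj₁ ζ))
    (pr' := fun ξ ↦ 𝒜.projReducedE (𝒜.verticalDualProj₁ ξ)) IsOrbitPairing
    (fun ζ ξ h ↦ congrArg 𝒜.projReducedE h.1) fun m ↦ ?_
  obtain ⟨F, _, _, _, W, C, φ, hm, h⟩ := 𝒜.exists_isSpecialChart m
  refine ⟨W, _, _, inferInstance, inferInstance, inferInstance, inferInstance, _, _,
    (ContinuousLinearEquiv.refl ℝ (F × ℝ)).prodCongr ((evalEquiv _).prodCongr (evalEquiv _)), hm,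
    h.reducedHorizontal_isDecomp.total, h.verticalDual_isDecomp.total, fun ζ ξ hζ hξ ↦ ?_⟩
  rw [h.isOrbitPairing_iff hζ]
  constructor
  · rintro ⟨h1, h2, h3⟩
    exact Prod.ext (congrArg (reducedFibreCoord C) h1) (Prod.ext h2 h3)
  · intro hc
    obtain ⟨h1, h2⟩ := Prod.ext_iff.1 hc
    obtain ⟨h2, h3⟩ := Prod.ext_iff.1 h2
    exact ⟨h.verticalDual_isDecomp.side₁.inj hζ hξ h1, h2, h3⟩

variable {𝒜}

set_option synthInstance.maxHeartbeats 400000 in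
-- The core of the reduced cotangent bundle is locally `(ℝ^d)*`, so its dual is locally the double
-- dual of the fibre of `TM`. The map induced by `Ψ` on second sides is evaluation there and does
-- not depend on the orbit chosen over `Z`.
theorem exists_tangentCoreDualEquiv {Ψ : 𝒜.reducedHor ≃ 𝒜.reducedCotangent.vert.dualSpace}
    (hΨ : ∀ ζ ξ, Ψ ζ = ξ ↔ IsOrbitPairing ζ ξ) :
    ∃ ψ : 𝒜.spaceTM ≃ 𝒜.reducedCotangent.core.dualSpace,
      ∀ Z f, ψ Z = f ↔ ∃ ζ, 𝒜.reducedHorProj₂ ζ = Z ∧ 𝒜.verticalDualProj₂ (Ψ ζ) = f := by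
  have hbase : ∀ ζ, 𝒜.projCoreDual (𝒜.verticalDualProj₂ (Ψ ζ)) =
      𝒜.projTM (𝒜.reducedHorProj₂ ζ) := fun ζ ↦ by
    rw [𝒜.verticalDual_isProj.comm, 𝒜.reducedHorizontal_isProj.comm, ((hΨ ζ _).1 rfl).1]
  refine exists_equiv_of_charts (pr := 𝒜.projTM) (pr' := 𝒜.projCoreDual) _
    (fun Z f ⟨ζ, h1, h2⟩ ↦ ?_) fun m ↦ ?_
  · rw [← h1, ← h2, hbase]
  obtain ⟨F, _, _, _, W, C, φ, hm, h⟩ := 𝒜.exists_isSpecialChart m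
  refine ⟨W, _, _, inferInstance, inferInstance, inferInstance, inferInstance, _, _,
    evalEquiv (EuclideanSpace ℝ (Fin d)), hm, h.reducedHorizontal_isDecomp.side₂.toIsChart,
    h.verticalDual_isDecomp.side₂.toIsChart, fun Z f hZ hf ↦ ?_⟩
  have hcoord : ∀ ζ, 𝒜.projTM (𝒜.reducedHorProj₂ ζ) ∈ W → _ := fun ζ hζ ↦
    ((h.isOrbitPairing_iff (ζ := ζ) (by rw [← 𝒜.reducedHorizontal_isProj.comm]; exact hζ)).1
      ((hΨ ζ _).1 rfl)).2.1
  constructor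
  · rintro ⟨ζ, rfl, rfl⟩
    exact hcoord ζ hZ
  · intro hc
    -- Any orbit over `Z` will do; the one with zero remaining coordinates is taken.
    obtain ⟨ζ, rfl, -⟩ := (h.reducedHorizontal_isDecomp.horiz 𝒜.reducedHorizontal_isProj).surj Z hZ 0
    refine ⟨ζ, rfl, h.verticalDual_isDecomp.side₂.inj (by rw [hf]; exact hZ)
      ((hbase ζ).trans hf.symm) ((hcoord ζ hZ).trans hc.symm)⟩

/-! ### The cores -/

variable (𝒜) in
-- The fibre velocity of the vertical vector is the coordinate of `w`, whose last component is its
-- height, which is zero.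
theorem coreLift_modelTot_mem_horizontal (w : 𝒜.spaceV) :
    𝒜.coreLift (𝒜.modelTot w) ∈ 𝒜.horizontal := by
  obtain ⟨F, _, _, _, W, C, φ, hm, h⟩ := 𝒜.exists_isSpecialChart (𝒜.projV w)
  have h1 : fibreVelocity C (𝒜.coreLift (𝒜.modelTot w)) = fibreCoord C (𝒜.modelTot w) :=
    (h.coreLift_isCoreTriv φ).c_eq _ hm
  have h2 : 𝒜.projE (𝒜.projTE (𝒜.coreLift (𝒜.modelTot w))) ∈ W := hm
  rw [h.mem_horizontal_iff _ h2, h1, h.fibreCoord_modelTot hm]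
  rfl

variable (𝒜) in
/-- The orbit of the vertical vector defined by a vector of the model bundle. -/
def orbitLift (w : 𝒜.spaceV) : 𝒜.reducedHor :=
  Quot.mk _ ⟨𝒜.coreLift (𝒜.modelTot w), 𝒜.coreLift_modelTot_mem_horizontal w⟩

theorem IsSpecialChart.coords_orbitLift (h : 𝒜.IsSpecialChart W C φ) {w : 𝒜.spaceV}
    (hw : 𝒜.projV w ∈ W) : reducedFibreCoord C (𝒜.reducedHorProj₁ (𝒜.orbitLift w)) = 0 ∧
      dcoord (𝓡 d) φ (𝒜.reducedHorProj₂ (𝒜.orbitLift w)) = 0 ∧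
      reducedHorVelocity C (𝒜.orbitLift w) = modelCoord C w := by
  have hc := h.coreLift_isCoreTriv φ
  have h1 : 𝒜.projE (𝒜.projTE (𝒜.coreLift (𝒜.modelTot w))) ∈ W := hw
  refine ⟨?_, hc.b_eq (𝒜.modelTot w) hw, ?_⟩
  · exact (h.reducedFibreCoord_mk h1).trans
      ((congrArg (dropSpecial F) (hc.a_eq (𝒜.modelTot w) hw)).trans (map_zero _))
  · exact (h.reducedHorVelocity_mk (X := ⟨_, 𝒜.coreLift_modelTot_mem_horizontal w⟩) h1).trans
      (congrArg Prod.fst (hc.c_eq (𝒜.modelTot w) hw))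

variable (𝒜) in
/-- The projection of the core of the bundle of orbits of horizontal vectors to `M`. -/
abbrev horCoreProj (x : 𝒜.reducedHorizontal.coreSpace) : 𝒜.spaceM :=
  𝒜.projReducedE (𝒜.reducedHorProj₁ (Subtype.val x))

variable (𝒜) in
-- The orbit lift of `w` has both side coordinates zero and core coordinate equal to that of `w`.
-- The core is described by precisely these conditions, so in charts the map is the identity of `ℝ ×
-- F`.
theorem exists_horCoreEquiv : ∃ κ : 𝒜.spaceV ≃ 𝒜.reducedHorizontal.coreSpace,
    ∀ w x, κ w = x ↔ Subtype.val x = 𝒜.orbitLift w := by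
  refine exists_equiv_of_charts (pr := 𝒜.projV) (pr' := 𝒜.horCoreProj) _
    (fun w x h ↦ congrArg (fun ζ ↦ 𝒜.projReducedE (𝒜.reducedHorProj₁ ζ)) h) fun m ↦ ?_
  obtain ⟨F, _, _, _, W, C, φ, hm, h⟩ := 𝒜.exists_isSpecialChart m
  have hc := h.reducedHorizontal_isDecomp.core 𝒜.reducedHorizontal_isProj
  refine ⟨W, _, _, inferInstance, inferInstance, inferInstance, inferInstance, _, _,
    .refl ℝ _, hm, h.fibV_isTriv.toIsChart, hc.triv.toIsChart, fun w x hw hx ↦ ?_⟩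
  obtain ⟨h1, h2, h3⟩ := h.coords_orbitLift hw
  constructor
  · intro he
    exact (congrArg (reducedHorVelocity C) he).trans h3
  · intro he
    have hxW : 𝒜.horCoreProj x ∈ W := by rw [hx]; exact hw
    refine h.reducedHorizontal_isDecomp.total.inj hw hx ?_
    rw [h1, h2, h3]
    exact Prod.ext (hc.a_eq x hxW) (Prod.ext (hc.b_eq x hxW) he)

variable (𝒜) in
/-- The projection of the core of the vertical dual to `M`. -/
abbrev verticalDualCoreProj (x : 𝒜.reducedCotangent.verticalDual.coreSpace) : 𝒜.spaceM :=
  𝒜.projReducedE (𝒜.verticalDualProj₁ (Subtype.val x))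

set_option synthInstance.maxHeartbeats 400000 in
theorem exists_verticalDualCoreEquiv {Ψ : 𝒜.reducedHor ≃ 𝒜.reducedCotangent.vert.dualSpace}
    (hΨ : ∀ ζ ξ, Ψ ζ = ξ ↔ IsOrbitPairing ζ ξ) :
    ∃ κ : 𝒜.spaceV ≃ 𝒜.reducedCotangent.verticalDual.coreSpace,
    ∀ w x, κ w = x ↔ Subtype.val x = Ψ (𝒜.orbitLift w) := by
  have hbase : ∀ w, 𝒜.projReducedE (𝒜.verticalDualProj₁ (Ψ (𝒜.orbitLift w))) = 𝒜.projV w :=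
    fun w ↦ by
      rw [((hΨ (𝒜.orbitLift w) _).1 rfl).1]
      rfl
  refine exists_equiv_of_charts (pr := 𝒜.projV) (pr' := 𝒜.verticalDualCoreProj) _
    (fun w x h ↦ ?_) fun m ↦ ?_
  · exact (congrArg (fun ξ ↦ 𝒜.projReducedE (𝒜.verticalDualProj₁ ξ)) h).trans (hbase w)
  obtain ⟨F, _, _, _, W, C, φ, hm, h⟩ := 𝒜.exists_isSpecialChart m
  have hc := h.verticalDual_isDecomp.core 𝒜.verticalDual_isProj
  refine ⟨W, _, _, inferInstance, inferInstance, inferInstance, inferInstance, _, _,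
    evalEquiv (ℝ × F), hm, h.fibV_isTriv.toIsChart, hc.triv.toIsChart, fun w x hw hx ↦ ?_⟩
  obtain ⟨h1, h2, h3⟩ := h.coords_orbitLift hw
  obtain ⟨e1, e2, e3⟩ := (h.isOrbitPairing_iff (ζ := 𝒜.orbitLift w) hw).1 ((hΨ _ _).1 rfl)
  -- The base velocity of the orbit lift is zero, so its image under `Ψ` lies over the zero vector
  -- of the dual of the core.
  rw [h2, ContinuousLinearEquiv.map_zero] at e2
  rw [h3] at e3
  constructor
  · intro he
    exact (congrArg (dualVelocity C φ) he).trans e3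
  · intro he
    have hxW : 𝒜.verticalDualCoreProj x ∈ W := by rw [hx]; exact hw
    refine h.verticalDual_isDecomp.total.inj (by rw [hbase]; exact hw) (hx.trans (hbase w).symm) ?_
    rw [e1, h1, e2, e3]
    exact Prod.ext (hc.a_eq x hxW) (Prod.ext (hc.b_eq x hxW) he)

end SpecialAffineBundle

namespace SpecialAffineBundle

variable {d k : ℕ} {M : Type u} [TopologicalSpace M] [ChartedSpace (EuclideanSpace ℝ (Fin d)) M]
  [IsManifold (𝓡 d) ∞ M] (𝒜 : SpecialAffineBundle.{u, v} d k M)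

/-! ### The reduced bundles are double vector bundles -/

theorem reducedCotangent_isDoubleVectorBundle : 𝒜.reducedCotangent.IsDoubleVectorBundle :=
  𝒜.reducedCotangent_isProj.isDoubleVectorBundle fun m ↦ by
    obtain ⟨F, _, _, _, W, C, φ, hm, h⟩ := 𝒜.exists_isSpecialChart m
    exact ⟨W, _, _, _, inferInstance, inferInstance, inferInstance, inferInstance, inferInstance,
      inferInstance, inferInstance, inferInstance, inferInstance, _, _, _, hm,
      h.reducedCotangent_isDecomp⟩

set_option synthInstance.maxHeartbeats 400000 in
theorem verticalDual_isDoubleVectorBundle :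
    𝒜.reducedCotangent.verticalDual.IsDoubleVectorBundle :=
  𝒜.verticalDual_isProj.isDoubleVectorBundle fun m ↦ by
    obtain ⟨F, _, _, _, W, C, φ, hm, h⟩ := 𝒜.exists_isSpecialChart m
    exact ⟨W, _, _, _, inferInstance, inferInstance, inferInstance, inferInstance, inferInstance,
      inferInstance, inferInstance, inferInstance, inferInstance, _, _, _, hm,
      h.verticalDual_isDecomp⟩

theorem reducedHorizontal_isDoubleVectorBundle : 𝒜.reducedHorizontal.IsDoubleVectorBundle :=
  𝒜.reducedHorizontal_isProj.isDoubleVectorBundle fun m ↦ by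
    obtain ⟨F, _, _, _, W, C, φ, hm, h⟩ := 𝒜.exists_isSpecialChart m
    exact ⟨W, _, _, _, inferInstance, inferInstance, inferInstance, inferInstance, inferInstance,
      inferInstance, inferInstance, inferInstance, inferInstance, _, _, _, hm,
      h.reducedHorizontal_isDecomp⟩

theorem fibV_isVectorBundle : 𝒜.fibV.IsVectorBundle :=
  𝒜.fibV_isProj.isVectorBundle fun m ↦ by
    obtain ⟨F, _, _, _, W, C, φ, hm, h⟩ := 𝒜.exists_isSpecialChart m
    exact ⟨W, _, inferInstance, inferInstance, inferInstance, _, hm, h.fibV_isTriv⟩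

/-! ### The isomorphisms -/

variable {𝒜}

set_option synthInstance.maxHeartbeats 400000 in
-- In the two adapted decompositions `Ψ` is diagonal: the identity on the first side and evaluation
-- on the second side and the core.
theorem isIso_of_orbitPairing {Ψ : 𝒜.reducedHor ≃ 𝒜.reducedCotangent.vert.dualSpace}
    (hΨ : ∀ ζ ξ, Ψ ζ = ξ ↔ IsOrbitPairing ζ ξ)
    {ψ : 𝒜.spaceTM ≃ 𝒜.reducedCotangent.core.dualSpace}
    (hψ : ∀ Z f, ψ Z = f ↔ ∃ ζ, 𝒜.reducedHorProj₂ ζ = Z ∧ 𝒜.verticalDualProj₂ (Ψ ζ) = f) :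
    𝒜.reducedHorizontal.IsIso 𝒜.reducedCotangent.verticalDual Ψ (Equiv.refl _) ψ := by
  have hp₁ : ∀ ζ, 𝒜.verticalDualProj₁ (Ψ ζ) = 𝒜.reducedHorProj₁ ζ :=
    fun ζ ↦ ((hΨ ζ _).1 rfl).1
  have hp₂ : ∀ ζ, 𝒜.verticalDualProj₂ (Ψ ζ) = ψ (𝒜.reducedHorProj₂ ζ) :=
    fun ζ ↦ ((hψ _ _).2 ⟨ζ, rfl, rfl⟩).symm
  have hlift : ∀ Z, ∃ ζ, 𝒜.reducedHorProj₂ ζ = Z := fun Z ↦ by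
    obtain ⟨ζ, hζ, -⟩ := (hψ Z _).1 rfl
    exact ⟨ζ, hζ⟩
  refine DoubleVecFib.isIso_of_isDecomp 𝒜.reducedHorizontal_isProj 𝒜.verticalDual_isProj hp₁ hp₂
    (fun _ ↦ rfl) (fun Z ↦ ?_) fun m ↦ ?_
  · obtain ⟨ζ, rfl⟩ := hlift Z
    rw [← hp₂, 𝒜.verticalDual_isProj.comm, 𝒜.reducedHorizontal_isProj.comm, hp₁]
  obtain ⟨F, _, _, _, W, C, φ, hm, h⟩ := 𝒜.exists_isSpecialChart m
  have hcoord := fun ζ (hζ : 𝒜.projReducedE (𝒜.reducedHorProj₁ ζ) ∈ W) ↦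
    (h.isOrbitPairing_iff hζ).1 ((hΨ ζ _).1 rfl)
  refine ⟨W, _, _, _, _, _, _, inferInstance, inferInstance, inferInstance, inferInstance,
    inferInstance, inferInstance, inferInstance, inferInstance, inferInstance, inferInstance,
    inferInstance, inferInstance, _, _, _, _, _, _, .refl ℝ _, evalEquiv _, evalEquiv _, hm,
    h.reducedHorizontal_isDecomp, h.verticalDual_isDecomp, fun _ _ ↦ rfl, fun Z hZ ↦ ?_,
    fun ζ hζ ↦ (hcoord ζ hζ).2.2⟩
  obtain ⟨ζ, rfl⟩ := hlift Z
  rw [← hp₂]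
  exact (hcoord ζ (by rw [← 𝒜.reducedHorizontal_isProj.comm]; exact hZ)).2.1

theorem isIso_horCore {κ : 𝒜.spaceV ≃ 𝒜.reducedHorizontal.coreSpace}
    (hκ : ∀ w x, κ w = x ↔ Subtype.val x = 𝒜.orbitLift w) :
    𝒜.fibV.IsIso 𝒜.reducedHorizontal.core κ (Equiv.refl _) := by
  have hval : ∀ w, Subtype.val (κ w) = 𝒜.orbitLift w := fun w ↦ (hκ w _).1 rfl
  refine VecFib.isIso_of_isTriv 𝒜.fibV_isProj 𝒜.reducedHorizontal_isProj.core dSmooth_id dSmooth_id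
    (fun w ↦ congrArg (fun ζ ↦ 𝒜.projReducedE (𝒜.reducedHorProj₁ ζ)) (hval w)) fun m ↦ ?_
  obtain ⟨F, _, _, _, W, C, φ, hm, h⟩ := 𝒜.exists_isSpecialChart m
  exact ⟨W, W, _, _, inferInstance, inferInstance, inferInstance, inferInstance, _, _,
    .refl ℝ _, hm, fun _ ↦ Iff.rfl, h.fibV_isTriv,
    (h.reducedHorizontal_isDecomp.core 𝒜.reducedHorizontal_isProj).triv, fun w hw ↦
    (congrArg (reducedHorVelocity C) (hval w)).trans (h.coords_orbitLift hw).2.2⟩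

set_option synthInstance.maxHeartbeats 400000 in
theorem isIso_verticalDualCore {Ψ : 𝒜.reducedHor ≃ 𝒜.reducedCotangent.vert.dualSpace}
    (hΨ : ∀ ζ ξ, Ψ ζ = ξ ↔ IsOrbitPairing ζ ξ)
    {κ : 𝒜.spaceV ≃ 𝒜.reducedCotangent.verticalDual.coreSpace}
    (hκ : ∀ w x, κ w = x ↔ Subtype.val x = Ψ (𝒜.orbitLift w)) :
    𝒜.fibV.IsIso 𝒜.reducedCotangent.verticalDual.core κ (Equiv.refl _) := by
  have hval : ∀ w, Subtype.val (κ w) = Ψ (𝒜.orbitLift w) := fun w ↦ (hκ w _).1 rfl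
  refine VecFib.isIso_of_isTriv 𝒜.fibV_isProj 𝒜.verticalDual_isProj.core dSmooth_id dSmooth_id
    (fun w ↦ (congrArg (fun ξ ↦ 𝒜.projReducedE (𝒜.verticalDualProj₁ ξ)) (hval w)).trans
      (congrArg 𝒜.projReducedE ((hΨ (𝒜.orbitLift w) _).1 rfl).1)) fun m ↦ ?_
  obtain ⟨F, _, _, _, W, C, φ, hm, h⟩ := 𝒜.exists_isSpecialChart m
  refine ⟨W, W, _, _, inferInstance, inferInstance, inferInstance, inferInstance, _, _,
    evalEquiv (ℝ × F), hm, fun _ ↦ Iff.rfl, h.fibV_isTriv,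
    (h.verticalDual_isDecomp.core 𝒜.verticalDual_isProj).triv, fun w hw ↦ ?_⟩
  have h3 := ((h.isOrbitPairing_iff (ζ := 𝒜.orbitLift w) hw).1 ((hΨ _ _).1 rfl)).2.2
  rw [(h.coords_orbitLift hw).2.2] at h3
  exact (congrArg (dualVelocity C φ) (hval w)).trans h3

end SpecialAffineBundle

/-! ### The main theorem. -/

theorem mainTheorem12 {d k : ℕ} {M : Type u} [TopologicalSpace M]
    [ChartedSpace (EuclideanSpace ℝ (Fin d)) M] [IsManifold (𝓡 d) ∞ M]
    (𝒜 : SpecialAffineBundle.{u, v} d k M) :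
    𝒜.reducedCotangent.IsDoubleVectorBundle ∧
    𝒜.reducedCotangent.verticalDual.IsDoubleVectorBundle ∧
    𝒜.reducedHorizontal.IsDoubleVectorBundle ∧
    𝒜.fibV.IsVectorBundle ∧
    ∃ (Ψ : 𝒜.reducedHor ≃ 𝒜.reducedCotangent.vert.dualSpace)
      (ψ : 𝒜.spaceTM ≃ 𝒜.reducedCotangent.core.dualSpace),
      𝒜.reducedHorizontal.IsIso 𝒜.reducedCotangent.verticalDual Ψ (Equiv.refl _) ψ ∧
      (∀ (X : 𝒜.horizontal) (η : 𝒜.spaceTEDual)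
        (h : 𝒜.tangentDouble.vert.liesOver X.1 (VecFib.Dual.base η)),
        ∃ h' : 𝒜.reducedCotangent.vert.liesOver (Quot.mk _ η)
            (VecFib.Dual.base (Ψ (Quot.mk _ X))),
          VecFib.Dual.toFun (Ψ (Quot.mk _ X)) ⟨Quot.mk _ η, h'⟩ =
            VecFib.Dual.toFun η ⟨X.1, h⟩) ∧
      ∃ (κ : 𝒜.spaceV ≃ 𝒜.reducedHorizontal.coreSpace)
        (κ' : 𝒜.spaceV ≃ 𝒜.reducedCotangent.verticalDual.coreSpace),
        𝒜.fibV.IsIso 𝒜.reducedHorizontal.core κ (Equiv.refl _) ∧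
        𝒜.fibV.IsIso 𝒜.reducedCotangent.verticalDual.core κ' (Equiv.refl _) ∧
        (∀ (x : M) (w : 𝒜.Model x),
          ∃ h : 𝒜.coreLift (⟨x, 𝒜.modelIncl x w⟩ : 𝒜.Tot) ∈ 𝒜.horizontal,
            Subtype.val (κ (⟨x, w⟩ : Σ x, 𝒜.Model x)) =
              Quot.mk _ ⟨𝒜.coreLift (⟨x, 𝒜.modelIncl x w⟩ : 𝒜.Tot), h⟩) ∧
        ∀ w, Subtype.val (κ' w) = Ψ (Subtype.val (κ w)) := by
  obtain ⟨Ψ, hΨ⟩ := 𝒜.exists_orbitPairingEquiv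
  obtain ⟨ψ, hψ⟩ := SpecialAffineBundle.exists_tangentCoreDualEquiv hΨ
  obtain ⟨κ, hκ⟩ := 𝒜.exists_horCoreEquiv
  obtain ⟨κ', hκ'⟩ := SpecialAffineBundle.exists_verticalDualCoreEquiv hΨ
  refine ⟨𝒜.reducedCotangent_isDoubleVectorBundle, 𝒜.verticalDual_isDoubleVectorBundle,
    𝒜.reducedHorizontal_isDoubleVectorBundle, 𝒜.fibV_isVectorBundle, Ψ, ψ,
    SpecialAffineBundle.isIso_of_orbitPairing hΨ hψ, fun X η h ↦ ?_, κ, κ',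
    SpecialAffineBundle.isIso_horCore hκ, SpecialAffineBundle.isIso_verticalDualCore hΨ hκ',
    fun x w ↦ ⟨𝒜.coreLift_modelTot_mem_horizontal ⟨x, w⟩, (hκ ⟨x, w⟩ _).1 rfl⟩, fun w ↦ ?_⟩
  · obtain ⟨hbase, hpair⟩ := (hΨ (Quot.mk _ X) _).1 rfl
    -- `X` and `η` have the same base point in `E`, so the orbit of `η` lies over the point of
    -- `E/⟨v_A⟩` at which the functional `Ψ [X]` is defined.
    have h' : 𝒜.reducedCotangent.vert.liesOver (Quot.mk _ η)
        (𝒜.verticalDualProj₁ (Ψ (Quot.mk _ X))) := 𝒜.reducedCotangent_isProj.vert.liesOver_iff.2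
      ((congrArg (Quot.mk 𝒜.relE) (𝒜.tangentDouble_isProj.vert.liesOver_iff.1 h).symm).trans
        hbase.symm)
    exact ⟨h', hpair X rfl η h h'⟩
  · exact ((hκ' w _).1 rfl).trans (congrArg Ψ ((hκ w _).1 rfl).symm)
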